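/- A symplectic Monge–Ampère equation in three independent variables, for $u(x^1,x^2,x^3)$ with Hessian matrix $U=(u_{ij})$, is a PDE $F(U)=0$ with constant coefficients $(\epsilon,h_i,g_i,s_i,\tau_i,\nu)$, not all zero, where $$F(U)=\epsilon\det U+h_1(u_{22}u_{33}-u_{23}^2)+h_2(u_{11}u_{33}-u_{13}^2)+h_3(u_{11}u_{22}-u_{12}^2)$$ $$+g_1(u_{11}u_{23}-u_{12}u_{13})+g_2(u_{22}u_{13}-u_{12}u_{23})+g_3(u_{33}u_{12}-u_{13}u_{23})+s_1u_{11}+s_2u_{22}+s_3u_{33}+\tau_1u_{23}+\tau_2u_{13}+\tau_3u_{12}+\nu .$$ **Linearizability.** Let $K=\mathbb R$ or $\mathbb C$ be the field of coefficients. The equation is *linearizable* if there are a symplectic matrix $\begin{pmatrix}A&B\\C&D\end{pmatrix}\in Sp(6,K)$ and a linear equation $L(\tilde U)=\sum_i s_i'\tilde u_{ii}+\tau_1'\tilde u_{23}+\tau_2'\tilde u_{13}+\tau_3'\tilde u_{12}+\nu'=0$ with $(s',\tau')\ne0$, such that $F(U)=\det(CU+D)\,L\big((AU+B)(CU+D)^{-1}\big)$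 for all symmetric $U$ over $K$ with $\det(CU+D)\neq0$. **Integrability.** Everything here is complex analytic; write $(x,y,t)=(x^1,x^2,x^3)$. An *$n$-component hydrodynamic reduction* consists of symmetric matrices $U(R)$ with $F(U(R))=0$ and pairs of characteristic speeds $(\mu^i(R),\lambda^i(R))$, distinct for different $i$, holomorphic in $R=(R^1,\dots,R^n)$, with $\partial_{R^i}u_{11}\ne0$, such that the systems $R^i_y=\mu^i(R)R^i_x$, $R^i_t=\lambda^i(R)R^i_x$ commute, i.e. $\partial_j\lambda^i(\mu^j-\mu^i)=\partial_j\mu^i(\lambda^j-\lambda^i)$ for $i\ne j$, and such that by virtue of these systems $\partial_{x^k}u_{jl}=\partial_{x^j}u_{kl}$ for all $j,k,l$. A *simple wave* through a symmetric $U_0$ is a germ of a holomorphic curve $\gamma(s)$ in $\{F=0\}$ with $\gamma(0)=U_0$, $\gamma'=\gamma_{11}'\,(1,m,l)^T(1,m,l)$ and $\gamma_{11}'(0)\ne0$, where $m,l$ are holomorphic; up to reparametrization, it depends on one arbitrary function of one variable. The equation is *integrable* if for every $n$ it has $n$-component reductions parametrized by $n$ arbitrary functions of one variable, in the following sense: for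 every symmetric $U_0$ with $F(U_0)=0$ at which the dispersion relation $\sum_{j\le k}\frac{\partial F}{\partial u_{jk}}\xi_j\xi_k=0$, $\xi=(1,\mu,\lambda)$, defines an irreducible conic, and for any $n$ simple waves $\gamma_1,\dots,\gamma_n$ through $U_0$ whose pairs $(m_i(0),l_i(0))$ are pairwise distinct, there is an $n$-component reduction near $R=0$ whose restriction to the $i$-th coordinate axis is $\gamma_i$ for each $i$. An equation with real coefficients is called integrable if it is so as an equation with complex coefficients. **Theorem.** (i) Over $K=\mathbb C$ and over $K=\mathbb R$, a symplectic Monge–Ampère equation in three variables is integrable if and only if it is linearizable, and it is linearizable if and only if its coefficients satisfy the quartic equation $Q=0$, where $$\begin{aligned}Q={}&h_1^2s_1^2+h_2^2s_2^2+h_3^2s_3^2+g_1^2s_2s_3+g_2^2s_1s_3+g_3^2s_1s_2-2(h_1h_2s_1s_2+h_1h_3s_1s_3+h_2h_3s_2s_3)\\&+4\epsilon s_1s_2s_3+4\nu h_1h_2h_3+\epsilon\tau_1\tau_2\tau_3-\nu g_1g_2g_3-\epsilon^2\nu^2-\nu(g_1^2h_1+g_2^2h_2+g_3^2h_3)\\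&-(g_1\tau_1+g_2\tau_2+g_3\tau_3+2\epsilon\nu)(h_1s_1+h_2s_2+h_3s_3-\epsilon\nu)\\&+2(g_1h_1s_1\tau_1+g_2h_2s_2\tau_2+g_3h_3s_3\tau_3)+\tau_1^2h_2h_3+\tau_2^2h_1h_3+\tau_3^2h_1h_2-\epsilon(\tau_1^2s_1+\tau_2^2s_2+\tau_3^2s_3)\\&+s_1\tau_1g_2g_3+s_2\tau_2g_1g_3+s_3\tau_3g_1g_2-(g_1h_1\tau_2\tau_3+g_2h_2\tau_1\tau_3+g_3h_3\tau_1\tau_2).\end{aligned}$$ (ii) The equations $\operatorname{Hess}u=1$ and $\operatorname{Hess}u=u_{11}+u_{22}+u_{33}$, where $\operatorname{Hess}u=\det U$, are not integrable. (iii) $Q=0$ is the equation of the dual variety of the complex Lagrangian Grassmannian $\Lambda\subset\mathbb P^{13}$ of Lagrangian planes in $\mathbb C^6$, where $\Lambda$ is embedded by the minors $(1,u_{ij},\dots,\det U)$ of $U$ on the open set of planes $dp=U\,dx$, and the coefficient vector of $F$ is viewed as a hyperplane in $\mathbb P^{13}$: the hyperplane is tangent to $\Lambda$ at some point if and only if $Q=0$,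 and a polynomial in the fourteen coefficients vanishes at all tangent hyperplanes if and only if it is divisible by $Q$. -/

import Mathlib

open Matrix Filter Topology

noncomputable section

namespace SymplecticMA

/-- Index set of the fourteen coefficients of a symplectic Monge-Ampère equation in three
variables (`0, 1, 2` stand for `1, 2, 3`). -/
inductive Idx : Type
  | eps : Idx
  | h : Fin 3 → Idx
  | g : Fin 3 → Idx
  | s : Fin 3 → Idx
  | tau : Fin 3 → Idx
  | nu : Idx

/-- A symplectic Monge-Ampère equation with coefficients in `K`, given by its coefficients
`ε, h₁, h₂, h₃, g₁, g₂, g₃, s₁, s₂, s₃, τ₁, τ₂, τ₃, ν`. -/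
abbrev MongeAmpere (K : Type*) : Type _ := Idx → K

/-- The left-hand side of the equation, as a function of the Hessian matrix `U` of `u`; the
PDE is `E.eval U = 0`. -/
def MongeAmpere.eval {K : Type*} [CommRing K] (E : MongeAmpere K)
    (U : Matrix (Fin 3) (Fin 3) K) : K :=
  E .eps * U.det
    + E (.h 0) * (U 1 1 * U 2 2 - U 1 2 ^ 2)
    + E (.h 1) * (U 0 0 * U 2 2 - U 0 2 ^ 2)
    + E (.h 2) * (U 0 0 * U 1 1 - U 0 1 ^ 2)
    + E (.g 0) * (U 0 0 * U 1 2 - U 0 1 * U 0 2)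
    + E (.g 1) * (U 1 1 * U 0 2 - U 0 1 * U 1 2)
    + E (.g 2) * (U 2 2 * U 0 1 - U 0 2 * U 1 2)
    + E (.s 0) * U 0 0 + E (.s 1) * U 1 1 + E (.s 2) * U 2 2
    + E (.tau 0) * U 1 2 + E (.tau 1) * U 0 2 + E (.tau 2) * U 0 1
    + E .nu

/-- The equation with complex coefficients defined by one with real coefficients. -/
def MongeAmpere.complexify (E : MongeAmpere ℝ) : MongeAmpere ℂ := fun i => (E i : ℂ)

/-- The equation `Hess u = 1`. -/
def hessOne : MongeAmpere ℂ
  | .eps => 1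
  | .nu => -1
  | _ => 0

/-- The equation `Hess u = u₁₁ + u₂₂ + u₃₃`. -/
def hessLaplace : MongeAmpere ℂ
  | .eps => 1
  | .s _ => -1
  | _ => 0

/-! ### Linearizability -/

/-- A linear equation `∑ sᵢ uᵢᵢ + τ₁ u₂₃ + τ₂ u₁₃ + τ₃ u₁₂ + ν = 0` which really is a second
order PDE. -/
def MongeAmpere.IsLinear {K : Type*} [CommRing K] (L : MongeAmpere K) : Prop :=
  L .eps = 0 ∧ (∀ i, L (.h i) = 0) ∧ (∀ i, L (.g i) = 0) ∧
    ∃ i, L (.s i) ≠ 0 ∨ L (.tau i) ≠ 0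

/-- `E` is linearizable: some element of the equivalence group `Sp(6, K)`, with blocks
`A, B, C, D` and acting by `Ũ = (A U + B) (C U + D)⁻¹`, transforms it to a linear equation.
The factor `det (C U + D)` clears the denominators of the transformed equation. -/
def MongeAmpere.Linearizable {K : Type*} [Field K] (E : MongeAmpere K) : Prop :=
  ∃ M ∈ Matrix.symplecticGroup (Fin 3) K, ∃ L : MongeAmpere K, L.IsLinear ∧
    ∀ U : Matrix (Fin 3) (Fin 3) K, U.IsSymm →
      (M.toBlocks₂₁ * U + M.toBlocks₂₂).det ≠ 0 →
      E.eval U = (M.toBlocks₂₁ * U + M.toBlocks₂₂).det *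
        L.eval ((M.toBlocks₁₁ * U + M.toBlocks₁₂) * (M.toBlocks₂₁ * U + M.toBlocks₂₂)⁻¹)

/-- The quartic form in the coefficients. -/
def MongeAmpere.quartic {K : Type*} [CommRing K] (E : MongeAmpere K) : K :=
  let ε := E .eps
  let ν := E .nu
  let h₁ := E (.h 0)
  let h₂ := E (.h 1)
  let h₃ := E (.h 2)
  let g₁ := E (.g 0)
  let g₂ := E (.g 1)
  let g₃ := E (.g 2)
  let s₁ := E (.s 0)
  let s₂ := E (.s 1)
  let s₃ := E (.s 2)
  let τ₁ := E (.tau 0)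
  let τ₂ := E (.tau 1)
  let τ₃ := E (.tau 2)
  h₁ ^ 2 * s₁ ^ 2 + h₂ ^ 2 * s₂ ^ 2 + h₃ ^ 2 * s₃ ^ 2
    + g₁ ^ 2 * s₂ * s₃ + g₂ ^ 2 * s₁ * s₃ + g₃ ^ 2 * s₁ * s₂
    - 2 * (h₁ * h₂ * s₁ * s₂ + h₁ * h₃ * s₁ * s₃ + h₂ * h₃ * s₂ * s₃)
    + 4 * ε * s₁ * s₂ * s₃ + 4 * ν * h₁ * h₂ * h₃
    + ε * τ₁ * τ₂ * τ₃ - ν * g₁ * g₂ * g₃ - ε ^ 2 * ν ^ 2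
    - ν * (g₁ ^ 2 * h₁ + g₂ ^ 2 * h₂ + g₃ ^ 2 * h₃)
    - (g₁ * τ₁ + g₂ * τ₂ + g₃ * τ₃ + 2 * ε * ν) * (h₁ * s₁ + h₂ * s₂ + h₃ * s₃ - ε * ν)
    + 2 * (g₁ * h₁ * s₁ * τ₁ + g₂ * h₂ * s₂ * τ₂ + g₃ * h₃ * s₃ * τ₃)
    + τ₁ ^ 2 * h₂ * h₃ + τ₂ ^ 2 * h₁ * h₃ + τ₃ ^ 2 * h₁ * h₂
    - ε * (τ₁ ^ 2 * s₁ + τ₂ ^ 2 * s₂ + τ₃ ^ 2 * s₃)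
    + s₁ * τ₁ * g₂ * g₃ + s₂ * τ₂ * g₁ * g₃ + s₃ * τ₃ * g₁ * g₂
    - (g₁ * h₁ * τ₂ * τ₃ + g₂ * h₂ * τ₁ * τ₃ + g₃ * h₃ * τ₁ * τ₂)

/-- The quartic form as a polynomial in fourteen indeterminates. -/
def quarticPoly : MvPolynomial Idx ℂ :=
  MongeAmpere.quartic (fun i => MvPolynomial.X i)

/-! ### The Lagrangian Grassmannian and its dual variety -/

/-- The columns of the `6 × 3` matrix with blocks `P` (on top) and `X` form a basis of a
Lagrangian plane. The planes with `X` invertible are the planes `dp = U dx`, `U = P X⁻¹`. -/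
def IsLagrangianFrame (P X : Matrix (Fin 3) (Fin 3) ℂ) : Prop :=
  Pᵀ * X = Xᵀ * P ∧ ∀ v : Fin 3 → ℂ, P *ᵥ v = 0 → X *ᵥ v = 0 → v = 0

/-- Homogeneous coordinates, in `ℙ¹³`, of the Lagrangian plane spanned by a frame: each is, up to
sign, a `3 × 3` minor of the frame. For `X = 1` and `P = U` symmetric they are the minors of `U`. -/
def plucker (P X : Matrix (Fin 3) (Fin 3) ℂ) : Idx → ℂ
  | .eps => P.det
  | .h i => (P.updateRow i (X i)).det
  | .g 0 => -(P.updateRow 1 (X 2)).det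
  | .g 1 => -(P.updateRow 0 (X 2)).det
  | .g 2 => -(P.updateRow 0 (X 1)).det
  | .s i => (X.updateRow i (P i)).det
  | .tau 0 => (X.updateRow 2 (P 1)).det
  | .tau 1 => (X.updateRow 2 (P 0)).det
  | .tau 2 => (X.updateRow 1 (P 0)).det
  | .nu => X.det

/-- The value at `Z` of the linear form on `ℂ¹⁴` with coefficients `E`. -/
def MongeAmpere.pairing (E : MongeAmpere ℂ) (Z : Idx → ℂ) : ℂ :=
  E .eps * Z .eps + ∑ i : Fin 3, E (.h i) * Z (.h i) + ∑ i : Fin 3, E (.g i) * Z (.g i)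
    + ∑ i : Fin 3, E (.s i) * Z (.s i) + ∑ i : Fin 3, E (.tau i) * Z (.tau i) + E .nu * Z .nu

/-- Solutions of the equation are the Lagrangian planes in the hyperplane section of the
Lagrangian Grassmannian by the hyperplane `E`. -/
theorem pairing_plucker_one (E : MongeAmpere ℂ) (U : Matrix (Fin 3) (Fin 3) ℂ) (hU : U.IsSymm) :
    E.pairing (plucker U 1) = E.eval U := by
  have h1 : U 1 0 = U 0 1 := hU.apply 0 1
  have h2 : U 2 0 = U 0 2 := hU.apply 0 2
  have h3 : U 2 1 = U 1 2 := hU.apply 1 2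
  simp [MongeAmpere.pairing, MongeAmpere.eval, plucker, Fin.sum_univ_three, Matrix.det_fin_three,
    Matrix.updateRow_apply, h1, h2, h3, Matrix.one_apply]
  ring

/-- The hyperplane with coefficients `E ≠ 0` is tangent to the Lagrangian Grassmannian
`Λ ⊂ ℙ¹³` at one of its points `(P, X)`: the linear form vanishes at the point and its derivative
vanishes along every tangent vector `(P', X')` to the variety of Lagrangian frames. Such
hyperplanes are the points of the dual variety of `Λ`. -/
def MongeAmpere.IsTangentHyperplane (E : MongeAmpere ℂ) : Prop :=
  E ≠ 0 ∧ ∃ P X : Matrix (Fin 3) (Fin 3) ℂ, IsLagrangianFrame P X ∧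
    E.pairing (plucker P X) = 0 ∧
    ∀ P' X' : Matrix (Fin 3) (Fin 3) ℂ, (P'ᵀ * X + Pᵀ * X').IsSymm →
      deriv (fun t : ℂ => E.pairing (plucker (P + t • P') (X + t • X'))) 0 = 0

/-! ### Hydrodynamic reductions and integrability -/

/-- The symbol of the equation at `U`, i.e. `∑_{j ≤ k} (∂F/∂u_{jk}) ξ_j ξ_k`. The dispersion
relation is `symbol E U (1, μ, λ) = 0`. -/
def MongeAmpere.symbol (E : MongeAmpere ℂ) (U : Matrix (Fin 3) (Fin 3) ℂ) (ξ : Fin 3 → ℂ) : ℂ :=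
  deriv (fun t : ℂ => E.eval (U + t • vecMulVec ξ ξ)) 0

/-- The dispersion relation at `U` defines an irreducible conic. -/
def MongeAmpere.IrreducibleConic (E : MongeAmpere ℂ) (U : Matrix (Fin 3) (Fin 3) ℂ) : Prop :=
  ¬ ∃ a b : Fin 3 → ℂ, ∀ ξ : Fin 3 → ℂ, E.symbol U ξ = (a ⬝ᵥ ξ) * (b ⬝ᵥ ξ)

/-- `∂g/∂Rⁱ`. -/
def pd {n : ℕ} (i : Fin n) (f : (Fin n → ℂ) → ℂ) (R : Fin n → ℂ) : ℂ :=
  fderiv ℂ f R (Pi.single i 1)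

/-- `(1, μ, λ)`. -/
def speedVec (mu lam : ℂ) : Fin 3 → ℂ := ![1, mu, lam]

/-- An `n`-component hydrodynamic reduction of the equation `E`, on the domain `V` of the
phases `R¹, …, Rⁿ`: second derivatives `U = U(R)` and characteristic speeds `μⁱ(R)`, `λⁱ(R)` such
that the ansatz `U = U(R¹, …, Rⁿ)` satisfies the equation by virtue of the commuting systems
`R_y = μ(R) R_x`, `R_t = λ(R) R_x`. -/
structure IsHydrodynamicReduction (E : MongeAmpere ℂ) {n : ℕ} (V : Set (Fin n → ℂ))
    (U : (Fin n → ℂ) → Matrix (Fin 3) (Fin 3) ℂ) (mu lam : Fin n → (Fin n → ℂ) → ℂ) : Prop where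
  analytic_U : ∀ j k, AnalyticOnNhd ℂ (fun R => U R j k) V
  analytic_mu : ∀ i, AnalyticOnNhd ℂ (mu i) V
  analytic_lam : ∀ i, AnalyticOnNhd ℂ (lam i) V
  symm : ∀ R ∈ V, (U R).IsSymm
  equation : ∀ R ∈ V, E.eval (U R) = 0
  /-- The characteristic speeds of different phases are different. -/
  distinct : ∀ R ∈ V, ∀ i j, i ≠ j → (mu i R, lam i R) ≠ (mu j R, lam j R)
  /-- Commutativity of the two systems,
  `∂_j λⁱ / (λʲ - λⁱ) = ∂_j μⁱ / (μʲ - μⁱ)`, without denominators. -/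
  commute : ∀ R ∈ V, ∀ i j, i ≠ j →
    pd j (lam i) R * (mu j R - mu i R) = pd j (mu i) R * (lam j R - lam i R)
  /-- For every value `r` of `R_x` (so that the derivative of `R` in the direction of the `k`-th
  of the variables `x, y, t` is `r`, `μ r`, `λ r`) the quasilinear system
  `∂_k u_{jl} = ∂_j u_{kl}` holds. -/
  quasilinear : ∀ R ∈ V, ∀ r : Fin n → ℂ, ∀ j k l : Fin 3,
    fderiv ℂ (fun R => U R j l) R (fun i => speedVec (mu i R) (lam i R) k * r i) =
      fderiv ℂ (fun R => U R k l) R (fun i => speedVec (mu i R) (lam i R) j * r i)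
  /-- Each phase really occurs. -/
  nondegenerate : ∀ R ∈ V, ∀ i, pd i (fun R => U R 0 0) R ≠ 0

/-- A germ at `0` of a holomorphic one-component reduction, i.e. of a curve `γ` with
`γ' = a' (1, μ, λ) (1, μ, λ)ᵀ`, `a = γ₁₁`, `a' ≠ 0`, in the hypersurface defined by `E`. Up to
reparametrization, the curves from a given point amount to one arbitrary function of one variable,
namely `μ` as a function of `a`; then `λ` is found from the dispersion relation, which
holds along the curve because `E` does, and `γ` by integration. (Where the dispersion relation
cannot be solved for `λ`, exchange `λ` and `μ`.) -/
structure IsSimpleWave (E : MongeAmpere ℂ) (γ : ℂ → Matrix (Fin 3) (Fin 3) ℂ)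
    (m l : ℂ → ℂ) : Prop where
  analytic_curve : ∀ j k, AnalyticAt ℂ (fun s => γ s j k) 0
  analytic_m : AnalyticAt ℂ m 0
  analytic_l : AnalyticAt ℂ l 0
  equation : ∀ᶠ s in 𝓝 (0 : ℂ), E.eval (γ s) = 0
  velocity : ∀ᶠ s in 𝓝 (0 : ℂ), ∀ j k, deriv (fun s => γ s j k) s =
    deriv (fun s => γ s 0 0) s * (speedVec (m s) (l s) j * speedVec (m s) (l s) k)
  nondegenerate : deriv (fun s => γ s 0 0) 0 ≠ 0

/-- Integrability: for every `n`, the equation has `n`-component hydrodynamic reductions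
parametrized by `n` arbitrary functions of one variable. Through every point `U₀` of the
hypersurface where the dispersion relation is an irreducible conic, the restrictions of a
reduction to the `n` coordinate lines of the phases can be prescribed arbitrarily: `n` simple waves
(each depending, up to reparametrization of its phase, on one arbitrary function of one variable)
with different characteristic speeds at `U₀`. -/
def MongeAmpere.Integrable (E : MongeAmpere ℂ) : Prop :=
  ∀ (n : ℕ) (U₀ : Matrix (Fin 3) (Fin 3) ℂ), U₀.IsSymm → E.eval U₀ = 0 → E.IrreducibleConic U₀ →
    ∀ (γ : Fin n → ℂ → Matrix (Fin 3) (Fin 3) ℂ) (m l : Fin n → ℂ → ℂ),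
      (∀ i, γ i 0 = U₀) → (∀ i, IsSimpleWave E (γ i) (m i) (l i)) →
      (∀ i j, i ≠ j → (m i 0, l i 0) ≠ (m j 0, l j 0)) →
      ∃ ρ : ℝ, 0 < ρ ∧ ∃ (U : (Fin n → ℂ) → Matrix (Fin 3) (Fin 3) ℂ)
        (mu lam : Fin n → (Fin n → ℂ) → ℂ),
        IsHydrodynamicReduction E (Metric.ball 0 ρ) U mu lam ∧
        ∀ i, ∀ᶠ s in 𝓝 (0 : ℂ), U (Pi.single i s) = γ i s

end SymplecticMA

end

/-! An equation is a hyperplane section of the Lagrangian Grassmannian. `hom` is its homogeneous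
form on pairs `(P, X)`, on which symplectic matrices act linearly. The symplectic group enters
through translations `U ↦ U + T`, the flip `U ↦ -U⁻¹` and the conjugates `lower` of translations by
it. That the quartic is invariant is a polynomial identity for each (`quartic_translate`,
`quartic_flip`, `quartic_lower`).

Linearizability. A linear equation reads `tr (S P adj X) + ν det X`, which has order two in `X`: it
is singular at the plane `X = 0`, and its quartic vanishes. By invariance, linearizable equations
have `Q = 0`. Conversely, any nonzero equation can be brought to `ε det P + tr (H X adj P) + ν det
X` with `ν ≠ 0`, where `Q = ν (ε² ν + 4 det H)`. If this vanishes, a singular point can be written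
down, and sending it to infinity makes the equation linear (`exists_equivalent_isLinear`). The same
singular point is the point of tangency of the hyperplane, which identifies `Q = 0` with the dual
variety. That `Q` generates the ideal follows since `Q` is quadratic in `ν` with generically
distinct roots (`quarticPoly_dvd`).

Integrability. Near a point with irreducible conic, the coordinate `W = V (1 + C V)⁻¹` turns the
equation into `tr (S W) + ε det W = 0`, and `Q = 4 ε det S` (`exists_standard_form`). This Möbius
change acts on velocities by congruences, so it preserves rank one. If `Q = 0`, then `ε = 0`, the
equation is linear in `W`, and reductions are sums of simple waves, one in each phase
(`integrable_of_quartic_eq_zero`). If `Q ≠ 0`, a point with irreducible conic exists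
(`exists_det_symS_ne_zero`). Along a three-component reduction there, `W` has vanishing mixed second
and third derivatives at the point, while the third derivative of `ε det W` is a nonzero multiple of
`ε`; hence `ε = 0`, a contradiction (`eq_zero_of_commuting_derivations`). -/

noncomputable section

namespace SymplecticMA

/-! ### Homogeneous form of an equation and generators of the symplectic group. -/

namespace MongeAmpere

variable {K : Type*} [Field K]

/-- The symmetric matrix of the linear terms of an equation. -/
def symS (E : MongeAmpere K) : Matrix (Fin 3) (Fin 3) K :=
  !![E (.s 0), E (.tau 2) / 2, E (.tau 1) / 2;
     E (.tau 2) / 2, E (.s 1), E (.tau 0) / 2;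
     E (.tau 1) / 2, E (.tau 0) / 2, E (.s 2)]

/-- The symmetric matrix of the quadratic terms of an equation, as a linear form in the
adjugate of the Hessian. -/
def symH (E : MongeAmpere K) : Matrix (Fin 3) (Fin 3) K :=
  !![E (.h 0), -E (.g 2) / 2, -E (.g 1) / 2;
     -E (.g 2) / 2, E (.h 1), -E (.g 0) / 2;
     -E (.g 1) / 2, -E (.g 0) / 2, E (.h 2)]

/-- The equation in homogeneous form, as a function on pairs of matrices. -/
def hom (E : MongeAmpere K) (P X : Matrix (Fin 3) (Fin 3) K) : K :=
  E .eps * P.det + (symH E * (X * P.adjugate)).trace + (symS E * (P * X.adjugate)).trace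
    + E .nu * X.det

/-- The equation satisfied by `U` when `U + T` satisfies `E`. -/
def translate (E : MongeAmpere K) (T : Matrix (Fin 3) (Fin 3) K) : MongeAmpere K
  | .eps => E .eps
  | .h i => E (.h i) + E .eps * T i i
  | .g 0 => E (.g 0) - 2 * E .eps * T 1 2
  | .g 1 => E (.g 1) - 2 * E .eps * T 0 2
  | .g 2 => E (.g 2) - 2 * E .eps * T 0 1
  | .s 0 => E (.s 0) + E (.h 1) * T 2 2 + E (.h 2) * T 1 1 + E (.g 0) * T 1 2
      + E .eps * (T 1 1 * T 2 2 - T 1 2 ^ 2)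
  | .s 1 => E (.s 1) + E (.h 0) * T 2 2 + E (.h 2) * T 0 0 + E (.g 1) * T 0 2
      + E .eps * (T 0 0 * T 2 2 - T 0 2 ^ 2)
  | .s 2 => E (.s 2) + E (.h 0) * T 1 1 + E (.h 1) * T 0 0 + E (.g 2) * T 0 1
      + E .eps * (T 0 0 * T 1 1 - T 0 1 ^ 2)
  | .tau 0 => E (.tau 0) - 2 * E (.h 0) * T 1 2 + E (.g 0) * T 0 0 - E (.g 1) * T 0 1
      - E (.g 2) * T 0 2 + 2 * E .eps * (T 0 1 * T 0 2 - T 0 0 * T 1 2)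
  | .tau 1 => E (.tau 1) - 2 * E (.h 1) * T 0 2 + E (.g 1) * T 1 1 - E (.g 0) * T 0 1
      - E (.g 2) * T 1 2 + 2 * E .eps * (T 0 1 * T 1 2 - T 1 1 * T 0 2)
  | .tau 2 => E (.tau 2) - 2 * E (.h 2) * T 0 1 + E (.g 2) * T 2 2 - E (.g 0) * T 0 2
      - E (.g 1) * T 1 2 + 2 * E .eps * (T 0 2 * T 1 2 - T 2 2 * T 0 1)
  | .nu => E.eval T

/-- The equation satisfied by `-U⁻¹` when `U` satisfies `E`. -/
def flip (E : MongeAmpere K) : MongeAmpere K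
  | .eps => -E .nu
  | .h i => E (.s i)
  | .g i => -E (.tau i)
  | .s i => -E (.h i)
  | .tau i => E (.g i)
  | .nu => E .eps

/-- The equation satisfied by `U (1 - C U)⁻¹` when `U` satisfies `E`. -/
def lower (E : MongeAmpere K) (C : Matrix (Fin 3) (Fin 3) K) : MongeAmpere K :=
  -- `flip` squares to `-1`, so three flips invert one: this is a translation conjugated by `flip`.
  flip (flip (flip ((flip E).translate (-C))))

theorem eval_translate (E : MongeAmpere K) {T U : Matrix (Fin 3) (Fin 3) K} (hT : T.IsSymm)
    (hU : U.IsSymm) : (E.translate T).eval U = E.eval (U + T) := by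
  have h1 : U 1 0 = U 0 1 := hU.apply 0 1
  have h2 : U 2 0 = U 0 2 := hU.apply 0 2
  have h3 : U 2 1 = U 1 2 := hU.apply 1 2
  have k1 : T 1 0 = T 0 1 := hT.apply 0 1
  have k2 : T 2 0 = T 0 2 := hT.apply 0 2
  have k3 : T 2 1 = T 1 2 := hT.apply 1 2
  simp only [eval, translate, det_fin_three, Matrix.add_apply, h1, h2, h3, k1, k2, k3]
  ring

set_option maxHeartbeats 4000000 in
theorem quartic_translate (E : MongeAmpere K) {T : Matrix (Fin 3) (Fin 3) K} (hT : T.IsSymm) :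
    (E.translate T).quartic = E.quartic := by
  have k1 : T 1 0 = T 0 1 := hT.apply 0 1
  have k2 : T 2 0 = T 0 2 := hT.apply 0 2
  have k3 : T 2 1 = T 1 2 := hT.apply 1 2
  simp only [quartic, eval, translate, det_fin_three, k1, k2, k3]
  ring

theorem quartic_flip (E : MongeAmpere K) : (flip E).quartic = E.quartic := by
  simp only [quartic, flip]
  ring

theorem hom_flip (E : MongeAmpere K) (P X : Matrix (Fin 3) (Fin 3) K) :
    (flip E).hom (-X) P = E.hom P X := by
  simp only [hom, flip, symS, symH, trace_fin_three, adjugate_fin_three, det_fin_three,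
    mul_apply, Fin.sum_univ_three, Matrix.neg_apply, of_apply, cons_val', cons_val_zero,
        cons_val_one, cons_val, cons_val_fin_one]
  ring

set_option maxHeartbeats 4000000 in
theorem hom_translate [CharZero K] (E : MongeAmpere K) {T : Matrix (Fin 3) (Fin 3) K} (hT :
    T.IsSymm)
    (P X : Matrix (Fin 3) (Fin 3) K) :
    (E.translate T).hom P X = E.hom (P + T * X) X := by
  have k1 : T 1 0 = T 0 1 := hT.apply 0 1
  have k2 : T 2 0 = T 0 2 := hT.apply 0 2
  have k3 : T 2 1 = T 1 2 := hT.apply 1 2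
  simp only [hom, eval, translate, symS, symH, trace_fin_three, adjugate_fin_three, det_fin_three,
    mul_apply, Fin.sum_univ_three, Matrix.add_apply, of_apply, cons_val', cons_val_zero,
        cons_val_one, cons_val, cons_val_fin_one, k1, k2, k3]
  field_simp
  ring

end MongeAmpere

/-! ### Symplectic equivalence of equations. -/

namespace MongeAmpere

variable {K : Type*} [Field K]

theorem hom_flip' (E : MongeAmpere K) (P X : Matrix (Fin 3) (Fin 3) K) :
    (flip E).hom P X = E.hom X (-P) := by
  simpa using hom_flip E X (-P)

theorem hom_lower [CharZero K] (E : MongeAmpere K) {C : Matrix (Fin 3) (Fin 3) K} (hC : C.IsSymm)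
    (P X : Matrix (Fin 3) (Fin 3) K) : (E.lower C).hom P X = E.hom P (X + C * P) := by
  rw [lower, hom_flip', hom_flip', hom_flip', hom_translate _ hC.neg, hom_flip']
  simp [add_comm]

theorem quartic_lower (E : MongeAmpere K) {C : Matrix (Fin 3) (Fin 3) K} (hC : C.IsSymm) :
    (E.lower C).quartic = E.quartic := by
  rw [lower, quartic_flip, quartic_flip, quartic_flip, quartic_translate _ hC.neg, quartic_flip]

theorem hom_one [CharZero K] (E : MongeAmpere K) {U : Matrix (Fin 3) (Fin 3) K} (hU : U.IsSymm) :
    E.hom U 1 = E.eval U := by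
  have h1 : U 1 0 = U 0 1 := hU.apply 0 1
  have h2 : U 2 0 = U 0 2 := hU.apply 0 2
  have h3 : U 2 1 = U 1 2 := hU.apply 1 2
  simp only [hom, eval, symS, symH, trace_fin_three, adjugate_fin_three, det_fin_three,
      adjugate_one,
    mul_one, one_mul, det_one,
    mul_apply, Fin.sum_univ_three, of_apply, cons_val', cons_val_zero, cons_val_one, cons_val,
    cons_val_fin_one, h1, h2, h3]
  ring

theorem hom_mul (E : MongeAmpere K) (P X N : Matrix (Fin 3) (Fin 3) K) :
    E.hom (P * N) (X * N) = N.det * E.hom P X := by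
  have h (A B : Matrix (Fin 3) (Fin 3) K) :
      A * N * (B * N).adjugate = N.det • (A * B.adjugate) := by
    rw [adjugate_mul_distrib, ← mul_assoc, mul_assoc A, mul_adjugate]
    simp
  simp only [hom, h, det_mul, mul_smul_comm, trace_smul, smul_eq_mul]
  ring

/-- Homogeneous forms of the two equations agree after a linear symplectic transformation. -/
def Equivalent (E E' : MongeAmpere K) : Prop :=
  ∃ M ∈ symplecticGroup (Fin 3) K, ∀ P X : Matrix (Fin 3) (Fin 3) K,
    E.hom P X = E'.hom (M.toBlocks₁₁ * P + M.toBlocks₁₂ * X) (M.toBlocks₂₁ * P + M.toBlocks₂₂ * X)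

theorem Equivalent.trans {E E' E'' : MongeAmpere K} (h : E.Equivalent E') (h' : E'.Equivalent E'') :
    E.Equivalent E'' := by
  obtain ⟨M, hM, h⟩ := h
  obtain ⟨N, hN, h'⟩ := h'
  refine ⟨N * M, mul_mem hN hM, fun P X => ?_⟩
  have hb : N * M = fromBlocks
      (N.toBlocks₁₁ * M.toBlocks₁₁ + N.toBlocks₁₂ * M.toBlocks₂₁)
      (N.toBlocks₁₁ * M.toBlocks₁₂ + N.toBlocks₁₂ * M.toBlocks₂₂)
      (N.toBlocks₂₁ * M.toBlocks₁₁ + N.toBlocks₂₂ * M.toBlocks₂₁)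
      (N.toBlocks₂₁ * M.toBlocks₁₂ + N.toBlocks₂₂ * M.toBlocks₂₂) := by
    rw [← fromBlocks_multiply, fromBlocks_toBlocks, fromBlocks_toBlocks]
  rw [h, h', hb]
  simp only [toBlocks_fromBlocks₁₁, toBlocks_fromBlocks₁₂, toBlocks_fromBlocks₂₁,
    toBlocks_fromBlocks₂₂]
  congr 1 <;> noncomm_ring

theorem equivalent_translate [CharZero K] (E : MongeAmpere K) {T : Matrix (Fin 3) (Fin 3) K}
    (hT : T.IsSymm) : E.Equivalent (E.translate T) := by
  refine ⟨fromBlocks 1 (-T) 0 1, ?_, fun P X => ?_⟩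
  · rw [SymplecticGroup.mem_iff]
    simp [J, fromBlocks_multiply, fromBlocks_transpose, hT.eq]
  · simp [hom_translate E hT]

theorem equivalent_flip (E : MongeAmpere K) : E.Equivalent (flip E) := by
  refine ⟨fromBlocks 0 (-1) 1 0, ?_, fun P X => ?_⟩
  · exact SymplecticGroup.J_mem (Fin 3) K
  · simp [hom_flip]

theorem equivalent_lower [CharZero K] (E : MongeAmpere K) {C : Matrix (Fin 3) (Fin 3) K}
    (hC : C.IsSymm) : E.Equivalent (E.lower C) := by
  refine ⟨fromBlocks 1 0 (-C) 1, ?_, fun P X => ?_⟩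
  · rw [SymplecticGroup.mem_iff]
    simp [J, fromBlocks_multiply, fromBlocks_transpose, hC.eq]
  · simp [hom_lower E hC]

/-- A symplectic matrix preserves the skew form whose vanishing on the columns of a frame is the
hypothesis `h`. -/
theorem symplectic_isSymm {M : Matrix (Fin 3 ⊕ Fin 3) (Fin 3 ⊕ Fin 3) K}
    (hM : M ∈ symplecticGroup (Fin 3) K) {P X : Matrix (Fin 3) (Fin 3) K} (h : Pᵀ * X = Xᵀ * P) :
    (M.toBlocks₁₁ * P + M.toBlocks₁₂ * X)ᵀ * (M.toBlocks₂₁ * P + M.toBlocks₂₂ * X) =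
    (M.toBlocks₂₁ * P + M.toBlocks₂₂ * X)ᵀ * (M.toBlocks₁₁ * P + M.toBlocks₁₂ * X) := by
  have h1 := SymplecticGroup.mem_iff'.1 hM
  rw [← fromBlocks_toBlocks M] at h1
  simp only [J, fromBlocks_multiply, fromBlocks_transpose, fromBlocks_inj, mul_zero, zero_add,
      mul_one,
    mul_neg, add_zero, neg_mul] at h1
  obtain ⟨a1, a2, a3, a4⟩ := h1
  have b1 : M.toBlocks₁₁ᵀ * M.toBlocks₂₁ = M.toBlocks₂₁ᵀ * M.toBlocks₁₁ := by
    rw [← sub_eq_zero, ← neg_eq_zero, ← a1]; noncomm_ring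
  have b4 : M.toBlocks₁₂ᵀ * M.toBlocks₂₂ = M.toBlocks₂₂ᵀ * M.toBlocks₁₂ := by
    rw [← sub_eq_zero, ← neg_eq_zero, ← a4]; noncomm_ring
  have b2 : M.toBlocks₁₁ᵀ * M.toBlocks₂₂ = M.toBlocks₂₁ᵀ * M.toBlocks₁₂ + 1 := by
    rw [← sub_eq_zero, ← neg_eq_zero, ← sub_eq_zero.2 a2]; noncomm_ring
  have b3 : M.toBlocks₂₂ᵀ * M.toBlocks₁₁ = M.toBlocks₁₂ᵀ * M.toBlocks₂₁ + 1 := by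
    rw [← sub_eq_zero, ← sub_eq_zero.2 a3]; noncomm_ring
  simp only [transpose_add, transpose_mul, add_mul, mul_add, mul_assoc]
  simp only [← mul_assoc _ _ P, ← mul_assoc _ _ X, b1, b2, b3, b4, add_mul, mul_add, one_mul, h]
  abel

theorem eval_eq_hom_mul [CharZero K] (E : MongeAmpere K) {P N : Matrix (Fin 3) (Fin 3) K}
    (h : Pᵀ * N = Nᵀ * P) (hN : N.det ≠ 0) : E.hom P N = N.det * E.eval (P * N⁻¹) := by
  have hu : IsUnit N.det := isUnit_iff_ne_zero.2 hN
  have hs : (P * N⁻¹).IsSymm := by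
    have h2 : N⁻¹ᵀ * Nᵀ = 1 := by rw [← transpose_mul, mul_nonsing_inv _ hu, transpose_one]
    calc (P * N⁻¹)ᵀ = N⁻¹ᵀ * (Pᵀ * N) * N⁻¹ := by
          rw [mul_assoc, mul_assoc, mul_nonsing_inv _ hu, mul_one, transpose_mul]
      _ = P * N⁻¹ := by rw [h, ← mul_assoc, h2, one_mul]
  rw [← hom_one E hs, ← hom_mul]
  rw [mul_assoc, nonsing_inv_mul _ hu, mul_one, one_mul]

theorem Equivalent.linearizable [CharZero K] {E L : MongeAmpere K} (h : E.Equivalent L)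
    (hL : L.IsLinear) : E.Linearizable := by
  obtain ⟨M, hM, h⟩ := h
  refine ⟨M, hM, L, hL, fun U hU hd => ?_⟩
  have h1 := symplectic_isSymm hM (P := U) (X := 1) (by simpa using hU.eq)
  have h2 := h U 1
  simp only [mul_one] at h1 h2
  rw [← hom_one E hU, h2, eval_eq_hom_mul _ h1 hd]

/-- Each coefficient is a combination of values at symmetric matrices with entries `0` and `1`. This
turns identities between functions into identities between equations. -/
theorem eq_zero_of_eval_eq_zero [CharZero K] (E : MongeAmpere K)
    (h : ∀ U : Matrix (Fin 3) (Fin 3) K, U.IsSymm → E.eval U = 0) : E = 0 := by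
  have key (a b c d e f : K) : E.eval !![a, b, c; b, d, e; c, e, f] = 0 := by
    refine h _ (IsSymm.ext fun i j => ?_)
    fin_cases i <;> fin_cases j <;> rfl
  simp only [eval, det_fin_three, of_apply, cons_val', cons_val_zero, cons_val_one, cons_val,
    cons_val_fin_one] at key
  have k0 := key 0 0 0 0 0 0
  have ka := key 1 0 0 0 0 0
  have kd := key 0 0 0 1 0 0
  have kf := key 0 0 0 0 0 1
  have kad := key 1 0 0 1 0 0
  have kaf := key 1 0 0 0 0 1
  have kdf := key 0 0 0 1 0 1
  have kb := key 0 1 0 0 0 0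
  have kc := key 0 0 1 0 0 0
  have ke := key 0 0 0 0 1 0
  have kadf := key 1 0 0 1 0 1
  have kae := key 1 0 0 0 1 0
  have kdc := key 0 0 1 1 0 0
  have kfb := key 0 1 0 0 0 1
  funext i
  rw [Pi.zero_apply]
  rcases i with _ | i | i | i | i | _
  · linear_combination kadf - kad - kaf - kdf + ka + kd + kf - k0
  · fin_cases i <;> simp only [Fin.zero_eta, Fin.mk_one, Fin.reduceFinMk]
    · linear_combination kdf - kd - kf + k0
    · linear_combination kaf - ka - kf + k0
    · linear_combination kad - ka - kd + k0
  · fin_cases i <;> simp only [Fin.zero_eta, Fin.mk_one, Fin.reduceFinMk]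
    · linear_combination kae - ke - ka + k0 + (kadf - kad - kaf - kdf + ka + kd + kf - k0)
    · linear_combination kdc - kc - kd + k0 + (kadf - kad - kaf - kdf + ka + kd + kf - k0)
    · linear_combination kfb - kb - kf + k0 + (kadf - kad - kaf - kdf + ka + kd + kf - k0)
  · fin_cases i <;> simp only [Fin.zero_eta, Fin.mk_one, Fin.reduceFinMk]
    · linear_combination ka - k0
    · linear_combination kd - k0
    · linear_combination kf - k0
  · fin_cases i <;> simp only [Fin.zero_eta, Fin.mk_one, Fin.reduceFinMk]
    · linear_combination ke - k0 + (kdf - kd - kf + k0)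
    · linear_combination kc - k0 + (kaf - ka - kf + k0)
    · linear_combination kb - k0 + (kad - ka - kd + k0)
  · linear_combination k0

theorem symS_isSymm (E : MongeAmpere K) : (symS E).IsSymm :=
  IsSymm.ext fun i j => by fin_cases i <;> fin_cases j <;> rfl

theorem symH_isSymm (E : MongeAmpere K) : (symH E).IsSymm :=
  IsSymm.ext fun i j => by fin_cases i <;> fin_cases j <;> rfl

/-- The first two hypotheses say that `U = 0` is a singular point. `flip` sends it to infinity,
where singularity means that there are no terms of degree above one. -/
theorem isLinear_flip {E : MongeAmpere K} (hν : E .nu = 0) (hS : symS E = 0) (hH : symH E ≠ 0)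
    [CharZero K] : (flip E).IsLinear := by
  have e (i j : Fin 3) : symS E i j = 0 := by rw [hS]; rfl
  have e0 := e 0 0
  have e1 := e 1 1
  have e2 := e 2 2
  have e3 := e 0 1
  have e4 := e 0 2
  have e5 := e 1 2
  simp [symS] at e0 e1 e2 e3 e4 e5
  refine ⟨by simp [flip, hν], fun i => ?_, fun i => ?_, ?_⟩
  · fin_cases i <;> simp [flip, *]
  · fin_cases i <;> simp [flip, *]
  · by_contra hc
    push Not at hc
    simp only [flip, neg_eq_zero] at hc
    apply hH
    ext i j
    fin_cases i <;> fin_cases j <;> simp [symH, hc]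

end MongeAmpere

/-! ### Singular points of equations with vanishing quartic. -/

namespace MongeAmpere

variable {K : Type*} [Field K]

/-- If the coefficients of the linear terms vanish and the constant does not, then a
degenerate equation with a nondegenerate quadratic part has a singular point. -/
theorem exists_equivalent_isLinear_of_eps_ne_zero [CharZero K] (E : MongeAmpere K)
    (hs : ∀ i, E (.s i) = 0) (ht : ∀ i, E (.tau i) = 0) (hν : E .nu ≠ 0) (hε : E .eps ≠ 0)
    (hQ : E.quartic = 0) : ∃ L : MongeAmpere K, L.IsLinear ∧ E.Equivalent L := by
  -- `-(2/ε) H` is a critical point of `ε det U + tr (H adj U)`. The value of the equation there is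
  -- `ν + 4 det H / ε²`, and the quartic is `ε² ν` times this value.
  have hT : (-(2 / E .eps) • symH E).IsSymm := (symH_isSymm E).smul _
  refine ⟨_, isLinear_flip ?_ ?_ ?_, (equivalent_translate E hT).trans (equivalent_flip _)⟩
  · simp only [quartic, hs, ht] at hQ
    have h4 : E .nu * (translate E (-(2 / E .eps) • symH E) .nu) * E .eps ^ 2 = 0 := by
      rw [← hQ]
      simp only [translate, eval, Matrix.smul_apply, smul_eq_mul, symH, det_fin_three, of_apply,
          cons_val', cons_val_zero, cons_val_one, cons_val,
        cons_val_fin_one, hs, ht]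
      field_simp
      ring
    simpa [hν, hε] using h4
  · ext i j
    fin_cases i <;> fin_cases j <;>
    · simp [translate, symS, symH, hs, ht]
      try field_simp
      try ring
  -- With `H = 0` the quartic would be `ε² ν²`, which is nonzero.
  · intro h0
    have e (i j : Fin 3) : symH (translate E (-(2 / E .eps) • symH E)) i j = 0 := by rw [h0]; rfl
    have hneg : symH (translate E (-(2 / E .eps) • symH E)) = - symH E := by
      ext i j
      fin_cases i <;> fin_cases j <;>
      · simp [translate, symH]
        try field_simp
        try ring
    have h1 : symH E = 0 := by rw [← neg_eq_zero, ← hneg, h0]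
    have e (i j : Fin 3) : symH E i j = 0 := by rw [h1]; rfl
    have e0 := e 0 0
    have e1 := e 1 1
    have e2 := e 2 2
    have e3 := e 0 1
    have e4 := e 0 2
    have e5 := e 1 2
    simp [symH] at e0 e1 e2 e3 e4 e5
    simp [quartic, hs, ht, e0, e1, e2, e3, e4, e5] at hQ
    have : (E .eps) ^ 2 * (E .nu) ^ 2 = 0 := by linear_combination hQ
    simp [hν, hε] at this

-- Here the quartic is `4 ν det H`, so `H` has a kernel vector `w`. The singular point is the
-- Lagrangian plane spanned by `(0, w)` and the vectors `(p, 0)` with `p ⊥ w`. It is not a graph `P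
-- = U X`, so `lower C` is needed to bring it into the affine chart.
set_option maxHeartbeats 1000000 in
theorem exists_equivalent_isLinear_of_eps_eq_zero [CharZero K] (E : MongeAmpere K)
    (hs : ∀ i, E (.s i) = 0) (ht : ∀ i, E (.tau i) = 0) (hν : E .nu ≠ 0) (hε : E .eps = 0)
    (hQ : E.quartic = 0) : ∃ L : MongeAmpere K, L.IsLinear ∧ E.Equivalent L := by
  suffices h : ∃ C p : Matrix (Fin 3) (Fin 3) K, C.IsSymm ∧ p.IsSymm ∧
      (E.lower C).eval p = 0 ∧ symS ((E.lower C).translate p) = 0 ∧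
      symH ((E.lower C).translate p) ≠ 0 by
    obtain ⟨C, p, hC, hp, h1, h2, h3⟩ := h
    exact ⟨_, isLinear_flip h1 h2 h3, ((equivalent_lower E hC).trans
      (equivalent_translate _ hp)).trans (equivalent_flip _)⟩
  have hdet : (symH E).det = 0 := by
    simp only [quartic, hs, ht, hε] at hQ
    have h4 : E .nu * (symH E).det = 0 := by
      simp only [symH, det_fin_three, of_apply, cons_val', cons_val_zero, cons_val_one, cons_val,
        cons_val_fin_one]
      linear_combination hQ / 4
    simpa [hν] using h4
  obtain ⟨v, hv, hHv⟩ := exists_mulVec_eq_zero_iff.2 hdet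
  obtain ⟨i, hi⟩ := Function.ne_iff.1 hv
  rw [Pi.zero_apply] at hi
  obtain ⟨w, hw, hwi⟩ : ∃ w, symH E *ᵥ w = 0 ∧ w i = 1 :=
    ⟨(v i)⁻¹ • v, by rw [mulVec_smul, hHv, smul_zero], by simp [hi]⟩
  have e0 := congrFun hw 0
  have e1 := congrFun hw 1
  have e2 := congrFun hw 2
  simp only [mulVec, dotProduct, symH, Fin.sum_univ_three, of_apply, cons_val', cons_val_zero,
    cons_val_one, cons_val, cons_val_fin_one, Pi.zero_apply] at e0 e1 e2
  -- With `w i = 1`, take for `C` the coordinate projection killing the `i`-th axis, and for `p` a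
  -- symmetric matrix with kernel spanned by `w` such that `1 + C p = w eᵢᵀ`. The frame `(p, 1 + C
  -- p)` then spans the singular plane. The new quadratic part is nonzero because its value on `w`
  -- is `ν`.
  fin_cases i
  · simp only [Fin.zero_eta] at hwi
    have gk : E (.g 2) = 2 * E (.h 1) * w 1 - E (.g 0) * w 2 := by
      rw [hwi] at e1
      linear_combination (-2) * e1
    have gj : E (.g 1) = 2 * E (.h 2) * w 2 - E (.g 0) * w 1 := by
      rw [hwi] at e2
      linear_combination (-2) * e2
    have hi : E (.h 0) = (E (.g 2) * w 1 + E (.g 1) * w 2) / 2 := by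
      rw [hwi] at e0
      linear_combination e0
    rw [gk, gj] at hi
    refine ⟨!![0, 0, 0; 0, 1, 0; 0, 0, 1],
      -!![w 1 ^ 2 + w 2 ^ 2, -w 1, -w 2; -w 1, 1, 0; -w 2, 0, 1],
      IsSymm.ext fun i j => by fin_cases i <;> fin_cases j <;> rfl,
      (IsSymm.ext fun i j => by fin_cases i <;> fin_cases j <;> rfl : IsSymm _).neg, ?_, ?_, fun h0
          => hν ?_⟩
    · simp [eval, lower, flip, translate, det_fin_three, hs, ht, hε, hi, gj, gk]
      ring
    · ext a b
      fin_cases a <;> fin_cases b <;>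
      · simp [symS, eval, lower, flip, translate, det_fin_three, hs, ht, hε, hi, gj, gk]
        try ring
    · have h1 := congrArg (fun A => w ⬝ᵥ (A *ᵥ w)) h0
      simp [dotProduct, mulVec, Fin.sum_univ_three, symH, eval, lower, flip, translate,
        det_fin_three, hs, ht, hε, hi, gj, gk, hwi] at h1
      linear_combination h1
  · simp only [Fin.mk_one] at hwi
    have gk : E (.g 2) = 2 * E (.h 0) * w 0 - E (.g 1) * w 2 := by
      rw [hwi] at e0
      linear_combination (-2) * e0
    have gj : E (.g 0) = 2 * E (.h 2) * w 2 - E (.g 1) * w 0 := by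
      rw [hwi] at e2
      linear_combination (-2) * e2
    have hi : E (.h 1) = (E (.g 2) * w 0 + E (.g 0) * w 2) / 2 := by
      rw [hwi] at e1
      linear_combination e1
    rw [gk, gj] at hi
    refine ⟨!![1, 0, 0; 0, 0, 0; 0, 0, 1],
      -!![1, -w 0, 0; -w 0, w 0 ^ 2 + w 2 ^ 2, -w 2; 0, -w 2, 1],
      IsSymm.ext fun i j => by fin_cases i <;> fin_cases j <;> rfl,
      (IsSymm.ext fun i j => by fin_cases i <;> fin_cases j <;> rfl : IsSymm _).neg, ?_, ?_, fun h0
          => hν ?_⟩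
    · simp [eval, lower, flip, translate, det_fin_three, hs, ht, hε, hi, gj, gk]
      ring
    · ext a b
      fin_cases a <;> fin_cases b <;>
      · simp [symS, eval, lower, flip, translate, det_fin_three, hs, ht, hε, hi, gj, gk]
        try ring
    · have h1 := congrArg (fun A => w ⬝ᵥ (A *ᵥ w)) h0
      simp [dotProduct, mulVec, Fin.sum_univ_three, symH, eval, lower, flip, translate,
        det_fin_three, hs, ht, hε, hi, gj, gk, hwi] at h1
      linear_combination h1
  · simp only [Fin.reduceFinMk] at hwi
    have gk : E (.g 1) = 2 * E (.h 0) * w 0 - E (.g 2) * w 1 := by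
      rw [hwi] at e0
      linear_combination (-2) * e0
    have gj : E (.g 0) = 2 * E (.h 1) * w 1 - E (.g 2) * w 0 := by
      rw [hwi] at e1
      linear_combination (-2) * e1
    have hi : E (.h 2) = (E (.g 1) * w 0 + E (.g 0) * w 1) / 2 := by
      rw [hwi] at e2
      linear_combination e2
    rw [gk, gj] at hi
    refine ⟨!![1, 0, 0; 0, 1, 0; 0, 0, 0],
      -!![1, 0, -w 0; 0, 1, -w 1; -w 0, -w 1, w 0 ^ 2 + w 1 ^ 2],
      IsSymm.ext fun i j => by fin_cases i <;> fin_cases j <;> rfl,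
      (IsSymm.ext fun i j => by fin_cases i <;> fin_cases j <;> rfl : IsSymm _).neg, ?_, ?_, fun h0
          => hν ?_⟩
    · simp [eval, lower, flip, translate, det_fin_three, hs, ht, hε, hi, gj, gk]
      ring
    · ext a b
      fin_cases a <;> fin_cases b <;>
      · simp [symS, eval, lower, flip, translate, det_fin_three, hs, ht, hε, hi, gj, gk]
        try ring
    · have h1 := congrArg (fun A => w ⬝ᵥ (A *ᵥ w)) h0
      simp [dotProduct, mulVec, Fin.sum_univ_three, symH, eval, lower, flip, translate,
        det_fin_three, hs, ht, hε, hi, gj, gk, hwi] at h1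
      linear_combination h1

/-- A translation makes the constant `ν` nonzero. Then `ν det (X + C P)` contributes `ν tr (C P adj
X)`, so `C = -ν⁻¹ S` removes the linear terms. -/
theorem exists_equivalent_isLinear [CharZero K] (E : MongeAmpere K) (hE : E ≠ 0)
    (hQ : E.quartic = 0) : ∃ L : MongeAmpere K, L.IsLinear ∧ E.Equivalent L := by
  obtain ⟨T, hT, hET⟩ : ∃ T : Matrix (Fin 3) (Fin 3) K, T.IsSymm ∧ E.eval T ≠ 0 := by
    by_contra! h
    exact hE (eq_zero_of_eval_eq_zero E h)
  have hC : (-(E.translate T .nu)⁻¹ • symS (E.translate T)).IsSymm := (symS_isSymm _).smul _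
  have hQ' : ((E.translate T).lower (-(E.translate T .nu)⁻¹ • symS (E.translate T))).quartic =
      0 := by
    rw [quartic_lower _ hC, quartic_translate _ hT, hQ]
  have heq := (equivalent_translate E hT).trans (equivalent_lower _ hC)
  have hν' : (E.translate T) .nu ≠ 0 := hET
  generalize E.translate T = E₁ at *
  obtain ⟨L, hL, h⟩ : ∃ L : MongeAmpere K, L.IsLinear ∧
      (E₁.lower (-(E₁ .nu)⁻¹ • symS E₁)).Equivalent L := by
    have hs (i) : (E₁.lower (-(E₁ .nu)⁻¹ • symS E₁)) (.s i) = 0 := by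
      fin_cases i <;> simp [lower, flip, translate, symS, hν']
    have ht (i) : (E₁.lower (-(E₁ .nu)⁻¹ • symS E₁)) (.tau i) = 0 := by
      fin_cases i <;>
      · simp [lower, flip, translate, symS]
        field_simp
        ring
    have hν : (E₁.lower (-(E₁ .nu)⁻¹ • symS E₁)) .nu ≠ 0 := by
      simpa [lower, flip, translate] using hν'
    by_cases hε : (E₁.lower (-(E₁ .nu)⁻¹ • symS E₁)) .eps = 0
    · exact exists_equivalent_isLinear_of_eps_eq_zero _ hs ht hν hε hQ'
    · exact exists_equivalent_isLinear_of_eps_ne_zero _ hs ht hν hε hQ'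
  exact ⟨L, hL, heq.trans h⟩

end MongeAmpere

/-! ### General position of Lagrangian planes; quartics of linearizable equations. -/

variable {K : Type*} [Field K]

theorem dotProduct_mulVec_mulVec_comm {P X : Matrix (Fin 3) (Fin 3) K} (h : Pᵀ * X = Xᵀ * P)
    (w u : Fin 3 → K) : (P *ᵥ w) ⬝ᵥ (X *ᵥ u) = (X *ᵥ w) ⬝ᵥ (P *ᵥ u) := by
  have key (A B : Matrix (Fin 3) (Fin 3) K) : (A *ᵥ w) ⬝ᵥ (B *ᵥ u) = w ⬝ᵥ ((Aᵀ * B) *ᵥ u) := by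
    rw [← mulVec_mulVec, dotProduct_mulVec w, vecMul_transpose]
  rw [key, key, h]

/-- Every Lagrangian plane is transversal to the graph of some symmetric matrix. -/
theorem exists_isSymm_det_ne_zero {P X : Matrix (Fin 3) (Fin 3) K} (h : Pᵀ * X = Xᵀ * P)
    (hk : ∀ v, P *ᵥ v = 0 → X *ᵥ v = 0 → v = 0) :
    ∃ C : Matrix (Fin 3) (Fin 3) K, C.IsSymm ∧ (X + C * P).det ≠ 0 := by
  obtain ⟨d, hd⟩ : ∃ d, Module.finrank K (LinearMap.ker X.mulVecLin) = d := ⟨_, rfl⟩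
  induction d using Nat.strong_induction_on generalizing X with
  | _ d ih =>
    by_cases hX : X.det = 0
    swap
    · exact ⟨0, isSymm_zero, by simpa using hX⟩
    obtain ⟨w, hw, hXw⟩ := exists_mulVec_eq_zero_iff.2 hX
    obtain ⟨i, hi⟩ := Function.ne_iff.1 fun hP => hw (hk w hP hXw)
    rw [Pi.zero_apply] at hi
    -- Adding `eᵢ eᵢᵀ P` to `X` shrinks the kernel. If `(X + C P) u = 0`, pairing with `P w` and
    -- using the Lagrangian condition and `X w = 0` leaves `(P w)ᵢ (P u)ᵢ = 0`. Hence `(P u)ᵢ = 0`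
    -- and `X u = 0`, while `w` itself drops out of the kernel.
    set C : Matrix (Fin 3) (Fin 3) K := vecMulVec (Pi.single i 1) (Pi.single i 1) with hC
    have hCs : C.IsSymm := by rw [IsSymm, hC, transpose_vecMulVec]
    have hCv (v : Fin 3 → K) : C *ᵥ v = v i • Pi.single i 1 := by
      rw [hC, vecMulVec_mulVec]
      ext j
      simp [mul_comm]
    have hX' : Pᵀ * (X + C * P) = (X + C * P)ᵀ * P := by
      rw [mul_add, transpose_add, add_mul, h, transpose_mul, hCs.eq, mul_assoc]
    have hsub {u : Fin 3 → K} (hu : (X + C * P) *ᵥ u = 0) : (P *ᵥ u) i = 0 := by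
      have h1 : (P *ᵥ w) ⬝ᵥ ((X + C * P) *ᵥ u) = 0 := by rw [hu, dotProduct_zero]
      rw [add_mulVec, dotProduct_add, dotProduct_mulVec_mulVec_comm h, hXw, zero_dotProduct,
        zero_add, ← mulVec_mulVec, hCv, dotProduct_smul, dotProduct_single] at h1
      simpa [hi] using h1
    have hlt : LinearMap.ker (X + C * P).mulVecLin < LinearMap.ker X.mulVecLin := by
      refine lt_of_le_of_ne (fun u hu => ?_) fun he => hi (hsub ?_)
      · rw [LinearMap.mem_ker, mulVecLin_apply] at hu ⊢
        have := hsub hu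
        rw [add_mulVec, ← mulVec_mulVec, hCv, this, zero_smul, add_zero] at hu
        exact hu
      · have : w ∈ LinearMap.ker X.mulVecLin := by simpa using hXw
        rwa [← he, LinearMap.mem_ker, mulVecLin_apply] at this
    obtain ⟨C', hC', hdet⟩ := ih _ (hd ▸ Submodule.finrank_lt_finrank_of_lt hlt) hX'
      (fun v h1 h2 => hk v h1 (by
        rw [add_mulVec, ← mulVec_mulVec, h1, mulVec_zero, add_zero] at h2; exact h2)) rfl
    exact ⟨C + C', hCs.add hC', by rwa [add_mul, ← add_assoc]⟩

theorem det_add_smul_fin_three {R : Type*} [CommRing R] (N Z : Matrix (Fin 3) (Fin 3) R) (t : R) :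
    (N + t • Z).det = N.det + t * (N.adjugate * Z).trace + t ^ 2 * (Z.adjugate * N).trace
      + t ^ 3 * Z.det := by
  simp only [trace_fin_three, adjugate_fin_three, det_fin_three, mul_apply, Fin.sum_univ_three,
    Matrix.add_apply, Matrix.smul_apply, smul_eq_mul, of_apply, cons_val', cons_val_zero,
    cons_val_one, cons_val, cons_val_fin_one]
  ring

-- There are no zero divisors in `K[t]`. This removes the restriction to nonvanishing determinants
-- from an identity.
open Polynomial in
theorem cubic_mul_cubic [Infinite K] {a₀ a₁ a₂ a₃ b₀ b₁ b₂ b₃ : K}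
    (h : ∀ t, (a₀ + t * a₁ + t ^ 2 * a₂ + t ^ 3 * a₃) * (b₀ + t * b₁ + t ^ 2 * b₂ + t ^ 3 * b₃) = 0)
    (hb : b₀ ≠ 0) (t : K) : a₀ + t * a₁ + t ^ 2 * a₂ + t ^ 3 * a₃ = 0 := by
  let p (a₀ a₁ a₂ a₃ : K) : K[X] := C a₀ + X * C a₁ + X ^ 2 * C a₂ + X ^ 3 * C a₃
  have hp (a₀ a₁ a₂ a₃ t : K) : (p a₀ a₁ a₂ a₃).eval t = a₀ + t * a₁ + t ^ 2 * a₂ + t ^ 3 * a₃ := by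
    simp only [p, Polynomial.eval_add, Polynomial.eval_mul, Polynomial.eval_pow, Polynomial.eval_X,
      Polynomial.eval_C]
  have h0 : p a₀ a₁ a₂ a₃ * p b₀ b₁ b₂ b₃ = 0 := by
    refine Polynomial.funext fun t => ?_
    rw [Polynomial.eval_mul, hp, hp, h, Polynomial.eval_zero]
  rcases mul_eq_zero.1 h0 with h0 | h0
  · rw [← hp, h0, Polynomial.eval_zero]
  · exact absurd (by rw [← Polynomial.eval_zero (x := 0), ← h0, hp]; ring) hb

namespace MongeAmpere

theorem eval_smul_eq [CharZero K] (E : MongeAmpere K) {V : Matrix (Fin 3) (Fin 3) K} (hV : V.IsSymm)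
    (t : K) : E.eval (t • V) = E .nu + t * (symS E * V).trace + t ^ 2 * (symH E * V.adjugate).trace
      + t ^ 3 * (E .eps * V.det) := by
  have h1 : V 1 0 = V 0 1 := hV.apply 0 1
  have h2 : V 2 0 = V 0 2 := hV.apply 0 2
  have h3 : V 2 1 = V 1 2 := hV.apply 1 2
  simp only [eval, symS, symH, trace_fin_three, adjugate_fin_three, det_fin_three, mul_apply,
    Fin.sum_univ_three, Matrix.smul_apply, smul_eq_mul, of_apply, cons_val', cons_val_zero,
    cons_val_one, cons_val, cons_val_fin_one, h1, h2, h3]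
  ring

theorem eval_sub (E E' : MongeAmpere K) (U : Matrix (Fin 3) (Fin 3) K) :
    (E - E').eval U = E.eval U - E'.eval U := by
  simp only [eval, Pi.sub_apply]
  ring

/-- On the line `t V` both the difference of the equations and `det (N + t C V)` are cubic in `t`.
Their product vanishes identically, and the second is nonzero at `t = 0`. -/
theorem eq_of_eval_eq_of_det_ne_zero [CharZero K] {E E' : MongeAmpere K} {N C : Matrix (Fin 3) (Fin
    3) K}
    (hN : N.det ≠ 0) (h : ∀ V : Matrix (Fin 3) (Fin 3) K, V.IsSymm → (N + C * V).det ≠ 0 →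
      E.eval V = E'.eval V) : E = E' := by
  rw [← sub_eq_zero]
  refine eq_zero_of_eval_eq_zero _ fun V hV => ?_
  have hab := eval_smul_eq (E - E') hV
  have h1 := hab 1
  rw [one_smul] at h1
  rw [h1]
  refine cubic_mul_cubic (b₀ := N.det) (b₁ := (N.adjugate * (C * V)).trace)
    (b₂ := ((C * V).adjugate * N).trace) (b₃ := (C * V).det) (fun t => ?_) hN 1
  rw [← hab, ← det_add_smul_fin_three, eval_sub, ← mul_smul_comm]
  by_cases hd : (N + C * t • V).det = 0
  · rw [hd, mul_zero]
  · rw [h _ (hV.smul t) hd, sub_self, zero_mul]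

/-- The linear equation with given symmetric matrix and constant term. -/
def ofSymm (S : Matrix (Fin 3) (Fin 3) K) (ν : K) : MongeAmpere K
  | .s i => S i i
  | .tau 0 => 2 * S 1 2
  | .tau 1 => 2 * S 0 2
  | .tau 2 => 2 * S 0 1
  | .nu => ν
  | _ => 0

theorem symS_ofSymm [CharZero K] {S : Matrix (Fin 3) (Fin 3) K} (hS : S.IsSymm) (ν : K) :
    symS (ofSymm S ν) = S := by
  have h1 : S 1 0 = S 0 1 := hS.apply 0 1
  have h2 : S 2 0 = S 0 2 := hS.apply 0 2
  have h3 : S 2 1 = S 1 2 := hS.apply 1 2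
  ext i j
  fin_cases i <;> fin_cases j <;> simp [symS, ofSymm, h1, h2, h3]

theorem hom_of_quadratic_eq_zero {L : MongeAmpere K} (hε : L .eps = 0) (hh : ∀ i, L (.h i) = 0)
    (hg : ∀ i, L (.g i) = 0) (P X : Matrix (Fin 3) (Fin 3) K) :
    L.hom P X = (symS L * (P * X.adjugate)).trace + L .nu * X.det := by
  have hH : symH L = 0 := by
    ext i j
    fin_cases i <;> fin_cases j <;> simp [symH, hh, hg]
  simp [hom, hε, hH]

theorem hom_ofSymm [CharZero K] {S : Matrix (Fin 3) (Fin 3) K} (hS : S.IsSymm) (ν : K)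
    (P X : Matrix (Fin 3) (Fin 3) K) :
    (ofSymm S ν).hom P X = (S * (P * X.adjugate)).trace + ν * X.det := by
  rw [hom_of_quadratic_eq_zero rfl (fun _ => rfl) (fun _ => rfl), symS_ofSymm hS]
  rfl

theorem quartic_of_isLinear {L : MongeAmpere K} (hε : L .eps = 0) (hh : ∀ i, L (.h i) = 0)
    (hg : ∀ i, L (.g i) = 0) : L.quartic = 0 := by
  simp [quartic, hε, hh, hg]

/-- The symplectic matrix factors as a translation by `T`, a `lower`, a block-diagonal matrix and
another translation. The block-diagonal factor replaces the matrix `S` of a linear equation by a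
multiple of a congruent one, so it keeps the equation linear; the other factors preserve the
quartic. -/
theorem Linearizable.quartic_eq_zero [CharZero K] {E : MongeAmpere K} (h : E.Linearizable) :
    E.quartic = 0 := by
  obtain ⟨M, hM, L, ⟨hε, hh, hg, -⟩, h⟩ := h
  have hsymm (U : Matrix (Fin 3) (Fin 3) K) (hU : U.IsSymm) :=
    symplectic_isSymm hM (P := U) (X := 1) (by simpa using hU.eq)
  have hsp := SymplecticGroup.mem_iff.1 hM
  have hsp' := SymplecticGroup.mem_iff'.1 hM
  rw [← fromBlocks_toBlocks M] at hsp hsp'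
  generalize M.toBlocks₁₁ = A at *
  generalize M.toBlocks₁₂ = B at *
  generalize M.toBlocks₂₁ = C at *
  generalize M.toBlocks₂₂ = D at *
  simp only [J, fromBlocks_multiply, fromBlocks_transpose, fromBlocks_inj, mul_zero, zero_add,
    mul_one, mul_neg, add_zero, neg_mul] at hsp hsp' hsymm
  obtain ⟨-, a2, -, a4⟩ := hsp
  obtain ⟨b1, -, b3, -⟩ := hsp'
  have c1 : Aᵀ * C = Cᵀ * A := by rw [← sub_eq_zero, ← neg_eq_zero, ← b1]; noncomm_ring
  have d4 : C * Dᵀ = D * Cᵀ := by rw [← sub_eq_zero, ← neg_eq_zero, ← a4]; noncomm_ring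
  have d2 : A * Dᵀ = B * Cᵀ + 1 := by
    rw [← sub_eq_zero, ← neg_eq_zero, ← sub_eq_zero.2 a2]; noncomm_ring
  -- The lower blocks `C, D` of a symplectic matrix give a Lagrangian frame, so `C T + D` is
  -- invertible for some symmetric `T`.
  obtain ⟨T, hT, hdet⟩ := exists_isSymm_det_ne_zero (P := Cᵀ) (X := Dᵀ) (by simpa using d4)
    (fun v h1 h2 => by
      have := congrArg (· *ᵥ v) d2
      simpa [add_mulVec, ← mulVec_mulVec, h1, h2] using this.symm)
  set N := C * T + D with hNdef
  set Q := A * T + B with hQdef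
  have hN : N.det ≠ 0 := by
    rw [← det_transpose]
    simpa [hNdef, hT.eq, add_comm] using hdet
  have hu : IsUnit N.det := isUnit_iff_ne_zero.2 hN
  have hQN : Qᵀ * N = Nᵀ * Q := hsymm T hT
  have hB : (Q * N⁻¹).IsSymm := by
    have h2 : N⁻¹ᵀ * Nᵀ = 1 := by rw [← transpose_mul, mul_nonsing_inv _ hu, transpose_one]
    calc (Q * N⁻¹)ᵀ = N⁻¹ᵀ * (Qᵀ * N) * N⁻¹ := by
          rw [mul_assoc, mul_assoc, mul_nonsing_inv _ hu, mul_one, transpose_mul]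
      _ = Q * N⁻¹ := by rw [hQN, ← mul_assoc, h2, one_mul]
  -- This is the upper-left block of the block-diagonal factor; it equals the inverse transpose of
  -- `N`.
  set G := A - Q * N⁻¹ * C with hG
  have hNG : Nᵀ * G = 1 := by
    calc Nᵀ * G = Nᵀ * A - Qᵀ * N * N⁻¹ * C := by rw [hQN, hG]; noncomm_ring
      _ = Nᵀ * A - Qᵀ * C := by rw [mul_assoc Qᵀ, mul_nonsing_inv _ hu, mul_one]
      _ = T * (Cᵀ * A - Aᵀ * C) + (Dᵀ * A + -(Bᵀ * C)) := by
        rw [hNdef, hQdef, transpose_add, transpose_add, transpose_mul, transpose_mul, hT.eq]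
        noncomm_ring
      _ = 1 := by rw [c1, sub_self, mul_zero, zero_add, b3]
  have hGN : N * Gᵀ = 1 := by
    rw [mul_eq_one_comm]
    simpa using congrArg transpose hNG
  have hadj : N.adjugate = N.det • Gᵀ := by
    calc N.adjugate = N.adjugate * N * Gᵀ := by rw [mul_assoc, hGN, mul_one]
      _ = N.det • Gᵀ := by rw [adjugate_mul, smul_mul_assoc, one_mul]
  have hC₀ : (Gᵀ * C).IsSymm := by
    have h1 : (Gᵀ * C)ᵀ = Cᵀ * A - Cᵀ * (Q * N⁻¹) * C := by
      rw [transpose_mul, transpose_transpose, hG]; noncomm_ring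
    have h2 : Gᵀ * C = Aᵀ * C - Cᵀ * (Q * N⁻¹)ᵀ * C := by
      rw [hG, transpose_sub, transpose_mul]; noncomm_ring
    rw [IsSymm, h1, h2, hB.eq, c1]
  set L' := L.translate (Q * N⁻¹) with hL'
  have hS : (N.det • (Gᵀ * symS L' * G)).IsSymm := by
    refine IsSymm.smul ?_ _
    rw [IsSymm, transpose_mul, transpose_mul, transpose_transpose, (symS_isSymm L').eq, mul_assoc]
  have key : E.translate T =
      (ofSymm (N.det • (Gᵀ * symS L' * G)) (N.det * L' .nu)).lower (Gᵀ * C) := by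
    refine eq_of_eval_eq_of_det_ne_zero hN (C := C) fun V hV hd => ?_
    have e1 : C * (V + T) + D = N + C * V := by rw [hNdef]; noncomm_ring
    have e2 : A * (V + T) + B = G * V + Q * N⁻¹ * (N + C * V) := by
      calc A * (V + T) + B = A * V + Q := by rw [hQdef]; noncomm_ring
        _ = A * V + Q * (N⁻¹ * N) := by rw [nonsing_inv_mul _ hu, mul_one]
        _ = G * V + Q * N⁻¹ * (N + C * V) := by rw [hG]; noncomm_ring
    have e3 : N + C * V = N * (1 + Gᵀ * C * V) := by
      rw [mul_add, mul_one, mul_assoc Gᵀ, ← mul_assoc N, hGN, one_mul]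
    have h1 := hsymm (V + T) (hV.add hT)
    have h2 := h (V + T) (hV.add hT)
    rw [e1] at h1 h2
    rw [eval_translate E hT hV, h2 hd, ← eval_eq_hom_mul _ h1 hd, e2, ← hom_translate _ hB,
      ← hom_one _ hV, hom_lower _ hC₀, hom_ofSymm hS,
      hom_of_quadratic_eq_zero (by simp [translate, hε])
        (fun i => by simp [translate, hε, hh]) (fun i => by fin_cases i <;> simp [translate, hε,
            hg]),
      e3, adjugate_mul_distrib, hadj, det_mul, ← hL']
    congr 1
    · simp only [mul_smul_comm, smul_mul_assoc, trace_smul]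
      congr 1
      rw [trace_mul_comm, ← mul_assoc (G * V), mul_assoc _ Gᵀ, trace_mul_comm]
      simp only [mul_assoc]
    · ring
  rw [← quartic_translate E hT, key, quartic_lower _ hC₀]
  exact quartic_of_isLinear rfl (fun _ => rfl) (fun _ => rfl)

theorem linearizable_iff [CharZero K] {E : MongeAmpere K} (hE : E ≠ 0) :
    E.Linearizable ↔ E.quartic = 0 := by
  refine ⟨Linearizable.quartic_eq_zero, fun hQ => ?_⟩
  obtain ⟨L, hL, h⟩ := exists_equivalent_isLinear E hE hQ
  exact h.linearizable hL

end MongeAmpere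

/-! ### Tangent hyperplanes of the Lagrangian Grassmannian. -/

namespace MongeAmpere

/-- On Lagrangian frames the homogeneous form of the equation is the linear form in the Plücker
coordinates. -/
theorem pairing_plucker (E : MongeAmpere ℂ) {P X : Matrix (Fin 3) (Fin 3) ℂ} (h : Pᵀ * X = Xᵀ * P) :
    E.pairing (plucker P X) = E.hom P X := by
  have c01 := congrFun (congrFun h 0) 1
  have c02 := congrFun (congrFun h 0) 2
  have c12 := congrFun (congrFun h 1) 2
  simp only [mul_apply, Fin.sum_univ_three, transpose_apply] at c01 c02 c12
  simp only [MongeAmpere.pairing, plucker, Fin.sum_univ_three, hom, symS, symH, trace_fin_three,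
    adjugate_fin_three, det_fin_three, mul_apply, Matrix.updateRow_apply, of_apply, cons_val',
    cons_val_zero, cons_val_one, cons_val, cons_val_fin_one, Fin.isValue, Fin.reduceEq, if_true,
    if_false]
  -- Off the diagonal `plucker` uses one of two minors that agree on Lagrangian frames, while `hom`
  -- uses their mean.
  linear_combination (E (.g 0) / 2) * (P 0 0 * c12 - P 0 1 * c02 + P 0 2 * c01)
    - (E (.g 1) / 2) * (P 1 0 * c12 - P 1 1 * c02 + P 1 2 * c01)
    + (E (.g 2) / 2) * (P 2 0 * c12 - P 2 1 * c02 + P 2 2 * c01)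
    - (E (.tau 0) / 2) * (X 0 0 * c12 - X 0 1 * c02 + X 0 2 * c01)
    + (E (.tau 1) / 2) * (X 1 0 * c12 - X 1 1 * c02 + X 1 2 * c01)
    - (E (.tau 2) / 2) * (X 2 0 * c12 - X 2 1 * c02 + X 2 2 * c01)

theorem differentiableAt_det {F : Type*} [NormedAddCommGroup F] [NormedSpace ℂ F] {z : F}
    {A : F → Matrix (Fin 3) (Fin 3) ℂ} (h : ∀ i j, DifferentiableAt ℂ (fun w => A w i j) z) :
    DifferentiableAt ℂ (fun w => (A w).det) z := by
  simp only [det_fin_three]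
  fun_prop

theorem differentiableAt_plucker {F : Type*} [NormedAddCommGroup F] [NormedSpace ℂ F] {z : F}
    {A B : F → Matrix (Fin 3) (Fin 3) ℂ} (hA : ∀ i j, DifferentiableAt ℂ (fun w => A w i j) z)
    (hB : ∀ i j, DifferentiableAt ℂ (fun w => B w i j) z) (k : Idx) :
    DifferentiableAt ℂ (fun w => plucker (A w) (B w) k) z := by
  have hu {A B : F → Matrix (Fin 3) (Fin 3) ℂ} (hA : ∀ i j, DifferentiableAt ℂ (fun w => A w i j) z)
      (hB : ∀ i j, DifferentiableAt ℂ (fun w => B w i j) z) (r s : Fin 3) :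
      DifferentiableAt ℂ (fun w => ((A w).updateRow r (B w s)).det) z := by
    refine differentiableAt_det fun i j => ?_
    simp only [Matrix.updateRow_apply]
    split_ifs
    · exact hB s j
    · exact hA i j
  rcases k with _ | i | i | i | i | _
  · exact differentiableAt_det hA
  · exact hu hA hB i i
  · fin_cases i
    · exact (hu hA hB 1 2).neg
    · exact (hu hA hB 0 2).neg
    · exact (hu hA hB 0 1).neg
  · exact hu hB hA i i
  · fin_cases i
    · exact hu hB hA 2 1
    · exact hu hB hA 2 0
    · exact hu hB hA 1 0
  · exact differentiableAt_det hB

theorem deriv_mul_self {φ : ℂ → ℂ} (h : DifferentiableAt ℂ φ 0) :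
    deriv (fun t : ℂ => t * φ t) 0 = φ 0 := by
  rw [deriv_fun_mul differentiableAt_fun_id h]
  simp

theorem lagrangian_add_mul {P X C : Matrix (Fin 3) (Fin 3) ℂ} (h : Pᵀ * X = Xᵀ * P) (hC : C.IsSymm)
    :
    Pᵀ * (X + C * P) = (X + C * P)ᵀ * P := by
  rw [mul_add, transpose_add, add_mul, h, transpose_mul, hC.eq, mul_assoc]

/-- Each side is the differential of one polynomial map at `(P, X)`, hence additive in the
direction. Tangent vectors can thus be treated summand by summand. -/
theorem deriv_pairing_plucker_add (E : MongeAmpere ℂ) (P X P₁ X₁ P₂ X₂ : Matrix (Fin 3) (Fin 3) ℂ) :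
    deriv (fun t : ℂ => E.pairing (plucker (P + t • (P₁ + P₂)) (X + t • (X₁ + X₂)))) 0 =
      deriv (fun t : ℂ => E.pairing (plucker (P + t • P₁) (X + t • X₁))) 0 +
      deriv (fun t : ℂ => E.pairing (plucker (P + t • P₂) (X + t • X₂))) 0 := by
  let Φ : ℂ × ℂ → ℂ := fun z =>
    E.pairing (plucker (P + z.1 • P₁ + z.2 • P₂) (X + z.1 • X₁ + z.2 • X₂))
  have hΦ : DifferentiableAt ℂ Φ 0 := by
    have hp := differentiableAt_plucker (z := (0 : ℂ × ℂ))
      (A := fun z => P + z.1 • P₁ + z.2 • P₂) (B := fun z => X + z.1 • X₁ + z.2 • X₂)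
      (fun i j => by simp only [Matrix.add_apply, Matrix.smul_apply, smul_eq_mul]; fun_prop)
      (fun i j => by simp only [Matrix.add_apply, Matrix.smul_apply, smul_eq_mul]; fun_prop)
    simp only [Φ, MongeAmpere.pairing, Fin.sum_univ_three]
    fun_prop
  have hd (v : ℂ × ℂ) : deriv (fun t : ℂ => Φ (t • v)) 0 = fderiv ℂ Φ 0 v := by
    have h1 : HasDerivAt (fun t : ℂ => t • v) v 0 := by
      simpa using (hasDerivAt_id (0 : ℂ)).smul_const v
    have h2 : HasFDerivAt Φ (fderiv ℂ Φ 0) ((0 : ℂ) • v) := by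
      rw [zero_smul]; exact hΦ.hasFDerivAt
    exact (h2.comp_hasDerivAt 0 h1).deriv
  have e0 := hd (1, 1)
  have e1 := hd (1, 0)
  have e2 := hd (0, 1)
  have hsum : ((1, 1) : ℂ × ℂ) = (1, 0) + (0, 1) := by simp
  rw [hsum, map_add, ← e1, ← e2, ← hsum] at e0
  simpa [Φ, smul_add, add_assoc] using e0

theorem symS_eq_zero {K : Type*} [Field K] [CharZero K] {E : MongeAmpere K}
    (h : ∀ V : Matrix (Fin 3) (Fin 3) K, V.IsSymm → (symS E * V).trace = 0) : symS E = 0 := by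
  ext i j
  have := h (single i j 1 + single j i 1) (by
    rw [IsSymm, transpose_add, transpose_single, transpose_single, add_comm])
  rw [mul_add, trace_add, trace_mul_single, trace_mul_single] at this
  have hs : symS E j i = symS E i j := (symS_isSymm E).apply i j
  simp [hs] at this
  simpa using this

/-- Every monomial of the quartic contains `ν`, some `sᵢ` or some `τᵢ`. -/
theorem quartic_of_symS_eq_zero {K : Type*} [Field K] [CharZero K] {E : MongeAmpere K}
    (hν : E .nu = 0) (hS : symS E = 0) : E.quartic = 0 := by
  have e (i j : Fin 3) : symS E i j = 0 := by rw [hS]; rfl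
  have e0 := e 0 0
  have e1 := e 1 1
  have e2 := e 2 2
  have e3 := e 0 1
  have e4 := e 0 2
  have e5 := e 1 2
  simp [symS] at e0 e1 e2 e3 e4 e5
  simp [quartic, *]

theorem IsTangentHyperplane.quartic_eq_zero {E : MongeAmpere ℂ} (h : E.IsTangentHyperplane) :
    E.quartic = 0 := by
  obtain ⟨-, P, X, ⟨hPX, hk⟩, h0, h1⟩ := h
  obtain ⟨C, hC, hdet⟩ := exists_isSymm_det_ne_zero hPX hk
  have hu : IsUnit (X + C * P).det := isUnit_iff_ne_zero.2 hdet
  have hCn : (-C).IsSymm := hC.neg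
  set Y := X + C * P with hY
  have hPY : Pᵀ * Y = Yᵀ * P := by
    rw [hY, lagrangian_add_mul hPX hC]
  have hX : X = Y - C * P := by rw [hY]; abel
  have hU : (P * Y⁻¹).IsSymm := by
    have h2 : Y⁻¹ᵀ * Yᵀ = 1 := by rw [← transpose_mul, mul_nonsing_inv _ hu, transpose_one]
    calc (P * Y⁻¹)ᵀ = Y⁻¹ᵀ * (Pᵀ * Y) * Y⁻¹ := by
          rw [mul_assoc, mul_assoc, mul_nonsing_inv _ hu, mul_one, transpose_mul]
      _ = P * Y⁻¹ := by rw [hPY, ← mul_assoc, h2, one_mul]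
  -- In this chart the point of tangency is `U = 0`, and the curve in `key` is the straight line `t
  -- V`. Tangency therefore kills the constant and the linear part of `E'`.
  set E' := (E.lower (-C)).translate (P * Y⁻¹) with hE'
  have key (V : Matrix (Fin 3) (Fin 3) ℂ) (hV : V.IsSymm) (t : ℂ) :
      E.pairing (plucker (P + t • (V * Y)) (X + t • (-(C * V * Y)))) = Y.det * E'.eval (t • V) := by
    have e1 : X + t • (-(C * V * Y)) = Y + -C * (P + t • (V * Y)) := by
      rw [hX]
      simp only [mul_add, mul_smul_comm, neg_mul, mul_assoc, smul_neg]
      abel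
    have e2 : P + t • (V * Y) = (t • V + P * Y⁻¹) * Y := by
      rw [add_mul, mul_assoc P, nonsing_inv_mul _ hu, mul_one, smul_mul_assoc, add_comm]
    have hs : (P + t • (V * Y))ᵀ * Y = Yᵀ * (P + t • (V * Y)) := by
      simp only [transpose_add, transpose_smul, transpose_mul, hV.eq, add_mul, mul_add, hPY,
        smul_mul_assoc, mul_smul_comm, mul_assoc]
    have hlag : (P + t • (V * Y))ᵀ * (X + t • (-(C * V * Y))) =
        (X + t • (-(C * V * Y)))ᵀ * (P + t • (V * Y)) := by
      rw [e1]
      exact lagrangian_add_mul hs hCn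
    rw [pairing_plucker E hlag, e1, ← hom_lower E hCn, e2, ← hom_one _ (hV.smul t),
      hE', hom_translate _ hU, mul_one, ← hom_mul, one_mul]
  have hν : E' .nu = 0 := by
    have := key 0 isSymm_zero 0
    rw [eval_smul_eq E' isSymm_zero] at this
    simpa [h0, hdet] using this
  rw [← quartic_lower E hCn, ← quartic_translate _ hU]
  refine quartic_of_symS_eq_zero hν (symS_eq_zero fun V hV => ?_)
  have h2 := h1 (V * Y) (-(C * V * Y)) (by
    have e : (V * Y)ᵀ * X + Pᵀ * -(C * V * Y) = Yᵀ * V * Y - (Yᵀ * V * C * P + (Yᵀ * V * C *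
        P)ᵀ) := by
      have : X = Y - C * P := by rw [hY]; abel
      rw [this]
      simp only [transpose_mul, hV.eq, hC.eq, transpose_transpose]
      noncomm_ring
    rw [e]
    refine IsSymm.sub ?_ (isSymm_add_transpose_self _)
    rw [IsSymm]
    simp only [transpose_mul, transpose_transpose, hV.eq, mul_assoc])
  have h3 (t : ℂ) : E.pairing (plucker (P + t • (V * Y)) (X + t • (-(C * V * Y)))) =
      t * (Y.det * ((E'.symS * V).trace + t * (E'.symH * V.adjugate).trace
        + t ^ 2 * (E' .eps * V.det))) := by
    rw [key V hV, eval_smul_eq E' hV, hν]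
    ring
  simp only [h3] at h2
  rw [deriv_mul_self (by fun_prop)] at h2
  simpa [hdet] using h2

/-- The linear equation equivalent to `E` is singular at the frame `(1, 0)`. Its preimage under the
symplectic matrix is `(Dᵀ, -Cᵀ)`, the point of tangency. -/
theorem isTangentHyperplane_of_quartic_eq_zero {E : MongeAmpere ℂ} (hE : E ≠ 0)
    (hQ : E.quartic = 0) : E.IsTangentHyperplane := by
  obtain ⟨L, ⟨hε, hh, hgL, -⟩, M, hM, h⟩ := exists_equivalent_isLinear E hE hQ
  have hsp := SymplecticGroup.mem_iff.1 hM
  rw [← fromBlocks_toBlocks M] at hsp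
  generalize M.toBlocks₁₁ = A at *
  generalize M.toBlocks₁₂ = B at *
  generalize M.toBlocks₂₁ = C at *
  generalize M.toBlocks₂₂ = D at *
  simp only [J, fromBlocks_multiply, fromBlocks_transpose, fromBlocks_inj, mul_zero, zero_add,
    mul_one, mul_neg, add_zero, neg_mul] at hsp
  obtain ⟨-, a2, -, a4⟩ := hsp
  have d4 : C * Dᵀ = D * Cᵀ := by rw [← sub_eq_zero, ← neg_eq_zero, ← a4]; noncomm_ring
  have d2 : A * Dᵀ = B * Cᵀ + 1 := by
    rw [← sub_eq_zero, ← neg_eq_zero, ← sub_eq_zero.2 a2]; noncomm_ring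
  have hA : A * Dᵀ + B * -Cᵀ = 1 := by rw [d2]; noncomm_ring
  have hB : C * Dᵀ + D * -Cᵀ = 0 := by rw [d4]; noncomm_ring
  have hPX : Dᵀᵀ * -Cᵀ = (-Cᵀ)ᵀ * Dᵀ := by simp [d4]
  have hk (v : Fin 3 → ℂ) (h1 : Dᵀ *ᵥ v = 0) (h2 : -Cᵀ *ᵥ v = 0) : v = 0 := by
    rw [← one_mulVec v, ← hA, add_mulVec, ← mulVec_mulVec, ← mulVec_mulVec, h1, h2]
    simp
  obtain ⟨T, hT, hdet⟩ := exists_isSymm_det_ne_zero hPX hk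
  have h0 : E.hom Dᵀ (-Cᵀ) = 0 := by
    rw [h, hA, hB, hom_of_quadratic_eq_zero hε hh hgL]
    simp
  refine ⟨hE, Dᵀ, -Cᵀ, ⟨hPX, hk⟩, by rw [pairing_plucker E hPX, h0], fun P' X' hP' => ?_⟩
  generalize Dᵀ = P at *
  generalize -Cᵀ = X at *
  have hu : IsUnit (X + T * P).det := isUnit_iff_ne_zero.2 hdet
  set Y := X + T * P with hY
  have hPY : Pᵀ * Y = Yᵀ * P := by
    rw [hY, lagrangian_add_mul hPX hT]
  have hX : X = Y - T * P := by rw [hY]; abel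
  set g := Y⁻¹ * (X' + T * P') with hg
  set V := (P' - P * g) * Y⁻¹ with hVdef
  have hVY : V * Y = P' - P * g := by rw [hVdef, mul_assoc, nonsing_inv_mul _ hu, mul_one]
  have hYg : Y * g = X' + T * P' := by rw [hg, ← mul_assoc, mul_nonsing_inv _ hu, one_mul]
  have hV : V.IsSymm := by
    have h1 : Pᵀ * Y * g = Pᵀ * (X' + T * P') := by rw [mul_assoc, hYg]
    have h2 : gᵀ * Yᵀ * P = (X' + T * P')ᵀ * P := by rw [← transpose_mul, hYg]
    have h3 : Yᵀ * (V * Y) - (V * Y)ᵀ * Y = 0 := by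
      have e : Yᵀ * (V * Y) - (V * Y)ᵀ * Y = (P'ᵀ * X + Pᵀ * X')ᵀ - (P'ᵀ * X + Pᵀ * X') := by
        calc Yᵀ * (V * Y) - (V * Y)ᵀ * Y
            = Yᵀ * P' - Yᵀ * P * g - P'ᵀ * Y + gᵀ * (Pᵀ * Y) := by
              rw [hVY, transpose_sub, transpose_mul]; noncomm_ring
          _ = Yᵀ * P' - Pᵀ * (X' + T * P') - P'ᵀ * Y + (X' + T * P')ᵀ * P := by
              rw [← h1, ← h2, hPY, mul_assoc gᵀ]
          _ = _ := by
              simp only [hY, transpose_add, transpose_mul, transpose_transpose, hT.eq]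
              noncomm_ring
      rw [e, hP'.eq, sub_self]
    have hu' : IsUnit Yᵀ.det := by rwa [det_transpose]
    rw [transpose_mul, ← mul_assoc, ← sub_mul, ← mul_sub] at h3
    have h4 : Yᵀ⁻¹ * (Yᵀ * (V - Vᵀ) * Y) * Y⁻¹ = 0 := by rw [h3]; simp
    rw [mul_assoc, mul_assoc, mul_nonsing_inv _ hu, mul_one, ← mul_assoc, nonsing_inv_mul _ hu',
      one_mul, sub_eq_zero] at h4
    exact h4.symm
  -- The summand `(P g, X g)` only changes the basis of the plane; the symmetric matrix `V`
  -- describes the motion of the plane itself.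
  have hsplit : P' = V * Y + P * g ∧ X' = -(T * V * Y) + X * g := by
    constructor
    · rw [hVY]; abel
    · have : X = Y - T * P := by rw [hY]; abel
      rw [this, sub_mul, hYg, mul_assoc T V, hVY]
      noncomm_ring
  rw [hsplit.1, hsplit.2, deriv_pairing_plucker_add]
  have z1 : (fun t : ℂ => E.pairing (plucker (P + t • (P * g)) (X + t • (X * g)))) = fun _ =>
      0 := by
    funext t
    have e1 (A : Matrix (Fin 3) (Fin 3) ℂ) : A + t • (A * g) = A * (1 + t • g) := by
      rw [mul_add, mul_one, mul_smul_comm]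
    rw [e1, e1, pairing_plucker, hom_mul, h0, mul_zero]
    rw [transpose_mul, transpose_mul, mul_assoc, ← mul_assoc _ X, hPX]
    simp only [mul_assoc]
  set Z₁ := A * (V * Y) + B * -(T * V * Y) with hZ₁
  set Z₂ := C * (V * Y) + D * -(T * V * Y) with hZ₂
  -- After the symplectic transformation the lower block is `t Z₂`, so the linear equation, having
  -- order two in that block, is divisible by `t²`.
  have z2 (t : ℂ) : E.pairing (plucker (P + t • (V * Y)) (X + t • (-(T * V * Y)))) =
      t ^ 2 * ((symS L * Z₂.adjugate).trace +
        t * ((symS L * (Z₁ * Z₂.adjugate)).trace + L .nu * Z₂.det)) := by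
    have e1 : X + t • (-(T * V * Y)) = Y + -T * (P + t • (V * Y)) := by
      rw [hX]
      simp only [mul_add, mul_smul_comm, neg_mul, mul_assoc, smul_neg]
      abel
    have hlag : (P + t • (V * Y))ᵀ * (X + t • (-(T * V * Y))) =
        (X + t • (-(T * V * Y)))ᵀ * (P + t • (V * Y)) := by
      have hs : (P + t • (V * Y))ᵀ * Y = Yᵀ * (P + t • (V * Y)) := by
        simp only [transpose_add, transpose_smul, transpose_mul, hV.eq, add_mul, mul_add, hPY,
          smul_mul_assoc, mul_smul_comm, mul_assoc]
      rw [e1]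
      exact lagrangian_add_mul hs hT.neg
    have e2 : A * (P + t • (V * Y)) + B * (X + t • (-(T * V * Y))) = 1 + t • Z₁ := by
      rw [← hA, hZ₁]
      simp only [mul_add, mul_smul_comm, smul_add]
      abel
    have e3 : C * (P + t • (V * Y)) + D * (X + t • (-(T * V * Y))) = t • Z₂ := by
      rw [← zero_add (t • Z₂), ← hB, hZ₂]
      simp only [mul_add, mul_smul_comm, smul_add]
      abel
    rw [pairing_plucker E hlag, h, e2, e3, hom_of_quadratic_eq_zero hε hh hgL, adjugate_smul,
      det_smul]
    simp only [Fintype.card_fin, Nat.add_one_sub_one, add_mul, one_mul, mul_add, mul_smul_comm,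
        smul_mul_assoc, trace_add,
      trace_smul, smul_eq_mul, smul_add]
    ring
  rw [z1]
  simp only [z2]
  have h3 (a b : ℂ) : deriv (fun t : ℂ => t ^ 2 * (a + t * b)) 0 = 0 := by
    have := deriv_mul_self (φ := fun t => t * (a + t * b)) (by fun_prop)
    simpa [pow_two, mul_assoc] using this
  rw [h3, deriv_const, add_zero]

theorem quartic_eq_zero_iff_isTangentHyperplane {E : MongeAmpere ℂ} (hE : E ≠ 0) :
    E.quartic = 0 ↔ E.IsTangentHyperplane :=
  ⟨isTangentHyperplane_of_quartic_eq_zero hE, IsTangentHyperplane.quartic_eq_zero⟩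

end MongeAmpere

/-! ### The ideal of the dual variety. -/

open MvPolynomial in
theorem eval_quarticPoly (x : Idx → ℂ) : eval x quarticPoly = MongeAmpere.quartic x := by
  simp [quarticPoly, MongeAmpere.quartic]

/-- Replace the last coefficient of an equation. -/
def setNu (x : Idx → ℂ) (y : ℂ) : Idx → ℂ
  | .nu => y
  | i => x i

/-- The polynomial does not depend on the last coefficient. -/
def NuFree (p : MvPolynomial Idx ℂ) : Prop :=
  ∀ x y, MvPolynomial.eval (setNu x y) p = MvPolynomial.eval x p

/-- The coefficient of `ν` in the quartic. -/
def quarticLin : MvPolynomial Idx ℂ :=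
  let X := MvPolynomial.X (R := ℂ) (σ := Idx)
  4 * X (.h 0) * X (.h 1) * X (.h 2) - X (.g 0) * X (.g 1) * X (.g 2)
    - (X (.g 0) ^ 2 * X (.h 0) + X (.g 1) ^ 2 * X (.h 1) + X (.g 2) ^ 2 * X (.h 2))
    + X .eps * (X (.g 0) * X (.tau 0) + X (.g 1) * X (.tau 1) + X (.g 2) * X (.tau 2))
    - 2 * X .eps * (X (.h 0) * X (.s 0) + X (.h 1) * X (.s 1) + X (.h 2) * X (.s 2))

/-- The part of the quartic of degree zero in `ν`. -/
def quarticConst : MvPolynomial Idx ℂ :=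
  quarticPoly - MvPolynomial.X .eps ^ 2 * MvPolynomial.X .nu ^ 2 - quarticLin * MvPolynomial.X .nu

theorem quarticPoly_eq : quarticPoly = MvPolynomial.X .eps ^ 2 * MvPolynomial.X .nu ^ 2
    + quarticLin * MvPolynomial.X .nu + quarticConst := by
  rw [quarticConst]; ring

theorem nuFree_quarticLin : NuFree quarticLin := fun x y => by
  simp [quarticLin, setNu]

theorem nuFree_quarticConst : NuFree quarticConst := fun x y => by
  simp only [quarticConst, quarticLin, map_sub, map_mul, map_add, map_pow, eval_quarticPoly,
    MvPolynomial.eval_X, setNu, MongeAmpere.quartic, map_ofNat]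
  ring

theorem NuFree.add {p q : MvPolynomial Idx ℂ} (hp : NuFree p) (hq : NuFree q) : NuFree (p + q) :=
  fun x y => by rw [map_add, map_add, hp, hq]

theorem NuFree.sub {p q : MvPolynomial Idx ℂ} (hp : NuFree p) (hq : NuFree q) : NuFree (p - q) :=
  fun x y => by rw [map_sub, map_sub, hp, hq]

theorem NuFree.mul {p q : MvPolynomial Idx ℂ} (hp : NuFree p) (hq : NuFree q) : NuFree (p * q) :=
  fun x y => by rw [map_mul, map_mul, hp, hq]

theorem nuFree_X {i : Idx} (hi : i ≠ .nu) : NuFree (MvPolynomial.X i) := fun x y => by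
  cases i <;> simp_all [setNu]

theorem NuFree.pow {p : MvPolynomial Idx ℂ} (hp : NuFree p) (k : ℕ) : NuFree (p ^ k) :=
  fun x y => by rw [map_pow, map_pow, hp]

/-- Pseudo-division by the quartic with respect to `ν`. -/
theorem exists_pseudo_division (p : MvPolynomial Idx ℂ) :
    ∃ (k : ℕ) (q r₁ r₀ : MvPolynomial Idx ℂ), NuFree r₁ ∧ NuFree r₀ ∧
      MvPolynomial.X .eps ^ k * p = quarticPoly * q + r₁ * MvPolynomial.X .nu + r₀ := by
  have hε : NuFree (MvPolynomial.X .eps) := nuFree_X (by simp)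
  induction p using MvPolynomial.induction_on with
  | C a => exact ⟨0, 0, 0, MvPolynomial.C a, fun x y => by simp, fun x y => by simp, by simp⟩
  | add p p' h h' =>
    obtain ⟨k, q, r₁, r₀, h₁, h₀, h⟩ := h
    obtain ⟨k', q', r₁', r₀', h₁', h₀', h'⟩ := h'
    refine ⟨k + k', MvPolynomial.X .eps ^ k' * q + MvPolynomial.X .eps ^ k * q',
      MvPolynomial.X .eps ^ k' * r₁ + MvPolynomial.X .eps ^ k * r₁',
      MvPolynomial.X .eps ^ k' * r₀ + MvPolynomial.X .eps ^ k * r₀',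
      ?_, ?_, ?_⟩
    · exact NuFree.add (NuFree.mul (hε.pow k') h₁) (NuFree.mul (hε.pow k) h₁')
    · exact NuFree.add (NuFree.mul (hε.pow k') h₀) (NuFree.mul (hε.pow k) h₀')
    linear_combination (MvPolynomial.X .eps ^ k') * h + (MvPolynomial.X .eps ^ k) * h'
  | mul_X p i h =>
    obtain ⟨k, q, r₁, r₀, h₁, h₀, h⟩ := h
    by_cases hi : i = .nu
    · subst hi
      -- One factor `ε²` allows `ε² ν²` to be replaced by `Q` minus its terms of lower degree in
      -- `ν`.
      refine ⟨k + 2, MvPolynomial.X .eps ^ 2 * q * MvPolynomial.X .nu + r₁,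
        MvPolynomial.X .eps ^ 2 * r₀ - r₁ * quarticLin, -(r₁ * quarticConst),
        ?_, ?_, ?_⟩
      · exact NuFree.sub (NuFree.mul (hε.pow 2) h₀) (NuFree.mul h₁ nuFree_quarticLin)
      · intro x y
        rw [map_neg, map_neg, NuFree.mul h₁ nuFree_quarticConst]
      linear_combination (MvPolynomial.X .eps ^ 2 * MvPolynomial.X .nu) * h - r₁ * quarticPoly_eq
    · refine ⟨k, q * MvPolynomial.X i, r₁ * MvPolynomial.X i, r₀ * MvPolynomial.X i, ?_, ?_, ?_⟩
      · exact NuFree.mul h₁ (nuFree_X hi)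
      · exact NuFree.mul h₀ (nuFree_X hi)
      · linear_combination (MvPolynomial.X i) * h

/-- A coefficient vector at which the quartic has two roots in `ν`. -/
def genericPoint : Idx → ℂ
  | .eps => 1
  | .s _ => 1
  | _ => 0

/-- Irreducibility of `Q` is not needed. It suffices that the two roots in `ν` are generically
distinct and that `ε` does not divide `Q`. -/
theorem quarticPoly_dvd {p : MvPolynomial Idx ℂ}
    (hp : ∀ x : Idx → ℂ, x .eps ≠ 0 → MongeAmpere.quartic x = 0 → MvPolynomial.eval x p = 0) :
    quarticPoly ∣ p := by
  obtain ⟨k, q, r₁, r₀, h₁, h₀, h⟩ := exists_pseudo_division p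
  set Δ := quarticLin ^ 2 - 4 * MvPolynomial.X .eps ^ 2 * quarticConst with hΔ
  have hne : Δ * MvPolynomial.X .eps ≠ 0 := by
    intro h0
    have := congrArg (MvPolynomial.eval genericPoint) h0
    simp [hΔ, quarticLin, quarticConst, eval_quarticPoly, genericPoint, MongeAmpere.quartic] at this
  -- Where `ε` and the discriminant `Δ` are nonzero, the remainder, of degree at most one in `ν`,
  -- has two distinct roots.
  have hroots (x : Idx → ℂ) (hx : MvPolynomial.eval x (Δ * MvPolynomial.X .eps) ≠ 0) :
      MvPolynomial.eval x r₁ = 0 ∧ MvPolynomial.eval x r₀ = 0 := by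
    rw [map_mul, MvPolynomial.eval_X, mul_ne_zero_iff] at hx
    obtain ⟨hd, hε⟩ := hx
    obtain ⟨d, hd2⟩ := IsAlgClosed.exists_pow_nat_eq (MvPolynomial.eval x Δ) (n := 2) (by norm_num)
    have hd0 : d ≠ 0 := by
      rintro rfl
      exact hd (by rw [← hd2]; norm_num)
    rw [hΔ] at hd2
    simp only [map_sub, map_mul, map_pow, MvPolynomial.eval_X, map_ofNat] at hd2
    have hval (y : ℂ) (hy : x .eps ^ 2 * y ^ 2 + MvPolynomial.eval x quarticLin * y
        + MvPolynomial.eval x quarticConst = 0) :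
        MvPolynomial.eval x r₁ * y + MvPolynomial.eval x r₀ = 0 := by
      have e1 : MongeAmpere.quartic (setNu x y) = 0 := by
        rw [← eval_quarticPoly, quarticPoly_eq]
        simp only [map_add, map_mul, map_pow, MvPolynomial.eval_X]
        rw [nuFree_quarticLin, nuFree_quarticConst]
        exact hy
      have e2 := congrArg (MvPolynomial.eval (setNu x y)) h
      simp only [map_add, map_mul, map_pow, MvPolynomial.eval_X, h₁ x y, h₀ x y, eval_quarticPoly,
        e1, hp (setNu x y) hε e1] at e2
      simpa [setNu] using e2.symm
    have v1 := hval ((-MvPolynomial.eval x quarticLin + d) / (2 * x .eps ^ 2)) (by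
      field_simp
      linear_combination hd2)
    have v2 := hval ((-MvPolynomial.eval x quarticLin - d) / (2 * x .eps ^ 2)) (by
      field_simp
      linear_combination hd2)
    have v3 : MvPolynomial.eval x r₁ * d = 0 := by
      field_simp at v1 v2
      linear_combination (v1 - v2) / 2
    have v4 : MvPolynomial.eval x r₁ = 0 := by simpa [hd0] using v3
    exact ⟨v4, by simpa [v4] using v1⟩
  have hz {r : MvPolynomial Idx ℂ} (hr : ∀ x, MvPolynomial.eval x (Δ * MvPolynomial.X .eps) ≠ 0 →
      MvPolynomial.eval x r = 0) : r = 0 := by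
    have : r * (Δ * MvPolynomial.X .eps) = 0 := by
      refine MvPolynomial.funext fun x => ?_
      rw [map_mul, map_zero]
      by_cases hx : MvPolynomial.eval x (Δ * MvPolynomial.X .eps) = 0
      · rw [hx, mul_zero]
      · rw [hr x hx, zero_mul]
    exact (mul_eq_zero.1 this).resolve_right hne
  rw [hz fun x hx => (hroots x hx).1, hz fun x hx => (hroots x hx).2, zero_mul, add_zero,
    add_zero] at h
  have hprime : Prime (MvPolynomial.X (R := ℂ) Idx.eps) := MvPolynomial.X_prime
  have hnd : ¬ MvPolynomial.X (R := ℂ) Idx.eps ∣ quarticPoly := by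
    rintro ⟨c, hc⟩
    -- At `h₁ = s₁ = 1` with all other coefficients zero, `ε = 0` and `Q = 1`.
    have := congrArg (MvPolynomial.eval fun i : Idx => match i with
      | .h 0 => 1
      | .s 0 => 1
      | _ => (0 : ℂ)) hc
    simp [eval_quarticPoly, MongeAmpere.quartic] at this
  clear hroots hz h₁ h₀
  induction k generalizing q with
  | zero => exact ⟨q, by simpa using h⟩
  | succ k ih =>
    obtain ⟨q', rfl⟩ := (hprime.dvd_or_dvd (Dvd.intro (MvPolynomial.X .eps ^ k * p) (by
      rw [← h, pow_succ', mul_assoc]) : MvPolynomial.X Idx.eps ∣ quarticPoly * q)).resolve_left hnd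
    refine ih q' (mul_left_cancel₀ hprime.ne_zero ?_)
    linear_combination h

theorem vanishing_iff_quarticPoly_dvd (p : MvPolynomial Idx ℂ) :
    (∀ E : MongeAmpere ℂ, E.IsTangentHyperplane → MvPolynomial.eval E p = 0) ↔ quarticPoly ∣ p := by
  constructor
  · refine fun h => quarticPoly_dvd fun x hx hQ => h x ?_
    exact MongeAmpere.isTangentHyperplane_of_quartic_eq_zero (fun h0 => hx (by rw [h0]; rfl)) hQ
  · rintro ⟨q, rfl⟩ E hE
    rw [map_mul, eval_quarticPoly, hE.quartic_eq_zero, zero_mul]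

/-! ### Degenerate ternary quadratic forms. -/

theorem trace_mul_vecMulVec {K : Type*} [Field K] (S : Matrix (Fin 3) (Fin 3) K) (ξ : Fin 3 → K) :
    (S * vecMulVec ξ ξ).trace = ξ ⬝ᵥ (S *ᵥ ξ) := by
  simp only [trace_fin_three, mul_apply, vecMulVec_apply, dotProduct, mulVec, Fin.sum_univ_three]
  ring

theorem isSymm_vecMulVec {K : Type*} [Field K] (ξ : Fin 3 → K) : (vecMulVec ξ ξ).IsSymm := by
  rw [IsSymm, transpose_vecMulVec]

theorem exists_binary_factorization (α β γ : ℂ) :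
    ∃ p q r w : ℂ, ∀ x y, α * x ^ 2 + 2 * β * x * y + γ * y ^ 2 = (p * x + q * y) * (r * x + w *
        y) := by
  by_cases hα : α = 0
  · exact ⟨0, 1, 2 * β, γ, fun x y => by rw [hα]; ring⟩
  · obtain ⟨d, hd⟩ := IsAlgClosed.exists_pow_nat_eq (β ^ 2 - α * γ) (n := 2) (by norm_num)
    refine ⟨α, β + d, 1, (β - d) / α, fun x y => ?_⟩
    field_simp
    linear_combination y ^ 2 * hd

/-- A degenerate ternary quadratic form splits into linear factors. -/
theorem exists_ternary_factorization {S : Matrix (Fin 3) (Fin 3) ℂ} (hS : S.IsSymm)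
    (hdet : S.det = 0) : ∃ a b : Fin 3 → ℂ, ∀ ξ, ξ ⬝ᵥ (S *ᵥ ξ) = (a ⬝ᵥ ξ) * (b ⬝ᵥ ξ) := by
  have h1 : S 1 0 = S 0 1 := hS.apply 0 1
  have h2 : S 2 0 = S 0 2 := hS.apply 0 2
  have h3 : S 2 1 = S 1 2 := hS.apply 1 2
  obtain ⟨v, hv, hSv⟩ := exists_mulVec_eq_zero_iff.2 hdet
  obtain ⟨i, hi⟩ := Function.ne_iff.1 hv
  rw [Pi.zero_apply] at hi
  obtain ⟨w, hw, hwi⟩ : ∃ w, S *ᵥ w = 0 ∧ w i = 1 :=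
    ⟨(v i)⁻¹ • v, by rw [mulVec_smul, hSv, smul_zero], by simp [hi]⟩
  have e0 := congrFun hw 0
  have e1 := congrFun hw 1
  have e2 := congrFun hw 2
  simp only [mulVec, dotProduct, Fin.sum_univ_three, Pi.zero_apply, h1, h2, h3] at e0 e1 e2
  -- Since `S w = 0` and `w i = 1`, the form takes the same value at `ξ` and at `ξ - ξᵢ w`, whose
  -- `i`-th entry is zero. Only a binary form remains to be factored.
  have key : ∃ p q r : ℂ, ∃ w' : ℂ, ∀ x y, S (i + 1) (i + 1) * x ^ 2 + 2 * S (i + 1) (i + 2) * x * y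
      + S (i + 2) (i + 2) * y ^ 2 = (p * x + q * y) * (r * x + w' * y) :=
    exists_binary_factorization _ _ _
  obtain ⟨p, q, r, t, h⟩ := key
  fin_cases i
  · simp only [Fin.zero_eta, zero_add, Fin.isValue] at h hwi
    refine ⟨![-(p * w 1 + q * w 2), p, q], ![-(r * w 1 + t * w 2), r, t], fun ξ => ?_⟩
    have := h (ξ 1 - ξ 0 * w 1) (ξ 2 - ξ 0 * w 2)
    simp [dotProduct, mulVec, Fin.sum_univ_three, h1, h2, h3]
    rw [hwi] at e0 e1 e2
    linear_combination this + ξ 0 ^ 2 * e0 + (2 * ξ 0 * ξ 1 - ξ 0 ^ 2 * w 1) * e1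
      + (2 * ξ 0 * ξ 2 - ξ 0 ^ 2 * w 2) * e2
  · have f1 : (1 + 1 : Fin 3) = 2 := rfl
    have f2 : (1 + 2 : Fin 3) = 0 := rfl
    simp only [Fin.mk_one, Fin.isValue, f1, f2, h2] at h hwi
    refine ⟨![q, -(p * w 2 + q * w 0), p], ![t, -(r * w 2 + t * w 0), r], fun ξ => ?_⟩
    have := h (ξ 2 - ξ 1 * w 2) (ξ 0 - ξ 1 * w 0)
    simp [dotProduct, mulVec, Fin.sum_univ_three, h1, h2, h3]
    rw [hwi] at e0 e1 e2
    linear_combination this + ξ 1 ^ 2 * e1 + (2 * ξ 1 * ξ 2 - ξ 1 ^ 2 * w 2) * e2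
      + (2 * ξ 1 * ξ 0 - ξ 1 ^ 2 * w 0) * e0
  · have f1 : (2 + 1 : Fin 3) = 0 := rfl
    have f2 : (2 + 2 : Fin 3) = 1 := rfl
    simp only [Fin.reduceFinMk, Fin.isValue, f1, f2] at h hwi
    refine ⟨![p, q, -(p * w 0 + q * w 1)], ![r, t, -(r * w 0 + t * w 1)], fun ξ => ?_⟩
    have := h (ξ 0 - ξ 2 * w 0) (ξ 1 - ξ 2 * w 1)
    simp [dotProduct, mulVec, Fin.sum_univ_three, h1, h2, h3]
    rw [hwi] at e0 e1 e2
    linear_combination this + ξ 2 ^ 2 * e2 + (2 * ξ 2 * ξ 0 - ξ 2 ^ 2 * w 0) * e0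
      + (2 * ξ 2 * ξ 1 - ξ 2 ^ 2 * w 1) * e1

/-- The entries of the matrix of a product of two linear forms. -/
theorem entry_of_factorization {S : Matrix (Fin 3) (Fin 3) ℂ} (hS : S.IsSymm) {a b : Fin 3 → ℂ}
    (h : ∀ ξ, ξ ⬝ᵥ (S *ᵥ ξ) = (a ⬝ᵥ ξ) * (b ⬝ᵥ ξ)) (i j : Fin 3) :
    S i j = (a i * b j + a j * b i) / 2 := by
  have hi := h (Pi.single i 1)
  have hj := h (Pi.single j 1)
  have hij := h (Pi.single i 1 + Pi.single j 1)
  have hs : S j i = S i j := hS.apply i j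
  simp [mulVec_add, hs] at hi hj hij
  linear_combination (hij - hi - hj) / 2

/-! ### The symbol and the standard form at a point. -/

namespace MongeAmpere

/-- The adjugate and the determinant of a rank-one matrix vanish, so an equation is affine along
every line of rank-one direction. -/
theorem eval_add_smul_vecMulVec (E : MongeAmpere ℂ) {U : Matrix (Fin 3) (Fin 3) ℂ} (hU : U.IsSymm)
    (ξ : Fin 3 → ℂ) (t : ℂ) : E.eval (U + t • vecMulVec ξ ξ) =
      E.eval U + t * (ξ ⬝ᵥ (symS (E.translate U) *ᵥ ξ)) := by
  rw [add_comm U, ← eval_translate E hU ((isSymm_vecMulVec ξ).smul t),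
    eval_smul_eq _ (isSymm_vecMulVec ξ), trace_mul_vecMulVec]
  have h1 : (vecMulVec ξ ξ).adjugate = 0 := by
    ext i j
    fin_cases i <;> fin_cases j <;> simp [adjugate_fin_three, vecMulVec_apply] <;> ring
  have h2 : (vecMulVec ξ ξ).det = 0 := by
    simp only [det_fin_three, vecMulVec_apply]; ring
  rw [h1, h2]
  simp [translate]

theorem symbol_eq (E : MongeAmpere ℂ) {U : Matrix (Fin 3) (Fin 3) ℂ} (hU : U.IsSymm) (ξ : Fin 3 →
    ℂ) :
    E.symbol U ξ = ξ ⬝ᵥ (symS (E.translate U) *ᵥ ξ) := by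
  simp only [symbol, eval_add_smul_vecMulVec E hU]
  simp

theorem irreducibleConic_iff (E : MongeAmpere ℂ) {U : Matrix (Fin 3) (Fin 3) ℂ} (hU : U.IsSymm) :
    E.IrreducibleConic U ↔ (symS (E.translate U)).det ≠ 0 := by
  simp only [IrreducibleConic, symbol_eq E hU]
  refine not_congr ⟨fun ⟨a, b, h⟩ => ?_, exists_ternary_factorization (symS_isSymm _)⟩
  have e := entry_of_factorization (symS_isSymm _) h
  rw [det_fin_three]
  simp only [e]
  ring

/-- Standard form of an equation at a point where the symbol is nondegenerate. -/
theorem exists_standard_form (E : MongeAmpere ℂ) {U : Matrix (Fin 3) (Fin 3) ℂ} (hU : U.IsSymm)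
    (h0 : E.eval U = 0) (hS : (symS (E.translate U)).det ≠ 0) :
    ∃ (C : Matrix (Fin 3) (Fin 3) ℂ) (ε : ℂ), C.IsSymm ∧
      E.quartic = 4 * ε * (symS (E.translate U)).det ∧
      ∀ V : Matrix (Fin 3) (Fin 3) ℂ, V.IsSymm → E.eval (U + V) =
        (symS (E.translate U) * (V * (1 + C * V).adjugate)).trace + ε * V.det := by
  have hν : E.translate U .nu = 0 := h0
  rw [← quartic_translate E hU]
  suffices h : ∃ C : Matrix (Fin 3) (Fin 3) ℂ, C.IsSymm ∧
      (∀ i, ((E.translate U).lower (-C)) (.h i) = 0) ∧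
      ∀ i, ((E.translate U).lower (-C)) (.g i) = 0 by
    obtain ⟨C, hC, hh, hg⟩ := h
    have hH : symH ((E.translate U).lower (-C)) = 0 := by
      ext i j
      fin_cases i <;> fin_cases j <;> simp [symH, hh, hg]
    have hS' : symS ((E.translate U).lower (-C)) = symS (E.translate U) := by
      generalize E.translate U = E' at *
      ext i j
      fin_cases i <;> fin_cases j <;> simp [symS, lower, flip, translate, hν]
    have hν' : ((E.translate U).lower (-C)) .nu = 0 := by
      generalize E.translate U = E' at *
      simpa [lower, flip, translate] using hν
    refine ⟨C, ((E.translate U).lower (-C)) .eps, hC, ?_, fun V hV => ?_⟩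
    · rw [← quartic_lower _ hC.neg, ← hS']
      simp only [quartic, symS, hh, hg, hν', det_fin_three, of_apply, cons_val', cons_val_zero,
        cons_val_one, cons_val, cons_val_fin_one]
      ring
    · rw [add_comm U, ← eval_translate E hU hV, ← hom_one _ hV]
      have := hom_lower (E.translate U) hC.neg V (1 + C * V)
      rw [show 1 + C * V + -C * V = 1 by noncomm_ring] at this
      rw [← this, hom, hH, hS', hν']
      simp
      ring
  generalize E.translate U = E' at *
  set D := (symS E').det with hD
  -- The quadratic terms vanish after `lower (-C)` exactly when `adj (S + C) - adj S - adj C = H`.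
  -- This is linear in `C`, and its solution is `M / det S`.
  set M := ((symS E').adjugate + symH E').adjugate - (symS E').adjugate.adjugate
    - (symH E').adjugate - ((symS E' * symH E').trace / 2) • symS E' with hM
  have hMs : M.IsSymm := by
    have a1 : (symS E').adjugate.IsSymm := by rw [IsSymm, adjugate_transpose, (symS_isSymm E').eq]
    have a2 : (symH E').adjugate.IsSymm := by rw [IsSymm, adjugate_transpose, (symH_isSymm E').eq]
    have a3 (A : Matrix (Fin 3) (Fin 3) ℂ) (hA : A.IsSymm) : A.adjugate.IsSymm := by
      rw [IsSymm, adjugate_transpose, hA.eq]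
    exact (((a3 _ (a1.add (symH_isSymm E'))).sub (a3 _ a1)).sub a2).sub ((symS_isSymm E').smul _)
  refine ⟨D⁻¹ • M, hMs.smul _, ?_⟩
  have hDM (i j : Fin 3) : D * ((D⁻¹ • M) i j) = M i j := by
    rw [Matrix.smul_apply, smul_eq_mul, mul_inv_cancel_left₀ hS]
  generalize D⁻¹ • M = C at *
  rw [det_fin_three] at hD
  simp only [symS, of_apply, cons_val', cons_val_zero, cons_val_one, cons_val,
    cons_val_fin_one] at hD
  have h00 := hDM 0 0
  have h01 := hDM 0 1
  have h02 := hDM 0 2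
  have h11 := hDM 1 1
  have h12 := hDM 1 2
  have h22 := hDM 2 2
  simp only [hM, symS, symH, adjugate_fin_three, trace_fin_three, mul_apply, Fin.sum_univ_three,
    Matrix.sub_apply, Matrix.add_apply, Matrix.smul_apply, smul_eq_mul,
    of_apply, cons_val', cons_val_zero, cons_val_one, cons_val, cons_val_fin_one]
      at h00 h01 h02 h11 h12 h22
  constructor
  · intro i
    refine (mul_eq_zero.1 (?_ : D * _ = 0)).resolve_left hS
    fin_cases i
    · simp only [lower, flip, translate, hν, Matrix.neg_apply]
      linear_combination E' (.h 0) * hD - E' (.s 1) * h22 - E' (.s 2) * h11 + E' (.tau 0) * h12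
    · simp only [lower, flip, translate, hν, Matrix.neg_apply]
      linear_combination E' (.h 1) * hD - E' (.s 0) * h22 - E' (.s 2) * h00 + E' (.tau 1) * h02
    · simp only [lower, flip, translate, hν, Matrix.neg_apply]
      linear_combination E' (.h 2) * hD - E' (.s 0) * h11 - E' (.s 1) * h00 + E' (.tau 2) * h01
  · intro i
    refine (mul_eq_zero.1 (?_ : D * _ = 0)).resolve_left hS
    fin_cases i
    · simp only [lower, flip, translate, hν, Matrix.neg_apply]
      linear_combination E' (.g 0) * hD - E' (.tau 0) * h00 + E' (.tau 1) * h01 + E' (.tau 2) * h02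
        - 2 * E' (.s 0) * h12
    · simp only [lower, flip, translate, hν, Matrix.neg_apply]
      linear_combination E' (.g 1) * hD - E' (.tau 1) * h11 + E' (.tau 0) * h01 + E' (.tau 2) * h12
        - 2 * E' (.s 1) * h02
    · simp only [lower, flip, translate, hν, Matrix.neg_apply]
      linear_combination E' (.g 2) * hD - E' (.tau 2) * h22 + E' (.tau 0) * h02 + E' (.tau 1) * h12
        - 2 * E' (.s 2) * h01

end MongeAmpere

theorem coeff_eq_zero_of_cubic {a b c d : ℂ} (h : ∀ t : ℂ, a + t * b + t ^ 2 * c + t ^ 3 * d = 0) :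
    b = 0 ∧ c = 0 := by
  have h0 := h 0
  have h1 := h 1
  have h2 := h (-1)
  have h3 := h 2
  exact ⟨by linear_combination -h0 / 2 + h1 - h2 / 3 - h3 / 6,
    by linear_combination h1 / 2 + h2 / 2 - h0⟩

/-- The left side is the first-order change of the determinant of a reducible symbol `S` under a
rank-one translation by `ξ ξᵀ`, where `ξ = b × y` is orthogonal to `b`. -/
theorem trace_gram {a b ξ : Fin 3 → ℂ} {S H : Matrix (Fin 3) (Fin 3) ℂ} (hS : ∀ i j, S i j = (a i *
    b j + a j * b i) / 2)
    (hH : H.IsSymm) (y : Fin 3 → ℂ) (hξ : ξ = ![b 1 * y 2 - b 2 * y 1, b 2 * y 0 - b 0 * y 2, b 0 *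
        y 1 - b 1 * y 0]) :
    (S.adjugate * ((H + vecMulVec ξ ξ).adjugate - H.adjugate - (vecMulVec ξ ξ).adjugate)).trace =
      -(a ⬝ᵥ ξ) ^ 2 * (b ⬝ᵥ (H *ᵥ b)) / 4 := by
  have h1 : H 1 0 = H 0 1 := hH.apply 0 1
  have h2 : H 2 0 = H 0 2 := hH.apply 0 2
  have h3 : H 2 1 = H 1 2 := hH.apply 1 2
  subst hξ
  simp only [adjugate_fin_three, trace_fin_three, mul_apply, Fin.sum_univ_three, Matrix.sub_apply,
    Matrix.add_apply, vecMulVec_apply, of_apply, cons_val', cons_val_zero, cons_val_one, cons_val,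
    cons_val_fin_one, dotProduct, mulVec, hS, h1, h2, h3]
  ring

theorem adjugate_of_factorization {S : Matrix (Fin 3) (Fin 3) ℂ} {a b : Fin 3 → ℂ}
    (hS : ∀ i j, S i j = (a i * b j + a j * b i) / 2) :
    S.adjugate = (-1 / 4 : ℂ) • vecMulVec
      ![a 1 * b 2 - a 2 * b 1, a 2 * b 0 - a 0 * b 2, a 0 * b 1 - a 1 * b 0]
      ![a 1 * b 2 - a 2 * b 1, a 2 * b 0 - a 0 * b 2, a 0 * b 1 - a 1 * b 0] := by
  ext i j
  fin_cases i <;> fin_cases j <;>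
  · simp [adjugate_fin_three, hS]
    ring

/-- For a symbol of rank one the determinant has no first-order change, so its adjugate is compared
at the parameters `1` and `-1` instead. -/
theorem quadratic_gram {a ξ : Fin 3 → ℂ} {κ : ℂ} {S H : Matrix (Fin 3) (Fin 3) ℂ}
    (hS : ∀ i j, S i j = κ * (a i * a j)) (hH : H.IsSymm) (x y : Fin 3 → ℂ)
    (hξ : ξ = ![a 1 * y 2 - a 2 * y 1, a 2 * y 0 - a 0 * y 2, a 0 * y 1 - a 1 * y 0]) :
    x ⬝ᵥ ((S + (1 : ℂ) • ((H + vecMulVec ξ ξ).adjugate - H.adjugate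
      - (vecMulVec ξ ξ).adjugate)).adjugate *ᵥ x) -
    x ⬝ᵥ ((S + (-1 : ℂ) • ((H + vecMulVec ξ ξ).adjugate - H.adjugate
      - (vecMulVec ξ ξ).adjugate)).adjugate *ᵥ x) =
      2 * κ * (a ⬝ᵥ (H *ᵥ a)) * (x ⬝ᵥ ξ) ^ 2 := by
  have h1 : H 1 0 = H 0 1 := hH.apply 0 1
  have h2 : H 2 0 = H 0 2 := hH.apply 0 2
  have h3 : H 2 1 = H 1 2 := hH.apply 1 2
  subst hξ
  simp only [adjugate_fin_three, Fin.sum_univ_three, Matrix.sub_apply, Matrix.smul_apply,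
      smul_eq_mul,
    Matrix.add_apply, vecMulVec_apply, of_apply, cons_val', cons_val_zero, cons_val_one, cons_val,
    cons_val_fin_one, dotProduct, mulVec, hS, h1, h2, h3]
  ring

/-! ### Existence of points with irreducible conic, and characteristic directions there. -/

namespace MongeAmpere

theorem translate_translate (E : MongeAmpere ℂ) {T T' : Matrix (Fin 3) (Fin 3) ℂ} (hT : T.IsSymm)
    (hT' : T'.IsSymm) : (E.translate T).translate T' = E.translate (T + T') := by
  rw [← sub_eq_zero]
  refine eq_zero_of_eval_eq_zero _ fun U hU => ?_
  rw [eval_sub, eval_translate _ hT' hU, eval_translate _ hT (hU.add hT'),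
    eval_translate _ (hT.add hT') hU, add_assoc, add_comm T', sub_self]

/-- The symbol after a translation of rank one. -/
theorem symS_translate_smul (E : MongeAmpere ℂ) (ξ : Fin 3 → ℂ) (t : ℂ) :
    symS (E.translate (t • vecMulVec ξ ξ)) = symS E + t • ((symH E + vecMulVec ξ ξ).adjugate
      - (symH E).adjugate - (vecMulVec ξ ξ).adjugate) := by
  ext i j
  fin_cases i <;> fin_cases j <;>
  · simp [symS, symH, translate, adjugate_fin_three, vecMulVec_apply]
    ring

/-- A nowhere vanishing equation is constant on every line of rank-one direction, since it is affine
there. So its symbol vanishes everywhere, and with it all coefficients except `ν`. -/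
theorem exists_eval_eq_zero {E : MongeAmpere ℂ} (hQ : E.quartic ≠ 0) :
    ∃ U : Matrix (Fin 3) (Fin 3) ℂ, U.IsSymm ∧ E.eval U = 0 := by
  by_contra! hne
  have hS (U : Matrix (Fin 3) (Fin 3) ℂ) (hU : U.IsSymm) : symS (E.translate U) = 0 := by
    have h0 (ξ : Fin 3 → ℂ) : ξ ⬝ᵥ (symS (E.translate U) *ᵥ ξ) = 0 := by
      by_contra h
      refine hne (U + (-(E.eval U) / (ξ ⬝ᵥ (symS (E.translate U) *ᵥ ξ))) • vecMulVec ξ ξ)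
        (hU.add ((isSymm_vecMulVec ξ).smul _)) ?_
      rw [eval_add_smul_vecMulVec E hU, div_mul_cancel₀ _ h]
      ring
    ext i j
    rw [entry_of_factorization (symS_isSymm _) (a := 0) (b := 0) (by simpa using h0)]
    simp
  have e (U : Matrix (Fin 3) (Fin 3) ℂ) (hU : U.IsSymm) (i j : Fin 3) :
      symS (E.translate U) i j = 0 := by rw [hS U hU]; rfl
  have z := e 0 isSymm_zero
  have z00 := z 0 0
  have z11 := z 1 1
  have z22 := z 2 2
  have z01 := z 0 1
  have z02 := z 0 2
  have z12 := z 1 2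
  have x := e 1 isSymm_one
  have x00 := x 0 0
  have hs (i : Fin 3) : E (.s i) = 0 := by
    fin_cases i
    · simpa [symS, translate] using z00
    · simpa [symS, translate] using z11
    · simpa [symS, translate] using z22
  have ht (i : Fin 3) : E (.tau i) = 0 := by
    fin_cases i
    · simpa [symS, translate] using z12
    · simpa [symS, translate] using z02
    · simpa [symS, translate] using z01
  have d (i : Fin 3) := e (vecMulVec (Pi.single i 1) (Pi.single i 1)) (isSymm_vecMulVec _)
  have d0 := d 0 1 1
  have d0' := d 0 2 2
  have d1 := d 1 2 2
  simp [symS, translate, vecMulVec_apply, hs] at d0 d0' d1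
  have d00 := d 0 1 2
  have d11 := d 1 0 2
  have d22 := d 2 0 1
  simp [symS, translate, vecMulVec_apply, ht] at d00 d11 d22
  simp [symS, translate, hs, d0, d0', d1, d00, d11, d22] at x00
  exact hQ (by simp [quartic, hs, ht, x00, d0, d0', d1, d00, d11, d22])

/-- At a point with reducible conic, a nonzero quartic thus forces both linear factors to be
non-isotropic for `H`. -/
theorem quartic_eq_of_factorization {E : MongeAmpere ℂ} (hν : E .nu = 0) {a b : Fin 3 → ℂ}
    (hS : ∀ i j, symS E i j = (a i * b j + a j * b i) / 2) :
    E.quartic = (a ⬝ᵥ (symH E *ᵥ a)) * (b ⬝ᵥ (symH E *ᵥ b)) := by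
  have e0 := hS 0 0
  have e1 := hS 1 1
  have e2 := hS 2 2
  have e01 := hS 0 1
  have e02 := hS 0 2
  have e12 := hS 1 2
  simp only [symS, of_apply, cons_val', cons_val_zero, cons_val_one, cons_val,
    cons_val_fin_one] at e0 e1 e2 e01 e02 e12
  have f0 : E (.s 0) = a 0 * b 0 := by rw [e0]; ring
  have f1 : E (.s 1) = a 1 * b 1 := by rw [e1]; ring
  have f2 : E (.s 2) = a 2 * b 2 := by rw [e2]; ring
  have f01 : E (.tau 2) = a 0 * b 1 + a 1 * b 0 := by linear_combination 2 * e01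
  have f02 : E (.tau 1) = a 0 * b 2 + a 2 * b 0 := by linear_combination 2 * e02
  have f12 : E (.tau 0) = a 1 * b 2 + a 2 * b 1 := by linear_combination 2 * e12
  simp only [quartic, hν, f0, f1, f2, f01, f02, f12, symH, dotProduct, mulVec, Fin.sum_univ_three,
    of_apply, cons_val', cons_val_zero, cons_val_one, cons_val, cons_val_fin_one]
  ring

/-- The points of a nondegenerate equation with an irreducible dispersion relation. -/
theorem exists_det_symS_ne_zero {E : MongeAmpere ℂ} (hQ : E.quartic ≠ 0) :
    ∃ U : Matrix (Fin 3) (Fin 3) ℂ, U.IsSymm ∧ E.eval U = 0 ∧ (symS (E.translate U)).det ≠ 0 := by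
  by_contra! hdet
  have key (U : Matrix (Fin 3) (Fin 3) ℂ) (hU : U.IsSymm) (h0 : E.eval U = 0) :
      ∃ a b : Fin 3 → ℂ, (∀ i j, symS (E.translate U) i j = (a i * b j + a j * b i) / 2) ∧
        a ⬝ᵥ (symH (E.translate U) *ᵥ a) ≠ 0 ∧ (∀ ξ, ξ ⬝ᵥ (symS (E.translate U) *ᵥ ξ) = (a ⬝ᵥ ξ) *
            (b ⬝ᵥ ξ)) ∧
        b ⬝ᵥ (symH (E.translate U) *ᵥ b) ≠ 0 ∧
        a 1 * b 2 - a 2 * b 1 = 0 ∧ a 2 * b 0 - a 0 * b 2 = 0 ∧ a 0 * b 1 - a 1 * b 0 = 0 := by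
    obtain ⟨a, b, hab⟩ := exists_ternary_factorization (symS_isSymm _) (hdet U hU h0)
    have hS := entry_of_factorization (symS_isSymm _) hab
    have hq : (E.translate U).quartic ≠ 0 := by rwa [quartic_translate E hU]
    rw [quartic_eq_of_factorization h0 hS, mul_ne_zero_iff] at hq
    -- Moving by `t ξ ξᵀ` with `ξ ⊥ b` stays on the equation, where the determinant of the symbol
    -- vanishes for all `t`. Its linear coefficient, computed in `trace_gram`, gives `a ⊥ ξ`; as `ξ`
    -- runs over `b × y`, this makes `a` and `b` parallel.
    have hperp (y : Fin 3 → ℂ) : a ⬝ᵥ ![b 1 * y 2 - b 2 * y 1, b 2 * y 0 - b 0 * y 2, b 0 * y 1 - b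
        1 * y 0] = 0 := by
      obtain ⟨ξ, hξ⟩ : ∃ ξ, ξ = ![b 1 * y 2 - b 2 * y 1, b 2 * y 0 - b 0 * y 2, b 0 * y 1 - b 1 * y
          0] :=
        ⟨_, rfl⟩
      have hbξ : b ⬝ᵥ ξ = 0 := by
        rw [hξ]; simp [dotProduct, Fin.sum_univ_three]; ring
      rw [← hξ]
      have h1 (t : ℂ) := hdet (U + t • vecMulVec ξ ξ) (hU.add ((isSymm_vecMulVec ξ).smul t))
        (by rw [eval_add_smul_vecMulVec E hU, h0, hab, hbξ]; ring)
      simp only [← translate_translate E hU ((isSymm_vecMulVec ξ).smul _), symS_translate_smul,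
        det_add_smul_fin_three] at h1
      have h2 := (coeff_eq_zero_of_cubic h1).1
      rw [trace_gram hS (symH_isSymm _) y hξ] at h2
      simpa [hq.2] using h2
    refine ⟨a, b, hS, hq.1, hab, hq.2, ?_, ?_, ?_⟩
    · have := hperp (Pi.single 0 1)
      simp [dotProduct, Fin.sum_univ_three] at this
      linear_combination this
    · have := hperp (Pi.single 1 1)
      simp [dotProduct, Fin.sum_univ_three] at this
      linear_combination this
    · have := hperp (Pi.single 2 1)
      simp [dotProduct, Fin.sum_univ_three] at this
      linear_combination this
  obtain ⟨U, hU, h0⟩ := exists_eval_eq_zero hQ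
  obtain ⟨a, b, hS, ha, hab, hb, c0, c1, c2⟩ := key U hU h0
  -- At every point of the equation the two factors are now parallel, so the adjugate of the symbol
  -- is zero.
  have hrank (t : ℂ) (y ξ : Fin 3 → ℂ)
      (hξ : ξ = ![a 1 * y 2 - a 2 * y 1, a 2 * y 0 - a 0 * y 2, a 0 * y 1 - a 1 * y 0]) :
      (symS (E.translate U) + t • ((symH (E.translate U) + vecMulVec ξ ξ).adjugate
      - (symH (E.translate U)).adjugate - (vecMulVec ξ ξ).adjugate)).adjugate = 0 := by
    have haξ : a ⬝ᵥ ξ = 0 := by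
      rw [hξ]; simp [dotProduct, Fin.sum_univ_three]; ring
    obtain ⟨a', b', hS', -, -, -, d0, d1, d2⟩ := key (U + t • vecMulVec ξ ξ)
      (hU.add ((isSymm_vecMulVec ξ).smul _))
      (by rw [eval_add_smul_vecMulVec E hU, h0, hab, haξ]; ring)
    rw [← translate_translate E hU ((isSymm_vecMulVec ξ).smul _), symS_translate_smul] at hS'
    rw [adjugate_of_factorization hS', d0, d1, d2]
    ext i j
    fin_cases i <;> fin_cases j <;> simp
  have hane : a ≠ 0 := by
    rintro rfl
    simp at ha
  obtain ⟨κ, rfl⟩ : ∃ κ : ℂ, b = κ • a := by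
    obtain ⟨i, hi⟩ := Function.ne_iff.1 hane
    rw [Pi.zero_apply] at hi
    refine ⟨b i / a i, ?_⟩
    ext j
    fin_cases i <;> fin_cases j <;>
    · simp only [Fin.zero_eta, Fin.mk_one, Fin.reduceFinMk, Pi.smul_apply, smul_eq_mul] at hi ⊢
      field_simp
      first
        | done
        | linear_combination c0
        | linear_combination c1
        | linear_combination c2
        | linear_combination -c0
        | linear_combination -c1
        | linear_combination -c2
  have hκ : κ ≠ 0 := by
    rintro rfl
    simp at hb
  -- By `quadratic_gram` the vanishing adjugates force `x ⊥ a × y` for all `x, y`, which contradicts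
  -- `a ≠ 0`.
  have hcross (y x : Fin 3 → ℂ) :
      x ⬝ᵥ ![a 1 * y 2 - a 2 * y 1, a 2 * y 0 - a 0 * y 2, a 0 * y 1 - a 1 * y 0] = 0 := by
    obtain ⟨ξ, hξ⟩ : ∃ ξ, ξ = ![a 1 * y 2 - a 2 * y 1, a 2 * y 0 - a 0 * y 2, a 0 * y 1 - a 1 * y
        0] :=
      ⟨_, rfl⟩
    have h1 := quadratic_gram (S := symS (E.translate U)) (κ := κ)
        (fun i j => by rw [hS]; simp; ring)
      (symH_isSymm (E.translate U)) x y hξ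
    rw [hrank 1 y ξ hξ, hrank (-1) y ξ hξ] at h1
    rw [← hξ]
    simpa [hκ, ha] using h1.symm
  refine hane (funext fun i => ?_)
  fin_cases i
  · simpa using hcross (Pi.single 1 1) (Pi.single 2 1)
  · simpa using hcross (Pi.single 2 1) (Pi.single 0 1)
  · simpa using hcross (Pi.single 0 1) (Pi.single 1 1)

/-- Three distinct points of a nondegenerate conic outside the line at infinity. -/
theorem exists_points_of_conic {S : Matrix (Fin 3) (Fin 3) ℂ} (hS : S.IsSymm) (hdet : S.det ≠ 0) :
    ∃ μ lam : Fin 3 → ℂ, (∀ i j, i ≠ j → (μ i, lam i) ≠ (μ j, lam j)) ∧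
      ∀ i, speedVec (μ i) (lam i) ⬝ᵥ (S *ᵥ speedVec (μ i) (lam i)) = 0 := by
  have h1 : S 1 0 = S 0 1 := hS.apply 0 1
  have h2 : S 2 0 = S 0 2 := hS.apply 0 2
  have h3 : S 2 1 = S 1 2 := hS.apply 1 2
  have hval (μ l : ℂ) : speedVec μ l ⬝ᵥ (S *ᵥ speedVec μ l) =
      S 1 1 * μ ^ 2 + 2 * (S 1 2 * l + S 0 1) * μ + (S 2 2 * l ^ 2 + 2 * S 0 2 * l + S 0 0) := by
    simp [speedVec, dotProduct, mulVec, Fin.sum_univ_three, h1, h2, h3]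
    ring
  have hsol (l : ℂ) (hl : S 1 1 ≠ 0 ∨ S 1 2 * l + S 0 1 ≠ 0) :
      ∃ μ, speedVec μ l ⬝ᵥ (S *ᵥ speedVec μ l) = 0 := by
    by_cases h11 : S 1 1 = 0
    · have hl' := hl.resolve_left (not_not.2 h11)
      refine ⟨-(S 2 2 * l ^ 2 + 2 * S 0 2 * l + S 0 0) / (2 * (S 1 2 * l + S 0 1)), ?_⟩
      rw [hval, h11]
      generalize S 1 2 * l + S 0 1 = q at *
      field_simp
      ring
    · obtain ⟨d, hd⟩ := IsAlgClosed.exists_pow_nat_eq ((S 1 2 * l + S 0 1) ^ 2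
        - S 1 1 * (S 2 2 * l ^ 2 + 2 * S 0 2 * l + S 0 0)) (n := 2) (by norm_num)
      refine ⟨(-(S 1 2 * l + S 0 1) + d) / S 1 1, ?_⟩
      rw [hval]
      field_simp
      linear_combination hd
  -- The values `c + 1, c + 2, c + 3` of `λ` keep the equation for `μ` nontrivial. When `S 1 1 = 0`,
  -- its linear coefficient must not vanish.
  obtain ⟨c, hc⟩ : ∃ c : ℂ, ∀ k : Fin 3, S 1 1 ≠ 0 ∨ S 1 2 * (c + (k : ℕ) + 1) + S 0 1 ≠ 0 := by
    by_cases h12 : S 1 2 = 0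
    · refine ⟨0, fun k => ?_⟩
      by_contra! h
      rw [h12, zero_mul, zero_add] at h
      exact hdet (by rw [det_fin_three, h1, h2, h3, h.1, h.2, h12]; ring)
    · refine ⟨-S 0 1 / S 1 2, fun k => Or.inr ?_⟩
      have e : S 1 2 * (-S 0 1 / S 1 2 + (k : ℕ) + 1) + S 0 1 = S 1 2 * (((k : ℕ) + 1 : ℕ) :
          ℂ) := by
        push_cast
        field_simp
        ring
      rw [e]
      exact mul_ne_zero h12 (Nat.cast_ne_zero.2 (Nat.succ_ne_zero _))
  choose μ hμ using fun k => hsol _ (hc k)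
  refine ⟨μ, _, fun i j hij h => hij ?_, hμ⟩
  have h := (Prod.ext_iff.1 h).2
  simpa [Fin.ext_iff] using h

/-- Distinct points of a nondegenerate conic are neither conjugate nor collinear. -/
theorem det_ne_zero_of_conic {S : Matrix (Fin 3) (Fin 3) ℂ} (hS : S.IsSymm) (hdet : S.det ≠ 0)
    {μ lam : Fin 3 → ℂ} (hne : ∀ i j, i ≠ j → (μ i, lam i) ≠ (μ j, lam j))
    (h0 : ∀ i, speedVec (μ i) (lam i) ⬝ᵥ (S *ᵥ speedVec (μ i) (lam i)) = 0) :
    (∀ i j, i ≠ j → speedVec (μ i) (lam i) ⬝ᵥ (S *ᵥ speedVec (μ j) (lam j)) ≠ 0) ∧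
      (Matrix.of fun i => speedVec (μ i) (lam i)).det ≠ 0 := by
  have h1 : S 1 0 = S 0 1 := hS.apply 0 1
  have h2 : S 2 0 = S 0 2 := hS.apply 0 2
  have h3 : S 2 1 = S 1 2 := hS.apply 1 2
  -- This is the Gram determinant of `x, y, z` for the form `S`, with `x` and `y` isotropic.
  have gram (x y z : Fin 3 → ℂ) (hx : x ⬝ᵥ (S *ᵥ x) = 0) (hy : y ⬝ᵥ (S *ᵥ y) = 0) :
      (Matrix.of ![x, y, z]).det ^ 2 * S.det = 2 * (x ⬝ᵥ (S *ᵥ y)) * (x ⬝ᵥ (S *ᵥ z)) * (y ⬝ᵥ (S *ᵥ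
          z))
        - (x ⬝ᵥ (S *ᵥ y)) ^ 2 * (z ⬝ᵥ (S *ᵥ z)) := by
    have e : (Matrix.of ![x, y, z]).det ^ 2 * S.det = (Matrix.of ![x, y, z] * S * (Matrix.of ![x,
        y, z])ᵀ).det := by
      rw [det_mul, det_mul, det_transpose]; ring
    have sym (u v : Fin 3 → ℂ) : u ⬝ᵥ (S *ᵥ v) = v ⬝ᵥ (S *ᵥ u) := by
      simp only [dotProduct, mulVec, Fin.sum_univ_three, h1, h2, h3]; ring
    have ent (i j : Fin 3) : (Matrix.of ![x, y, z] * S * (Matrix.of ![x, y, z])ᵀ) i j =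
        (![x, y, z] i) ⬝ᵥ (S *ᵥ (![x, y, z] j)) := by
      simp only [mul_apply, dotProduct, mulVec, Fin.sum_univ_three, transpose_apply, of_apply]
      ring
    rw [e, det_fin_three]
    simp only [ent]
    simp only [cons_val_zero, cons_val_one, cons_val, hx, hy, sym y x, sym z x, sym z y]
    ring
  have hpair (i j) (hij : i ≠ j) : speedVec (μ i) (lam i) ⬝ᵥ (S *ᵥ speedVec (μ j) (lam j)) ≠ 0 := by
    intro h
    -- Conjugate isotropic vectors would be linearly dependent, hence equal, as both have first
    -- entry `1`.
    have key (z : Fin 3 → ℂ) : (Matrix.of ![speedVec (μ i) (lam i), speedVec (μ j) (lam j), z]).det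
        = 0 := by
      have := gram _ _ z (h0 i) (h0 j)
      rw [h] at this
      simpa [hdet] using this
    refine hne i j hij ?_
    have k1 := key (Pi.single 2 1)
    have k2 := key (Pi.single 1 1)
    simp [det_fin_three, speedVec] at k1 k2
    ext
    · linear_combination -k1
    · linear_combination k2
  refine ⟨hpair, fun h => ?_⟩
  have := gram _ _ (speedVec (μ 2) (lam 2)) (h0 0) (h0 1)
  have e : (Matrix.of fun i => speedVec (μ i) (lam i)) =
      Matrix.of ![speedVec (μ 0) (lam 0), speedVec (μ 1) (lam 1), speedVec (μ 2) (lam 2)] := by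
    ext i j
    fin_cases i <;> rfl
  rw [← e, h, h0 2] at this
  have p01 := hpair 0 1 (by decide)
  have p02 := hpair 0 2 (by decide)
  have p12 := hpair 1 2 (by decide)
  simp [p01, p02, p12] at this

/-- The straight line in a characteristic direction is a simple wave. -/
theorem isSimpleWave_line {E : MongeAmpere ℂ} {U : Matrix (Fin 3) (Fin 3) ℂ} (hU : U.IsSymm)
    (h0 : E.eval U = 0) {μ l : ℂ}
    (h : speedVec μ l ⬝ᵥ (symS (E.translate U) *ᵥ speedVec μ l) = 0) :
    IsSimpleWave E (fun s => U + s • vecMulVec (speedVec μ l) (speedVec μ l)) (fun _ => μ)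
      (fun _ => l) := by
  have hd (s : ℂ) (j k : Fin 3) : deriv (fun s : ℂ => (U + s • vecMulVec (speedVec μ l) (speedVec μ
      l)) j k) s =
      speedVec μ l j * speedVec μ l k := by
    simp [vecMulVec_apply]
  refine ⟨fun j k => ?_, analyticAt_const, analyticAt_const, .of_forall fun s => ?_,
    .of_forall fun s j k => ?_, ?_⟩
  · simp only [Matrix.add_apply, Matrix.smul_apply, smul_eq_mul]
    fun_prop
  · rw [eval_add_smul_vecMulVec E hU, h0, h]
    ring
  · rw [hd, hd]
    simp [speedVec]
  · rw [hd]
    simp [speedVec]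

end MongeAmpere

/-! ### Möbius transformations and rank-one curves. -/

section Calculus

attribute [local instance] Matrix.linftyOpNormedRing Matrix.linftyOpNormedAlgebra

/-- A matrix entry, as a continuous linear form. -/
def entry (j k : Fin 3) : Matrix (Fin 3) (Fin 3) ℂ →L[ℂ] ℂ :=
  LinearMap.toContinuousLinearMap (Matrix.entryLinearMap ℂ ℂ j k)

variable {F : Type*} [NormedAddCommGroup F] [NormedSpace ℂ F]

theorem analyticAt_of_entries {f : F → Matrix (Fin 3) (Fin 3) ℂ} {x : F}
    (h : ∀ j k, AnalyticAt ℂ (fun y => f y j k) x) : AnalyticAt ℂ f x := by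
  have h1 : f = fun y => ∑ j, ∑ k, f y j k • Matrix.single j k (1 : ℂ) := by
    funext y
    conv_lhs => rw [Matrix.matrix_eq_sum_single (f y)]
    simp [Matrix.smul_single]
  rw [h1]
  exact Finset.analyticAt_fun_sum _ fun j _ => Finset.analyticAt_fun_sum _ fun k _ =>
    (h j k).smul analyticAt_const

theorem analyticAt_entry {f : F → Matrix (Fin 3) (Fin 3) ℂ} {x : F} (h : AnalyticAt ℂ f x)
    (j k : Fin 3) : AnalyticAt ℂ (fun y => f y j k) x :=
  ((entry j k).analyticAt _).comp h

theorem hasFDerivAt_entry {f : F → Matrix (Fin 3) (Fin 3) ℂ} {f' : F →L[ℂ] Matrix (Fin 3) (Fin 3) ℂ}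
    {x : F} (h : HasFDerivAt f f' x) (j k : Fin 3) :
    HasFDerivAt (fun y => f y j k) ((entry j k).comp f') x :=
  (entry j k).hasFDerivAt.comp x h

/-- The Möbius transformation `V ↦ V (1 + C V)⁻¹` of matrices. -/
def mobius (C V : Matrix (Fin 3) (Fin 3) ℂ) : Matrix (Fin 3) (Fin 3) ℂ := V * (1 + C * V)⁻¹

theorem mobius_zero (C : Matrix (Fin 3) (Fin 3) ℂ) : mobius C 0 = 0 := by simp [mobius]

theorem mobius_mul {C V : Matrix (Fin 3) (Fin 3) ℂ} (h : (1 + C * V).det ≠ 0) :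
    mobius C V * (1 + C * V) = V := by
  rw [mobius, Matrix.mul_assoc, Matrix.nonsing_inv_mul _ (isUnit_iff_ne_zero.2 h), Matrix.mul_one]

theorem one_sub_mul_mobius_mul {C V : Matrix (Fin 3) (Fin 3) ℂ} (h : (1 + C * V).det ≠ 0) :
    (1 - C * mobius C V) * (1 + C * V) = 1 := by
  rw [Matrix.sub_mul, Matrix.mul_assoc, mobius_mul h]
  simp

theorem one_sub_mul_mobius {C V : Matrix (Fin 3) (Fin 3) ℂ} (h : (1 + C * V).det ≠ 0) :
    1 - C * mobius C V = (1 + C * V)⁻¹ :=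
  (Matrix.inv_eq_left_inv (one_sub_mul_mobius_mul h)).symm

theorem det_one_sub_mul_mobius {C V : Matrix (Fin 3) (Fin 3) ℂ} (h : (1 + C * V).det ≠ 0) :
    (1 + -C * mobius C V).det ≠ 0 := by
  rw [Matrix.neg_mul, ← sub_eq_add_neg]
  intro h0
  have := congrArg Matrix.det (one_sub_mul_mobius_mul h)
  rw [Matrix.det_mul, h0] at this
  simp at this

theorem mobius_neg_mobius {C V : Matrix (Fin 3) (Fin 3) ℂ} (h : (1 + C * V).det ≠ 0) :
    mobius (-C) (mobius C V) = V := by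
  rw [mobius, Matrix.neg_mul, ← sub_eq_add_neg, one_sub_mul_mobius h,
    Matrix.nonsing_inv_nonsing_inv _ (isUnit_iff_ne_zero.2 h), mobius_mul h]

theorem mobius_isSymm {C V : Matrix (Fin 3) (Fin 3) ℂ} (hC : C.IsSymm) (hV : V.IsSymm)
    (h : (1 + C * V).det ≠ 0) : (mobius C V).IsSymm := by
  have h1 : (1 + V * C).det ≠ 0 := by rwa [Matrix.det_one_add_mul_comm]
  have h2 : (1 + C * V)ᵀ = 1 + V * C := by simp [Matrix.transpose_mul, hC.eq, hV.eq]
  have h3 : (1 + V * C) * V = V * (1 + C * V) := by noncomm_ring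
  have h4 : V = (1 + V * C) * (V * (1 + C * V)⁻¹) := by
    rw [← Matrix.mul_assoc, h3, Matrix.mul_assoc, Matrix.mul_nonsing_inv _ (isUnit_iff_ne_zero.2 h),
      Matrix.mul_one]
  rw [Matrix.IsSymm, mobius, Matrix.transpose_mul, Matrix.transpose_nonsing_inv, h2, hV.eq]
  calc (1 + V * C)⁻¹ * V = (1 + V * C)⁻¹ * ((1 + V * C) * (V * (1 + C * V)⁻¹)) := by rw [← h4]
    _ = V * (1 + C * V)⁻¹ := by
      rw [← Matrix.mul_assoc, Matrix.nonsing_inv_mul _ (isUnit_iff_ne_zero.2 h1), Matrix.one_mul]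

theorem trace_mul_mobius (S : Matrix (Fin 3) (Fin 3) ℂ) {C V : Matrix (Fin 3) (Fin 3) ℂ}
    (h : (1 + C * V).det ≠ 0) :
    (S * (V * (1 + C * V).adjugate)).trace = (1 + C * V).det * (S * mobius C V).trace := by
  have h1 : (1 + C * V).adjugate = (1 + C * V).det • (1 + C * V)⁻¹ := by
    rw [Matrix.inv_def, smul_smul, Ring.inverse_eq_inv', mul_inv_cancel₀ h, one_smul]
  rw [h1, mobius]
  simp

theorem analyticAt_mobius {C : Matrix (Fin 3) (Fin 3) ℂ} {f : F → Matrix (Fin 3) (Fin 3) ℂ} {x : F}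
    (hf : AnalyticAt ℂ f x) (h : (1 + C * f x).det ≠ 0) :
    AnalyticAt ℂ (fun y => mobius C (f y)) x := by
  have : CompleteSpace (Matrix (Fin 3) (Fin 3) ℂ) := FiniteDimensional.complete ℂ _
  obtain ⟨u, hu⟩ := (Matrix.isUnit_iff_isUnit_det _).2 (isUnit_iff_ne_zero.2 h)
  have h1 := analyticAt_inverse (𝕜 := ℂ) u
  rw [hu] at h1
  have h2 : AnalyticAt ℂ (fun y => Ring.inverse (1 + C * f y)) x :=
    AnalyticAt.fun_comp (g := Ring.inverse) (f := fun y => 1 + C * f y) h1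
      (analyticAt_const.add (analyticAt_const.mul hf))
  simp only [mobius, Matrix.nonsing_inv_eq_ringInverse]
  exact hf.mul h2

/-- Differentiate `W (1 + C V) = V`. For symmetric `C` and `W` the two outer factors are transposes
of each other, so rank-one symmetric velocities stay so. -/
theorem fderiv_mobius {C : Matrix (Fin 3) (Fin 3) ℂ} {f : F → Matrix (Fin 3) (Fin 3) ℂ} {x : F}
    (hf : AnalyticAt ℂ f x) (h : (1 + C * f x).det ≠ 0) (v : F) :
    fderiv ℂ (fun y => mobius C (f y)) x v =
      (1 - mobius C (f x) * C) * fderiv ℂ f x v * (1 - C * mobius C (f x)) := by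
  have hW := (analyticAt_mobius hf h).differentiableAt.hasFDerivAt
  have hf' := hf.differentiableAt.hasFDerivAt
  have h1 := hW.mul' ((hf'.const_mul C).const_add 1)
  have hev : ∀ᶠ y in 𝓝 x, (1 + C * f y).det ≠ 0 := by
    have hc : ContinuousAt (fun y => (1 + C * f y).det) x := by
      have := hf.continuousAt
      have h3 : Continuous fun M : Matrix (Fin 3) (Fin 3) ℂ => (1 + C * M).det :=
        (continuous_const.add (continuous_const.mul continuous_id)).matrix_det
      exact h3.continuousAt.comp this
    exact hc.eventually_ne h
  have h2 : (fun y => mobius C (f y) * (1 + C * f y)) =ᶠ[𝓝 x] f :=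
    hev.mono fun y hy => mobius_mul hy
  have h3 := congrArg (fun L => L v) ((h1.congr_of_eventuallyEq h2.symm).unique hf')
  simp at h3
  have h5 : fderiv ℂ (fun y => mobius C (f y)) x v * (1 + C * f x) =
      (1 - mobius C (f x) * C) * fderiv ℂ f x v := by
    rw [Matrix.sub_mul, Matrix.one_mul, Matrix.mul_assoc]
    exact eq_sub_of_add_eq' h3
  rw [one_sub_mul_mobius h, ← h5, Matrix.mul_assoc,
    Matrix.mul_nonsing_inv _ (isUnit_iff_ne_zero.2 h), Matrix.mul_one]

theorem mul_vecMulVec_mul {M N : Matrix (Fin 3) (Fin 3) ℂ} (h : Mᵀ = N) (x : Fin 3 → ℂ) (a : ℂ) :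
    M * (a • vecMulVec x x) * N = a • vecMulVec (M *ᵥ x) (M *ᵥ x) := by
  rw [Matrix.mul_smul, Matrix.smul_mul, Matrix.mul_vecMulVec, Matrix.vecMulVec_mul, ← h,
    Matrix.vecMul_transpose]

/-- A curve with derivative of rank one, the building block of a hydrodynamic reduction of the
equation `tr (S W) = 0`. -/
structure IsRankOneCurve (S : Matrix (Fin 3) (Fin 3) ℂ) (w : ℂ → Matrix (Fin 3) (Fin 3) ℂ)
    (a : ℂ → ℂ) (η : ℂ → Fin 3 → ℂ) : Prop where
  analytic_w : AnalyticAt ℂ w 0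
  analytic_η : ∀ k, AnalyticAt ℂ (fun s => η s k) 0
  analytic_a : AnalyticAt ℂ a 0
  symm : ∀ᶠ s in 𝓝 (0 : ℂ), (w s).IsSymm
  equation : ∀ᶠ s in 𝓝 (0 : ℂ), (S * w s).trace = 0
  velocity : ∀ᶠ s in 𝓝 (0 : ℂ), HasDerivAt w (a s • vecMulVec (η s) (η s)) s
  zero : w 0 = 0
  ne_zero : a 0 ≠ 0

/-- Symmetry is not part of the notion of a simple wave; it propagates from the base point because
the velocity is symmetric. -/
theorem eventually_isSymm_of_isSimpleWave {E : MongeAmpere ℂ}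
    {γ : ℂ → Matrix (Fin 3) (Fin 3) ℂ} {m l : ℂ → ℂ} (hγ : IsSimpleWave E γ m l)
    (h0 : (γ 0).IsSymm) : ∀ᶠ s in 𝓝 (0 : ℂ), (γ s).IsSymm := by
  have key (j k : Fin 3) : ∀ᶠ s in 𝓝 (0 : ℂ), γ s j k = γ s k j := by
    have h1 := (hγ.analytic_curve j k).eventually_analyticAt
    have h2 := (hγ.analytic_curve k j).eventually_analyticAt
    obtain ⟨ρ, hρ, hb⟩ := Metric.eventually_nhds_iff_ball.1 (h1.and (h2.and hγ.velocity))
    refine Metric.eventually_nhds_iff_ball.2 ⟨ρ, hρ, fun s hs => ?_⟩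
    have h3 : γ s j k - γ s k j = γ 0 j k - γ 0 k j := by
      refine Metric.isOpen_ball.is_const_of_deriv_eq_zero (𝕜 := ℂ)
        (f := fun s => γ s j k - γ s k j) (convex_ball (0 : ℂ) ρ).isPreconnected ?_ ?_ hs
        (Metric.mem_ball_self hρ)
      · intro t ht
        exact ((hb t ht).1.differentiableAt.sub
          (hb t ht).2.1.differentiableAt).differentiableWithinAt
      · intro t ht
        obtain ⟨ha, hb, hc⟩ := hb t ht
        rw [deriv_fun_sub ha.differentiableAt hb.differentiableAt, hc j k, hc k j]
        simp [mul_comm]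
    rwa [h0.apply k j, sub_self, sub_eq_zero] at h3
  filter_upwards [eventually_all.2 fun j => eventually_all.2 fun k => key j k] with s hs
  exact Matrix.IsSymm.ext fun i j => hs j i

theorem hasDerivAt_of_entries {f : ℂ → Matrix (Fin 3) (Fin 3) ℂ} {D : Matrix (Fin 3) (Fin 3) ℂ}
    {x : ℂ} (h : ∀ j k, HasDerivAt (fun y => f y j k) (D j k) x) : HasDerivAt f D x := by
  have h1 (M : Matrix (Fin 3) (Fin 3) ℂ) : M = ∑ j, ∑ k, M j k • Matrix.single j k (1 : ℂ) := by
    conv_lhs => rw [Matrix.matrix_eq_sum_single M]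
    simp [Matrix.smul_single]
  rw [funext fun y => h1 (f y), h1 D]
  exact HasDerivAt.fun_sum fun j _ => HasDerivAt.fun_sum fun k _ => (h j k).smul_const _

/-- In the coordinate `W` the equation becomes `tr (S W) = 0` up to the factor `det (1 + C V)`,
which is nonzero near the base point. -/
theorem exists_isRankOneCurve {E : MongeAmpere ℂ} {γ : ℂ → Matrix (Fin 3) (Fin 3) ℂ}
    {m l : ℂ → ℂ} (hγ : IsSimpleWave E γ m l) {U₀ S C : Matrix (Fin 3) (Fin 3) ℂ}
    (hU : U₀.IsSymm) (h0 : γ 0 = U₀) (hC : C.IsSymm)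
    (hE : ∀ V : Matrix (Fin 3) (Fin 3) ℂ, V.IsSymm →
      E.eval (U₀ + V) = (S * (V * (1 + C * V).adjugate)).trace) :
    ∃ w a η, IsRankOneCurve S w a η ∧ η 0 = speedVec (m 0) (l 0) ∧
      ∀ᶠ s in 𝓝 (0 : ℂ), U₀ + mobius (-C) (w s) = γ s := by
  have hV : AnalyticAt ℂ (fun s => γ s - U₀) 0 :=
    (analyticAt_of_entries hγ.analytic_curve).sub analyticAt_const
  have hdet : ∀ᶠ s in 𝓝 (0 : ℂ), (1 + C * (γ s - U₀)).det ≠ 0 := by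
    have h3 : Continuous fun M : Matrix (Fin 3) (Fin 3) ℂ => (1 + C * M).det :=
      (continuous_const.add (continuous_const.mul continuous_id)).matrix_det
    exact (h3.continuousAt.comp hV.continuousAt).eventually_ne (by simp [h0])
  have hdet0 : (1 + C * (γ 0 - U₀)).det ≠ 0 := hdet.self_of_nhds
  have hsymm := eventually_isSymm_of_isSimpleWave hγ (h0 ▸ hU)
  have hw := analyticAt_mobius hV hdet0
  have hspeed (k : Fin 3) : AnalyticAt ℂ (fun s => speedVec (m s) (l s) k) 0 := by
    fin_cases k
    · exact analyticAt_const
    · exact hγ.analytic_m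
    · exact hγ.analytic_l
  refine ⟨fun s => mobius C (γ s - U₀), fun s => deriv (fun s => γ s 0 0) s,
    fun s => (1 - mobius C (γ s - U₀) * C) *ᵥ speedVec (m s) (l s),
    ⟨hw, fun k => ?_, (hγ.analytic_curve 0 0).deriv, ?_, ?_, ?_, ?_, hγ.nondegenerate⟩, ?_, ?_⟩
  · simp only [Matrix.mulVec, dotProduct]
    refine Finset.analyticAt_fun_sum _ fun j _ => AnalyticAt.mul ?_ (hspeed j)
    exact analyticAt_entry (f := fun s => 1 - mobius C (γ s - U₀) * C)
      (analyticAt_const.sub (hw.mul analyticAt_const)) k j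
  · filter_upwards [hdet, hsymm] with s h1 h2
    exact mobius_isSymm hC (h2.sub hU) h1
  · filter_upwards [hdet, hsymm, hγ.equation] with s h1 h2 h3
    have h4 := hE _ (h2.sub hU)
    rw [add_sub_cancel, h3, trace_mul_mobius _ h1] at h4
    exact (mul_eq_zero.1 h4.symm).resolve_left h1
  · filter_upwards [hdet, hsymm, hγ.velocity, hV.eventually_analyticAt,
      eventually_all.2 fun j => eventually_all.2 fun k => (hγ.analytic_curve j
          k).eventually_analyticAt]
      with s h1 h2 h3 h4 h5
    have h6 : HasDerivAt (fun s => γ s - U₀)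
        (deriv (fun s => γ s 0 0) s • vecMulVec (speedVec (m s) (l s)) (speedVec (m s) (l s)))
            s := by
      refine (hasDerivAt_of_entries fun j k => ?_).sub_const U₀
      rw [Matrix.smul_apply, smul_eq_mul, vecMulVec_apply, ← h3 j k]
      exact (h5 j k).differentiableAt.hasDerivAt
    have h7 : deriv (fun s => mobius C (γ s - U₀)) s = (1 - mobius C (γ s - U₀) * C) *
        deriv (fun s => γ s - U₀) s * (1 - C * mobius C (γ s - U₀)) :=
      fderiv_mobius (C := C) h4 h1 1
    have h8 : HasDerivAt (fun s => mobius C (γ s - U₀)) (deriv (fun s => mobius C (γ s - U₀)) s) s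
        :=
      (analyticAt_mobius (C := C) h4 h1).differentiableAt.hasDerivAt
    have h9 : deriv (fun s => γ s - U₀) s = deriv (fun s => γ s 0 0) s •
        vecMulVec (speedVec (m s) (l s)) (speedVec (m s) (l s)) := h6.deriv
    rw [h9, mul_vecMulVec_mul] at h7
    · rwa [h7] at h8
    · simp [Matrix.transpose_mul, hC.eq, (mobius_isSymm hC (h2.sub hU) h1).eq]
  · simp [h0, mobius_zero]
  · simp [h0, mobius_zero]
  · filter_upwards [hdet] with s h1
    rw [mobius_neg_mobius h1]
    simp

end Calculus

/-! ### Degenerate equations: superposition of simple waves. -/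

section Reduction

attribute [local instance] Matrix.linftyOpNormedRing Matrix.linftyOpNormedAlgebra

variable {n : ℕ} {w : Fin n → ℂ → Matrix (Fin 3) (Fin 3) ℂ} {a : Fin n → ℂ → ℂ}
  {η : Fin n → ℂ → Fin 3 → ℂ} {R : Fin n → ℂ} {C : Matrix (Fin 3) (Fin 3) ℂ}

/-- Superposition of curves of matrices, each depending on its own phase. -/
def superpose (w : Fin n → ℂ → Matrix (Fin 3) (Fin 3) ℂ) (R : Fin n → ℂ) :
    Matrix (Fin 3) (Fin 3) ℂ := ∑ i, w i (R i)

theorem eventually_phase {p : ℂ → Prop} (h : ∀ᶠ s in 𝓝 (0 : ℂ), p s) (i : Fin n) :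
    ∀ᶠ R in 𝓝 (0 : Fin n → ℂ), p (R i) :=
  (continuous_apply i).continuousAt.eventually (by simpa using h)

theorem analyticAt_phase {G : Type*} [NormedAddCommGroup G] [NormedSpace ℂ G] {f : ℂ → G} {i : Fin
    n}
    (h : AnalyticAt ℂ f (R i)) : AnalyticAt ℂ (fun R : Fin n → ℂ => f (R i)) R :=
  AnalyticAt.fun_comp (f := fun R : Fin n → ℂ => R i) h
    ((ContinuousLinearMap.proj (R := ℂ) (φ := fun _ : Fin n => ℂ) i).analyticAt R)

theorem analyticAt_superpose (hw : ∀ i, AnalyticAt ℂ (w i) (R i)) :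
    AnalyticAt ℂ (superpose w) R :=
  Finset.analyticAt_fun_sum _ fun i _ => analyticAt_phase (hw i)

theorem hasFDerivAt_phase {G : Type*} [NormedAddCommGroup G] [NormedSpace ℂ G] {f : ℂ → G} {i : Fin
    n}
    {D : G} (h : HasDerivAt f D (R i)) :
    HasFDerivAt (fun R : Fin n → ℂ => f (R i))
      ((ContinuousLinearMap.proj (R := ℂ) (φ := fun _ : Fin n => ℂ) i).smulRight D) R := by
  have h1 := h.hasFDerivAt.comp R
    (ContinuousLinearMap.proj (R := ℂ) (φ := fun _ : Fin n => ℂ) i).hasFDerivAt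
  refine h1.congr_fderiv ?_
  ext v
  simp

theorem fderiv_superpose
    (hv : ∀ i, HasDerivAt (w i) (a i (R i) • vecMulVec (η i (R i)) (η i (R i))) (R i))
    (v : Fin n → ℂ) :
    fderiv ℂ (superpose w) R v =
      ∑ i, (v i * a i (R i)) • vecMulVec (η i (R i)) (η i (R i)) := by
  have h1 : HasFDerivAt (superpose w) _ R :=
    HasFDerivAt.fun_sum fun i (_ : i ∈ Finset.univ) => hasFDerivAt_phase (hv i)
  have h2 : (∑ i, (ContinuousLinearMap.proj (R := ℂ) (φ := fun _ : Fin n => ℂ) i).smulRight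
      (a i (R i) • vecMulVec (η i (R i)) (η i (R i)))) v =
      ∑ i, (v i * a i (R i)) • vecMulVec (η i (R i)) (η i (R i)) := by
    simp [smul_smul]
  exact (congrArg (fun L => L v) h1.fderiv).trans h2

/-- The amplitudes of the phases. -/
def amplitude (C : Matrix (Fin 3) (Fin 3) ℂ) (w : Fin n → ℂ → Matrix (Fin 3) (Fin 3) ℂ)
    (η : Fin n → ℂ → Fin 3 → ℂ) (i : Fin n) (R : Fin n → ℂ) : Fin 3 → ℂ :=
  (1 + mobius (-C) (superpose w R) * C) *ᵥ η i (R i)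

theorem fderiv_mobius_superpose (hC : C.IsSymm) (hw : ∀ i, AnalyticAt ℂ (w i) (R i))
    (hv : ∀ i, HasDerivAt (w i) (a i (R i) • vecMulVec (η i (R i)) (η i (R i))) (R i))
    (hs : ∀ i, (w i (R i)).IsSymm) (hdet : (1 + -C * superpose w R).det ≠ 0) (v : Fin n → ℂ) :
    fderiv ℂ (fun R => mobius (-C) (superpose w R)) R v =
      ∑ i, (v i * a i (R i)) • vecMulVec (amplitude C w η i R) (amplitude C w η i R) := by
  have hsym : (superpose w R).IsSymm := by
    rw [Matrix.IsSymm, superpose, Matrix.transpose_sum]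
    exact Finset.sum_congr rfl fun i _ => hs i
  have hM : (mobius (-C) (superpose w R)).IsSymm := mobius_isSymm hC.neg hsym hdet
  have h1 : fderiv ℂ (fun R => mobius (-C) (superpose w R)) R v =
      (1 - mobius (-C) (superpose w R) * (-C)) * fderiv ℂ (superpose w) R v *
        (1 - (-C) * mobius (-C) (superpose w R)) :=
    fderiv_mobius (analyticAt_superpose hw) hdet v
  rw [h1, fderiv_superpose hv, Finset.mul_sum, Finset.sum_mul]
  refine Finset.sum_congr rfl fun i _ => ?_
  rw [mul_vecMulVec_mul]
  · simp [amplitude]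
  · simp [Matrix.transpose_mul, hM.eq, hC.eq]

theorem analyticAt_amplitude (hw : ∀ i, AnalyticAt ℂ (w i) (R i))
    (hη : ∀ i k, AnalyticAt ℂ (fun s => η i s k) (R i))
    (hdet : (1 + -C * superpose w R).det ≠ 0) (i : Fin n) (k : Fin 3) :
    AnalyticAt ℂ (fun R => amplitude C w η i R k) R := by
  have h1 := analyticAt_mobius (analyticAt_superpose hw) hdet
  simp only [amplitude, Matrix.mulVec, dotProduct]
  refine Finset.analyticAt_fun_sum _ fun j _ => AnalyticAt.mul ?_ (analyticAt_phase (f := fun s =>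
      η i s j) (hη i j))
  exact analyticAt_entry (f := fun R => 1 + mobius (-C) (superpose w R) * C)
    (analyticAt_const.add (h1.mul analyticAt_const)) k j

/-- Only the Möbius factor of amplitude `i` depends on phase `j`, and its derivative has rank one
along amplitude `j`. Commutativity of the reduction comes from this proportionality. -/
theorem pd_amplitude (hC : C.IsSymm) (hw : ∀ i, AnalyticAt ℂ (w i) (R i))
    (hη : ∀ i k, AnalyticAt ℂ (fun s => η i s k) (R i))
    (hv : ∀ i, HasDerivAt (w i) (a i (R i) • vecMulVec (η i (R i)) (η i (R i))) (R i))
    (hs : ∀ i, (w i (R i)).IsSymm) (hdet : (1 + -C * superpose w R).det ≠ 0) {i j : Fin n}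
    (hij : i ≠ j) (k : Fin 3) :
    pd j (fun R => amplitude C w η i R k) R =
      a j (R j) * (amplitude C w η j R ⬝ᵥ (C *ᵥ η i (R i))) * amplitude C w η j R k := by
  have h1 := analyticAt_mobius (analyticAt_superpose hw) hdet
  have h2 : HasFDerivAt (fun R => 1 + mobius (-C) (superpose w R) * C) _ R :=
    (h1.differentiableAt.hasFDerivAt.mul_const' C).const_add 1
  have h3 (p : Fin 3) := hasFDerivAt_phase (R := R) (hη i p).differentiableAt.hasDerivAt
  have h5 : fderiv ℂ (fun R => mobius (-C) (superpose w R)) R (Pi.single j 1) =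
      a j (R j) • vecMulVec (amplitude C w η j R) (amplitude C w η j R) := by
    rw [fderiv_mobius_superpose hC hw hv hs hdet, Finset.sum_eq_single j]
    · simp
    · intro b _ hb
      simp [hb]
    · simp
  have h6 (p : Fin 3) : ∃ L : (Fin n → ℂ) →L[ℂ] ℂ,
      HasFDerivAt (fun R => (1 + mobius (-C) (superpose w R) * C) k p) L R ∧ L (Pi.single j 1) =
      ((a j (R j) • vecMulVec (amplitude C w η j R) (amplitude C w η j R)) * C) k p :=
    ⟨_, hasFDerivAt_entry h2 k p, congrArg (fun M => (M * C) k p) h5⟩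
  choose L hL hL' using h6
  have h4 : HasFDerivAt (fun R => amplitude C w η i R k) _ R :=
    HasFDerivAt.fun_sum fun p (_ : p ∈ Finset.univ) => (hL p).mul (h3 p)
  rw [pd, h4.fderiv]
  simp only [_root_.sum_apply, _root_.add_apply, _root_.smul_apply, smul_eq_mul, hL']
  simp [hij, Matrix.mul_apply, dotProduct, Matrix.mulVec, Fin.sum_univ_three, vecMulVec_apply]
  ring

/-- A degenerate equation has hydrodynamic reductions with prescribed restrictions to the
coordinate axes. -/
theorem MongeAmpere.integrable_of_quartic_eq_zero {E : MongeAmpere ℂ} (hQ : E.quartic = 0) :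
    E.Integrable := by
  intro n U₀ hU h0 hirr γ m l hγ0 hγ hne
  rw [MongeAmpere.irreducibleConic_iff E hU] at hirr
  obtain ⟨C, ε, hC, hε, hE⟩ := MongeAmpere.exists_standard_form E hU h0 hirr
  have hε0 : ε = 0 := by simpa [hirr, hQ] using hε
  set S := MongeAmpere.symS (E.translate U₀) with hS
  have hE (V : Matrix (Fin 3) (Fin 3) ℂ) (hV : V.IsSymm) :
      E.eval (U₀ + V) = (S * (V * (1 + C * V).adjugate)).trace := by
    simpa [hε0] using hE V hV
  choose w a η hw hη hmob using fun i => exists_isRankOneCurve (hγ i) hU (hγ0 i) hC hE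
  have hw0 (R : Fin n → ℂ) (h : ∀ i, w i (R i) = 0) : superpose w R = 0 :=
    Finset.sum_eq_zero fun i _ => h i
  have hamp0 (i : Fin n) : amplitude C w η i 0 = speedVec (m i 0) (l i 0) := by
    simp [amplitude, hw0 0 fun i => (hw i).zero, mobius_zero, hη]
  have hWc : ContinuousAt (superpose w) (0 : Fin n → ℂ) :=
    (analyticAt_superpose fun i => (hw i).analytic_w).continuousAt
  have hdet0 : (1 + -C * superpose w 0).det ≠ 0 := by simp [hw0 0 fun i => (hw i).zero]
  have hdet : ∀ᶠ R in 𝓝 (0 : Fin n → ℂ), (1 + -C * superpose w R).det ≠ 0 := by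
    have h3 : Continuous fun M : Matrix (Fin 3) (Fin 3) ℂ => (1 + -C * M).det :=
      (continuous_const.add (continuous_const.mul continuous_id)).matrix_det
    exact (h3.continuousAt.comp hWc).eventually_ne hdet0
  have hampc (i : Fin n) (k : Fin 3) : AnalyticAt ℂ (fun R => amplitude C w η i R k) 0 :=
    analyticAt_amplitude (fun i => (hw i).analytic_w) (fun i k => (hw i).analytic_η k) hdet0 i k
  have hamp (i : Fin n) : ∀ᶠ R in 𝓝 (0 : Fin n → ℂ), amplitude C w η i R 0 ≠ 0 :=
    (hampc i 0).continuousAt.eventually_ne (by simp [hamp0, speedVec])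
  -- The amplitudes are multiples of `(1, μ, λ)`; at `R = 0` they equal it, so their first entries
  -- do not vanish nearby.
  set mu : Fin n → (Fin n → ℂ) → ℂ :=
    fun i R => amplitude C w η i R 1 / amplitude C w η i R 0 with hmu
  set lam : Fin n → (Fin n → ℂ) → ℂ :=
    fun i R => amplitude C w η i R 2 / amplitude C w η i R 0 with hlam
  have hdist (i j : Fin n) (hij : i ≠ j) : ∀ᶠ R in 𝓝 (0 : Fin n → ℂ),
      (mu i R, lam i R) ≠ (mu j R, lam j R) := by
    have hc (i : Fin n) : ContinuousAt (fun R => (mu i R, lam i R)) (0 : Fin n → ℂ) :=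
      ((hampc i 1).continuousAt.div (hampc i 0).continuousAt (hamp i).self_of_nhds).prodMk
        ((hampc i 2).continuousAt.div (hampc i 0).continuousAt (hamp i).self_of_nhds)
    refine ((hc i).prodMk (hc j)).eventually
      ((isOpen_ne_fun continuous_fst continuous_snd).mem_nhds ?_)
    simpa [hmu, hlam, hamp0, speedVec] using hne i j hij
  have hall : ∀ᶠ R in 𝓝 (0 : Fin n → ℂ), (1 + -C * superpose w R).det ≠ 0 ∧
      (∀ i, amplitude C w η i R 0 ≠ 0) ∧
      (∀ i j, i ≠ j → (mu i R, lam i R) ≠ (mu j R, lam j R)) ∧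
      (∀ i, AnalyticAt ℂ (w i) (R i)) ∧ (∀ i k, AnalyticAt ℂ (fun s => η i s k) (R i)) ∧
      (∀ i, (w i (R i)).IsSymm) ∧ (∀ i, (S * w i (R i)).trace = 0) ∧
      (∀ i, HasDerivAt (w i) (a i (R i) • vecMulVec (η i (R i)) (η i (R i))) (R i)) ∧
      ∀ i, a i (R i) ≠ 0 := by
    refine hdet.and ((eventually_all.2 hamp).and ((eventually_all.2 fun i => eventually_all.2 fun j
        =>
      eventually_all.2 (hdist i j)).and
      ((eventually_all.2 fun i => eventually_phase (hw i).analytic_w.eventually_analyticAt i).and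
      ((eventually_all.2 fun i => eventually_all.2 fun k =>
        eventually_phase ((hw i).analytic_η k).eventually_analyticAt i).and
      ((eventually_all.2 fun i => eventually_phase (hw i).symm i).and
      ((eventually_all.2 fun i => eventually_phase (hw i).equation i).and
      ((eventually_all.2 fun i => eventually_phase (hw i).velocity i).and
      (eventually_all.2 fun i => eventually_phase
        ((hw i).analytic_a.continuousAt.eventually_ne (hw i).ne_zero) i))))))))
  obtain ⟨ρ, hρ, hb⟩ := Metric.eventually_nhds_iff_ball.1 hall
  have hfd (R : Fin n → ℂ) (hR : R ∈ Metric.ball 0 ρ) (j k : Fin 3) (v : Fin n → ℂ) :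
      fderiv ℂ (fun R => (U₀ + mobius (-C) (superpose w R)) j k) R v =
        ∑ i, v i * a i (R i) * (amplitude C w η i R j * amplitude C w η i R k) := by
    obtain ⟨hd, -, -, hwa, -, hs, -, hv, -⟩ := hb R hR
    have h1 := hasFDerivAt_entry ((analyticAt_mobius (analyticAt_superpose hwa)
      hd).differentiableAt.hasFDerivAt) j k
    have h2 := congrArg (fun M => M j k) (fderiv_mobius_superpose hC hwa hv hs hd v)
    simp only [Matrix.add_apply]
    rw [(h1.const_add (U₀ j k)).fderiv]
    refine Eq.trans ?_ (h2.trans ?_)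
    · rfl
    · simp [Matrix.sum_apply, vecMulVec_apply]
  have hspeed (R : Fin n → ℂ) (hR : R ∈ Metric.ball 0 ρ) (i : Fin n) (j : Fin 3) :
      amplitude C w η i R j = amplitude C w η i R 0 * speedVec (mu i R) (lam i R) j := by
    have := (hb R hR).2.1 i
    fin_cases j
    · simp [speedVec]
    · simp [speedVec, hmu]
      field_simp
    · simp [speedVec, hlam]
      field_simp
  have han (R : Fin n → ℂ) (hR : R ∈ Metric.ball 0 ρ) (i : Fin n) (k : Fin 3) :
      AnalyticAt ℂ (fun R => amplitude C w η i R k) R :=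
    analyticAt_amplitude (hb R hR).2.2.2.1 (hb R hR).2.2.2.2.1 (hb R hR).1 i k
  have hsym (R : Fin n → ℂ) (hR : R ∈ Metric.ball 0 ρ) : (mobius (-C) (superpose w R)).IsSymm := by
    refine mobius_isSymm hC.neg ?_ (hb R hR).1
    rw [Matrix.IsSymm, superpose, Matrix.transpose_sum]
    exact Finset.sum_congr rfl fun i _ => (hb R hR).2.2.2.2.2.1 i
  have hpd (R : Fin n → ℂ) (hR : R ∈ Metric.ball 0 ρ) (i j : Fin n) (hij : i ≠ j) (k : Fin 3) :
      pd j (fun R => amplitude C w η i R k / amplitude C w η i R 0) R =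
        a j (R j) * (amplitude C w η j R ⬝ᵥ (C *ᵥ η i (R i))) *
          (amplitude C w η j R k * amplitude C w η i R 0 -
            amplitude C w η i R k * amplitude C w η j R 0) / amplitude C w η i R 0 ^ 2 := by
    obtain ⟨hd, hne0, -, hwa, hηa, hs, -, hv, -⟩ := hb R hR
    have h1 := pd_amplitude hC hwa hηa hv hs hd hij k
    have h2 := pd_amplitude hC hwa hηa hv hs hd hij 0
    rw [pd] at h1 h2 ⊢
    have h3 : HasFDerivAt (fun R => amplitude C w η i R k * (amplitude C w η i R 0)⁻¹) _ R :=
      (han R hR i k).differentiableAt.hasFDerivAt.mul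
        ((hasDerivAt_inv (hne0 i)).comp_hasFDerivAt R (han R hR i 0).differentiableAt.hasFDerivAt)
    simp only [div_eq_mul_inv (amplitude C w η i _ k)]
    rw [h3.fderiv]
    simp [h1, h2]
    have := hne0 i
    field_simp
    ring
  refine ⟨ρ, hρ, fun R => U₀ + mobius (-C) (superpose w R), mu, lam, ⟨?_, ?_, ?_, ?_, ?_, ?_, ?_,
      ?_, ?_⟩,
    fun i => ?_⟩
  · intro j k R hR
    exact analyticAt_const.add (analyticAt_entry (analyticAt_mobius
      (analyticAt_superpose (hb R hR).2.2.2.1) (hb R hR).1) j k)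
  · exact fun i R hR => (han R hR i 1).div (han R hR i 0) ((hb R hR).2.1 i)
  · exact fun i R hR => (han R hR i 2).div (han R hR i 0) ((hb R hR).2.1 i)
  · exact fun R hR => hU.add (hsym R hR)
  · intro R hR
    have h1 : (1 + C * mobius (-C) (superpose w R)).det ≠ 0 := by
      simpa using det_one_sub_mul_mobius (hb R hR).1
    have h2 : mobius C (mobius (-C) (superpose w R)) = superpose w R := by
      simpa using mobius_neg_mobius (hb R hR).1
    rw [hE _ (hsym R hR), trace_mul_mobius _ h1, h2, superpose, Finset.mul_sum, Matrix.trace_sum,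
      Finset.sum_eq_zero fun i _ => (hb R hR).2.2.2.2.2.2.1 i, mul_zero]
  · exact fun R hR => (hb R hR).2.2.1
  -- By `hpd`, `∂ⱼ μⁱ` and `∂ⱼ λⁱ` are `μʲ - μⁱ` and `λʲ - λⁱ` times one common factor.
  · intro R hR i j hij
    rw [hlam, hmu, hpd R hR i j hij, hpd R hR i j hij]
    have h1 := (hb R hR).2.1 i
    have h2 := (hb R hR).2.1 j
    field_simp
  · intro R hR r j k q
    rw [hfd R hR, hfd R hR]
    refine Finset.sum_congr rfl fun i _ => ?_
    rw [hspeed R hR i j, hspeed R hR i k]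
    ring
  · intro R hR i
    rw [pd, hfd R hR, Finset.sum_eq_single i]
    · simpa using ⟨(hb R hR).2.2.2.2.2.2.2.2 i, (hb R hR).2.1 i⟩
    · intro b _ hb
      simp [hb]
    · simp
  -- On a coordinate axis all other waves are at phase `0`, where they vanish.
  · filter_upwards [hmob i] with s hs
    rw [← hs, superpose, Finset.sum_eq_single i]
    · simp
    · intro b _ hb
      simp [hb, (hw b).zero]
    · simp

end Reduction

/-! ### The algebraic obstruction to three-component reductions. -/

section Algebra

variable {A : Type*} [CommRing A]

/-- Contracting `h` with `x × y` gives `x σ = y τ`, so `det (x, y, z) σ = τ det (y, y, z) = 0`,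
while the sum equals `x p * σ`. The determinant stays as a factor because it need not be invertible
in `A`; the identity holds in the ring and can be differentiated. -/
theorem triple_mul_self {x y z u v : Fin 3 → A}
    (h : ∀ p q, x p * u q + u p * x q = y p * v q + v p * y q) (p : Fin 3) :
    z ⬝ᵥ crossProduct x y * ∑ q, (x p * u q + u p * x q) * crossProduct x y q = 0 := by
  have hs (p : Fin 3) : x p * (u ⬝ᵥ crossProduct x y) = y p * (v ⬝ᵥ crossProduct x y) := by
    have h0 := h p 0
    have h1 := h p 1
    have h2 := h p 2
    simp only [cross_apply, vec3_dotProduct, Matrix.cons_val]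
    linear_combination (x 1 * y 2 - x 2 * y 1) * h0 + (x 2 * y 0 - x 0 * y 2) * h1 +
      (x 0 * y 1 - x 1 * y 0) * h2
  generalize hσ : u ⬝ᵥ crossProduct x y = σ at hs
  generalize v ⬝ᵥ crossProduct x y = τ at hs
  have h1 : ∑ q, (x p * u q + u p * x q) * crossProduct x y q = x p * σ := by
    rw [← hσ]
    simp only [cross_apply, vec3_dotProduct, Matrix.cons_val, Fin.sum_univ_three]
    ring
  have h2 : z ⬝ᵥ crossProduct x y * σ = 0 := by
    have h0 := hs 0
    have h1 := hs 1
    have h2 := hs 2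
    simp only [cross_apply, vec3_dotProduct, Matrix.cons_val]
    linear_combination (z 1 * y 0 - z 0 * y 1) * h2 + (z 0 * y 2 - z 2 * y 0) * h1 +
      (z 2 * y 1 - z 1 * y 2) * h0
  rw [h1, mul_left_comm, h2, mul_zero]

theorem triple_smul (x y z t : Fin 3 → A) (p : Fin 3) :
    z ⬝ᵥ crossProduct x y * t p = t ⬝ᵥ crossProduct y z * x p + t ⬝ᵥ crossProduct z x * y p +
      t ⬝ᵥ crossProduct x y * z p := by
  simp only [cross_apply, vec3_dotProduct, Matrix.cons_val]
  fin_cases p <;> simp <;> ring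

/-- A symmetric product with `x` that is also one with `y` is a multiple of that of `x` and `y`, and
its pairing with `S` is this multiple times a nonzero number. -/
theorem eq_zero_of_symmetric_product {x y z u v : Fin 3 → ℂ} {S : Matrix (Fin 3) (Fin 3) ℂ}
    (hS : S.IsSymm) (h : ∀ p q, x p * u q + u p * x q = y p * v q + v p * y q)
    (hd : z ⬝ᵥ crossProduct x y ≠ 0) (hxy : x ⬝ᵥ (S *ᵥ y) ≠ 0)
    (htr : ∑ p, ∑ q, S p q * (x q * u p + u q * x p) = 0) : u = 0 := by
  have key (e f : Fin 3 → ℂ) : (x ⬝ᵥ e) * (u ⬝ᵥ f) + (u ⬝ᵥ e) * (x ⬝ᵥ f) =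
      (y ⬝ᵥ e) * (v ⬝ᵥ f) + (v ⬝ᵥ e) * (y ⬝ᵥ f) := by
    have h1 : ∑ p, ∑ q, (x p * u q + u p * x q) * (e p * f q) =
        ∑ p, ∑ q, (y p * v q + v p * y q) * (e p * f q) := by simp only [h]
    simp only [Fin.sum_univ_three, vec3_dotProduct] at h1 ⊢
    linear_combination h1
  have d1 : x ⬝ᵥ crossProduct y z = z ⬝ᵥ crossProduct x y := by
    simp only [cross_apply, vec3_dotProduct, Matrix.cons_val]
    ring
  have h1 : u ⬝ᵥ crossProduct y z = 0 := by
    have := key (crossProduct y z) (crossProduct y z)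
    rw [dot_self_cross, d1] at this
    have h2 : 2 * (z ⬝ᵥ crossProduct x y) * (u ⬝ᵥ crossProduct y z) = 0 := by
      linear_combination this
    simpa [hd] using h2
  have h2 : u ⬝ᵥ crossProduct x y = 0 := by
    have := key (crossProduct y z) (crossProduct x y)
    rw [dot_self_cross, dot_cross_self, h1, d1] at this
    simpa [hd] using this
  have h3 (p : Fin 3) := triple_smul x y z u p
  simp only [h1, h2, zero_mul, zero_add, add_zero] at h3
  have h4 : u ⬝ᵥ crossProduct z x = 0 := by
    have s1 : S 1 0 = S 0 1 := hS.apply 0 1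
    have s2 : S 2 0 = S 0 2 := hS.apply 0 2
    have s3 : S 2 1 = S 1 2 := hS.apply 1 2
    have h5 : 2 * (x ⬝ᵥ (S *ᵥ y)) * (u ⬝ᵥ crossProduct z x) =
        z ⬝ᵥ crossProduct x y * ∑ p, ∑ q, S p q * (x q * u p + u q * x p) := by
      have e0 := h3 0
      have e1 := h3 1
      have e2 := h3 2
      generalize z ⬝ᵥ crossProduct x y = δ at *
      generalize u ⬝ᵥ crossProduct z x = σ at *
      simp only [Fin.sum_univ_three, vec3_dotProduct, Matrix.mulVec, s1, s2, s3]
      linear_combination (-2) * (S 0 0 * x 0 + S 0 1 * x 1 + S 0 2 * x 2) * e0 -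
        2 * (S 0 1 * x 0 + S 1 1 * x 1 + S 1 2 * x 2) * e1 -
        2 * (S 0 2 * x 0 + S 1 2 * x 1 + S 2 2 * x 2) * e2
    rw [htr, mul_zero] at h5
    simpa [hxy] using h5
  funext p
  have := h3 p
  rw [h4, zero_mul] at this
  simpa [hd] using this

variable [Algebra ℂ A] (ev : A →ₐ[ℂ] ℂ)

theorem ev_derivation_derivation_mul (d e : Derivation ℂ A A) {f g h : A} (hf : ev f = 0)
    (hg : ev g = 0) (hh : ev h = 0) : ev (d (e (f * g * h))) = 0 := by
  simp [Derivation.leibniz, hf, hg, hh]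

/-- The obstruction to the existence of three-component reductions. -/
theorem eq_zero_of_commuting_derivations (d : Fin 3 → Derivation ℂ A A)
    (hd : ∀ i j f, d i (d j f) = d j (d i f)) {w : Matrix (Fin 3) (Fin 3) A} {a : Fin 3 → A}
    {η : Fin 3 → Fin 3 → A} (h : ∀ i p q, d i (w p q) = a i * (η i p * η i q))
    (hw : ∀ p q, ev (w p q) = 0) (ha : ∀ i, ev (a i) ≠ 0)
    (hη : (Matrix.of fun i p => ev (η i p)).det ≠ 0)
    {S : Matrix (Fin 3) (Fin 3) ℂ} (hS : S.IsSymm)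
    (hSη : ∀ i j, i ≠ j → (fun p => ev (η i p)) ⬝ᵥ (S *ᵥ fun p => ev (η j p)) ≠ 0) {ε : ℂ}
    (hG : ∑ p, ∑ q, S p q • w q p + ε • w.det = 0) : ε = 0 := by
  have hc (f g : Fin 3 → A) (p : Fin 3) : ev (crossProduct f g p) =
      crossProduct (fun p => ev (f p)) (fun p => ev (g p)) p := by
    fin_cases p <;> simp [cross_apply]
  have hdot (f g k : Fin 3 → A) : ev (k ⬝ᵥ crossProduct f g) =
      (fun p => ev (k p)) ⬝ᵥ crossProduct (fun p => ev (f p)) (fun p => ev (g p)) := by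
    simp only [cross_apply, vec3_dotProduct, Matrix.cons_val, map_add, map_sub, map_mul]
  have hδ (f : Fin 3 → Fin 3 → ℂ) : (Matrix.of f).det = f 2 ⬝ᵥ crossProduct (f 0) (f 1) := by
    simp only [cross_apply, vec3_dotProduct, Matrix.cons_val, Matrix.det_fin_three, Matrix.of_apply]
    ring
  have hrot (x y z : Fin 3 → ℂ) : x ⬝ᵥ crossProduct y z = z ⬝ᵥ crossProduct x y := by
    simp only [cross_apply, vec3_dotProduct, Matrix.cons_val]
    ring
  set x : Fin 3 → Fin 3 → ℂ := fun i p => ev (η i p) with hx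
  rw [hδ x] at hη
  -- Chosen so that twice the mixed derivative of `w` is the symmetric product of `η i` and `u i j`.
  set u : Fin 3 → Fin 3 → Fin 3 → A := fun i j p => d j (a i) * η i p + 2 * a i * d j (η i p) with
      hu
  have hM (i j p q) : 2 * d j (d i (w p q)) = η i p * u i j q + u i j p * η i q := by
    rw [h]
    simp only [Derivation.leibniz, smul_eq_mul, hu]
    ring
  have hsymm (i j p q) : η i p * u i j q + u i j p * η i q = η j p * u j i q + u j i p * η j q := by
    rw [← hM, ← hM, hd]
  -- Two derivatives of the cubic `det w` vanish where `w = 0`, so only the trace term survives.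
  have hG2 (i j : Fin 3) : ∑ p, ∑ q, S p q * ev (d j (d i (w q p))) = 0 := by
    have h1 := congrArg (fun f => ev (d j (d i f))) hG
    simpa [Matrix.det_fin_three, ev_derivation_derivation_mul, hw] using h1
  have hzero (i j k : Fin 3) (hij : i ≠ j) (hk : x k ⬝ᵥ crossProduct (x i) (x j) ≠ 0) (p q : Fin 3)
      :
      ev (d j (d i (w p q))) = 0 := by
    have hev (p q : Fin 3) : 2 * ev (d j (d i (w p q))) =
        x i p * ev (u i j q) + ev (u i j p) * x i q := by
      simpa [map_ofNat ev 2] using congrArg ev (hM i j p q)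
    have h1 : (fun p => ev (u i j p)) = 0 := by
      refine eq_zero_of_symmetric_product (y := x j) (v := fun p => ev (u j i p)) hS (fun p q =>
          ?_) hk
        (hSη i j hij) ?_
      · simpa using congrArg ev (hsymm i j p q)
      · simp only [← hev]
        simp only [mul_left_comm _ (2 : ℂ), ← Finset.mul_sum, hG2, mul_zero]
    have h2 := hev p q
    rw [congrFun h1 p, congrFun h1 q] at h2
    simpa using h2
  -- Differentiate the identity of `triple_mul_self`. As the second derivatives vanish at the point,
  -- only the term with the third derivative remains.
  have hthird (i j k : Fin 3) (hij : i ≠ j) (hk : x k ⬝ᵥ crossProduct (x i) (x j) ≠ 0) (p : Fin 3) :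
      (fun q => ev (d k (d j (d i (w p q))))) ⬝ᵥ crossProduct (x i) (x j) = 0 := by
    have h1 := triple_mul_self (z := η k) (hsymm i j) p
    simp only [← hM, mul_assoc, ← Finset.mul_sum] at h1
    have h2 := congrArg (fun f => ev (d k f)) h1
    simp only [Derivation.leibniz, smul_eq_mul, map_add, map_mul, map_sum, map_zero, hdot,
      hzero i j k hij hk, zero_mul, Finset.sum_const_zero, mul_zero, add_zero, hc] at h2
    have h3 := (mul_eq_zero.1 ((mul_eq_zero.1 h2).resolve_left hk)).resolve_left
      (by rw [map_ofNat]; exact two_ne_zero)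
    simpa [dotProduct, mul_comm] using h3
  -- Third derivatives commute, so the same matrix annihilates all three cross products of the
  -- independent vectors `x 0, x 1, x 2`.
  have h10 (p q : Fin 3) : ev (d 2 (d 1 (d 0 (w p q)))) = 0 := by
    have t1 := hthird 0 1 2 (by decide) hη p
    have t2 := hthird 1 2 0 (by decide) (by rwa [hrot]) p
    have t3 := hthird 2 0 1 (by decide) (by rwa [← hrot]) p
    simp only [hd 0 1, hd 0 2, hd 1 2] at t2 t3
    have h1 := triple_smul (x 0) (x 1) (x 2) (fun q => ev (d 2 (d 1 (d 0 (w p q))))) q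
    rw [t1, t2, t3] at h1
    simpa [hη] using h1
  -- What is left of the third derivative of `hG` is `ε a₀ a₁ a₂ det (η)²`, the mixed derivative of
  -- `ε det w` at `w = 0`.
  have h1 := congrArg (fun f => ev (d 2 (d 1 (d 0 f)))) hG
  simp [Matrix.det_fin_three, hw, h10] at h1
  refine h1.resolve_right fun h2 => ?_
  simp only [h, map_mul] at h2
  refine mul_ne_zero (mul_ne_zero (mul_ne_zero (ha 0) (ha 1)) (ha 2)) (pow_ne_zero 2 hη) ?_
  rw [← h2]
  simp only [cross_apply, vec3_dotProduct, Matrix.cons_val, hx]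
  ring

end Algebra

/-! ### Analytic functions on an open set as a ring with commuting derivations. -/

section AnalyticFunctions

variable {n : ℕ} {V : TopologicalSpace.Opens (Fin n → ℂ)} {f g : (Fin n → ℂ) → ℂ}

theorem analyticOnNhd_pd {s : Set (Fin n → ℂ)} (hf : AnalyticOnNhd ℂ f s) (i : Fin n) :
    AnalyticOnNhd ℂ (pd i f) s := fun x hx =>
  ((ContinuousLinearMap.apply ℂ ℂ (Pi.single i 1 : Fin n → ℂ)).analyticAt _).comp (hf x hx).fderiv

theorem pd_comm {R : Fin n → ℂ} (hf : AnalyticAt ℂ f R) (i j : Fin n) :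
    pd i (pd j f) R = pd j (pd i f) R := by
  have h1 (i j : Fin n) : pd i (pd j f) R = fderiv ℂ (fderiv ℂ f) R (Pi.single i 1) (Pi.single j
      1) := by
    have h2 : HasFDerivAt (pd j f) _ R :=
      (ContinuousLinearMap.apply ℂ ℂ (Pi.single j 1 : Fin n → ℂ)).hasFDerivAt.comp R
        hf.fderiv.differentiableAt.hasFDerivAt
    rw [pd, h2.fderiv]
    rfl
  rw [h1, h1]
  exact (hf.contDiffAt (n := ⊤)).isSymmSndFDerivAt (by simp) _ _

theorem pd_congr {R : Fin n → ℂ} (h : f =ᶠ[𝓝 R] g) (i : Fin n) : pd i f R = pd i g R := by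
  rw [pd, pd, h.fderiv_eq]

variable (V) in
/-- The algebra of analytic functions on an open set. -/
def analyticAlgebra : Subalgebra ℂ (V → ℂ) where
  carrier := {f | ∃ g : (Fin n → ℂ) → ℂ, AnalyticOnNhd ℂ g V ∧ ∀ x : V, g x = f x}
  mul_mem' := by
    rintro a b ⟨f, hf, hfa⟩ ⟨g, hg, hgb⟩
    exact ⟨fun x => f x * g x, hf.mul hg, fun x => by simp [hfa, hgb]⟩
  add_mem' := by
    rintro a b ⟨f, hf, hfa⟩ ⟨g, hg, hgb⟩
    exact ⟨fun x => f x + g x, hf.add hg, fun x => by simp [hfa, hgb]⟩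
  algebraMap_mem' c := ⟨fun _ => c, analyticOnNhd_const, fun _ => rfl⟩

/-- The restriction of an analytic function. -/
def restrict (f : (Fin n → ℂ) → ℂ) (hf : AnalyticOnNhd ℂ f V) : analyticAlgebra V :=
  ⟨fun x => f x, f, hf, fun _ => rfl⟩

theorem exists_restrict_eq (F : analyticAlgebra V) : ∃ f hf, restrict f hf = F := by
  obtain ⟨F, f, hf, h⟩ := F
  exact ⟨f, hf, Subtype.ext (funext h)⟩

theorem restrict_eq_iff (hf : AnalyticOnNhd ℂ f V) (hg : AnalyticOnNhd ℂ g V) :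
    restrict f hf = restrict g hg ↔ Set.EqOn f g V :=
  ⟨fun h x hx => congrFun (congrArg Subtype.val h) ⟨x, hx⟩,
    fun h => Subtype.ext (funext fun x => h x.2)⟩

/-- The partial derivative of an analytic function on an open set. -/
def analyticPd (i : Fin n) (F : analyticAlgebra V) : analyticAlgebra V :=
  restrict (pd i (exists_restrict_eq F).choose)
    (analyticOnNhd_pd (exists_restrict_eq F).choose_spec.choose i)

/-- Representatives that agree on the open set have equal derivatives there, so the choice does not
matter. -/
theorem analyticPd_restrict (i : Fin n) (hf : AnalyticOnNhd ℂ f V) :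
    analyticPd i (restrict f hf) = restrict (pd i f) (analyticOnNhd_pd hf i) := by
  rw [analyticPd, restrict_eq_iff]
  have h1 := (exists_restrict_eq (restrict f hf)).choose_spec.choose_spec
  rw [restrict_eq_iff] at h1
  exact fun x hx => pd_congr (h1.eventuallyEq_of_mem (V.isOpen.mem_nhds hx)) i

/-- The partial derivatives, as derivations. -/
def analyticDerivation (i : Fin n) : Derivation ℂ (analyticAlgebra V) (analyticAlgebra V) :=
  Derivation.mk'
    { toFun := analyticPd i
      map_add' := fun F G => by
        obtain ⟨f, hf, rfl⟩ := exists_restrict_eq F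
        obtain ⟨g, hg, rfl⟩ := exists_restrict_eq G
        have h1 : restrict f hf + restrict g hg = restrict (fun x => f x + g x) (hf.add hg) := rfl
        rw [h1]
        simp only [analyticPd_restrict]
        refine Subtype.ext (funext fun x => ?_)
        have h2 := (hf x x.2).differentiableAt.hasFDerivAt.add (hg x
            x.2).differentiableAt.hasFDerivAt
        exact congrArg (fun L => L (Pi.single i 1)) h2.fderiv
      map_smul' := fun c F => by
        obtain ⟨f, hf, rfl⟩ := exists_restrict_eq F
        have h1 : c • restrict f hf = restrict (fun x => c * f x) (analyticOnNhd_const.mul hf) :=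
            rfl
        rw [h1]
        simp only [analyticPd_restrict]
        refine Subtype.ext (funext fun x => ?_)
        have h2 := (hf x x.2).differentiableAt.hasFDerivAt.const_mul c
        exact congrArg (fun L => L (Pi.single i 1)) h2.fderiv }
    fun F G => by
      obtain ⟨f, hf, rfl⟩ := exists_restrict_eq F
      obtain ⟨g, hg, rfl⟩ := exists_restrict_eq G
      have h1 : restrict f hf * restrict g hg = restrict (fun x => f x * g x) (hf.mul hg) := rfl
      rw [h1]
      change analyticPd i _ = restrict f hf • analyticPd i _ + restrict g hg • analyticPd i _
      simp only [analyticPd_restrict]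
      refine Subtype.ext (funext fun x => ?_)
      have h2 := (hf x x.2).differentiableAt.hasFDerivAt.mul (hg x x.2).differentiableAt.hasFDerivAt
      exact congrArg (fun L => L (Pi.single i 1)) h2.fderiv

theorem analyticDerivation_restrict (i : Fin n) (hf : AnalyticOnNhd ℂ f V) :
    analyticDerivation i (restrict f hf) = restrict (pd i f) (analyticOnNhd_pd hf i) :=
  analyticPd_restrict i hf

theorem analyticDerivation_comm (i j : Fin n) (F : analyticAlgebra V) :
    analyticDerivation i (analyticDerivation j F) = analyticDerivation j (analyticDerivation i
        F) := by
  obtain ⟨f, hf, rfl⟩ := exists_restrict_eq F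
  simp only [analyticDerivation_restrict, restrict_eq_iff]
  exact fun x hx => pd_comm (hf x hx) i j

/-- Evaluation at a point. -/
def analyticEval (x : V) : analyticAlgebra V →ₐ[ℂ] ℂ :=
  (Pi.evalAlgHom ℂ (fun _ : V => ℂ) x).comp (analyticAlgebra V).val

theorem analyticEval_restrict (x : V) (hf : AnalyticOnNhd ℂ f V) :
    analyticEval x (restrict f hf) = f x := rfl

end AnalyticFunctions

/-! ### Nondegenerate equations are not integrable. -/

section Obstruction

attribute [local instance] Matrix.linftyOpNormedRing Matrix.linftyOpNormedAlgebra

/-- Testing the quasilinear system on `R_x = eᵢ`, with `x` as one of the two variables, gives `∂ᵢ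
u_{jl}` as the `j`-th speed times `∂ᵢ u_{1l}`; symmetry allows a second application. -/
theorem IsHydrodynamicReduction.pd_eq {E : MongeAmpere ℂ} {n : ℕ} {ρ : ℝ}
    {U : (Fin n → ℂ) → Matrix (Fin 3) (Fin 3) ℂ} {mu lam : Fin n → (Fin n → ℂ) → ℂ}
    (h : IsHydrodynamicReduction E (Metric.ball 0 ρ) U mu lam) {R : Fin n → ℂ}
    (hR : R ∈ Metric.ball 0 ρ) (i : Fin n) (p q : Fin 3) :
    pd i (fun R => U R p q) R = pd i (fun R => U R 0 0) R *
      (speedVec (mu i R) (lam i R) p * speedVec (mu i R) (lam i R) q) := by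
  have h1 (j l : Fin 3) : pd i (fun R => U R j l) R =
      speedVec (mu i R) (lam i R) j * pd i (fun R => U R 0 l) R := by
    have := h.quasilinear R hR (Pi.single i 1) j 0 l
    have h2 (k : Fin 3) : (fun i' => speedVec (mu i' R) (lam i' R) k * (Pi.single i 1 : Fin n → ℂ)
        i') =
        speedVec (mu i R) (lam i R) k • (Pi.single i 1 : Fin n → ℂ) := by
      funext i'
      by_cases hi : i' = i
      · subst hi
        simp
      · simp [hi]
    rw [h2, h2, map_smul, map_smul] at this
    simpa [speedVec, pd] using this
  have h2 : pd i (fun R => U R 0 q) R = pd i (fun R => U R q 0) R := by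
    refine pd_congr ?_ i
    filter_upwards [Metric.isOpen_ball.mem_nhds hR] with x hx
    exact (h.symm x hx).apply q 0
  rw [h1 p q, h2, h1 q 0]
  ring

/-- Three straight lines in distinct characteristic directions already suffice as initial waves.
Distinct points of a nondegenerate conic are independent and pairwise non-conjugate, as the
obstruction requires. -/
theorem MongeAmpere.not_integrable {E : MongeAmpere ℂ} (hQ : E.quartic ≠ 0) : ¬ E.Integrable := by
  intro hE
  obtain ⟨U₀, hU, h0, hdet⟩ := exists_det_symS_ne_zero hQ
  obtain ⟨C, ε, hC, hε, hform⟩ := exists_standard_form E hU h0 hdet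
  obtain ⟨μ, ν, hne, hcon⟩ := exists_points_of_conic (symS_isSymm (E.translate U₀)) hdet
  obtain ⟨hconj, hind⟩ := det_ne_zero_of_conic (symS_isSymm (E.translate U₀)) hdet hne hcon
  obtain ⟨ρ, hρ, U, mu, lam, hred, hax⟩ := hE 3 U₀ hU h0 ((irreducibleConic_iff E hU).2 hdet)
    _ _ _ (fun i => by simp) (fun i => isSimpleWave_line hU h0 (hcon i)) hne
  have hmem0 : (0 : Fin 3 → ℂ) ∈ Metric.ball 0 ρ := Metric.mem_ball_self hρ
  have hU0 : U 0 = U₀ := by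
    have := (hax 0).self_of_nhds
    simpa using this
  have hpd0 (i : Fin 3) (p q : Fin 3) : pd i (fun R => U R p q) 0 =
      speedVec (μ i) (ν i) p * speedVec (μ i) (ν i) q := by
    have h1 := (hred.analytic_U p q 0 hmem0).differentiableAt.hasFDerivAt
    have hl : HasDerivAt (fun s : ℂ => s • (Pi.single i 1 : Fin 3 → ℂ)) (Pi.single i 1) 0 := by
      simpa using (hasDerivAt_id (0 : ℂ)).smul_const (Pi.single i 1 : Fin 3 → ℂ)
    have h2 : HasDerivAt (fun s : ℂ => U (s • (Pi.single i 1 : Fin 3 → ℂ)) p q)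
        (pd i (fun R => U R p q) 0) 0 :=
      HasFDerivAt.comp_hasDerivAt (l := fun R => U R p q) 0 (by simpa using h1) hl
    have h3 : HasDerivAt (fun s : ℂ =>
        (U₀ + s • vecMulVec (speedVec (μ i) (ν i)) (speedVec (μ i) (ν i))) p q)
        (speedVec (μ i) (ν i) p * speedVec (μ i) (ν i) q) 0 := by
      simpa [vecMulVec_apply] using ((hasDerivAt_id (0 : ℂ)).mul_const
        (speedVec (μ i) (ν i) p * speedVec (μ i) (ν i) q)).const_add (U₀ p q)
    refine h2.unique (h3.congr_of_eventuallyEq ?_)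
    filter_upwards [hax i] with s hs
    rw [← hs, ← Pi.single_smul]
    simp
  have hamp0 (i : Fin 3) : pd i (fun R => U R 0 0) 0 = 1 := by simp [hpd0, speedVec]
  have hspeed0 (i : Fin 3) : speedVec (mu i 0) (lam i 0) = speedVec (μ i) (ν i) := by
    funext p
    have h1 := hred.pd_eq hmem0 i p 0
    rw [hpd0, hamp0] at h1
    simpa [speedVec] using h1.symm
  have han (R : Fin 3 → ℂ) (hR : R ∈ Metric.ball 0 ρ) : AnalyticAt ℂ (fun R => U R - U₀) R :=
    (analyticAt_of_entries fun j k => hred.analytic_U j k R hR).sub analyticAt_const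
  have hdet' : ∀ᶠ R in 𝓝 (0 : Fin 3 → ℂ), (1 + C * (U R - U₀)).det ≠ 0 := by
    have h3 : Continuous fun M : Matrix (Fin 3) (Fin 3) ℂ => (1 + C * M).det :=
      (continuous_const.add (continuous_const.mul continuous_id)).matrix_det
    exact (h3.continuousAt.comp (han 0 hmem0).continuousAt).eventually_ne (by simp [hU0])
  obtain ⟨r, hr, hb⟩ := Metric.eventually_nhds_iff_ball.1
    (hdet'.and (Metric.isOpen_ball.mem_nhds hmem0))
  set V : TopologicalSpace.Opens (Fin 3 → ℂ) := ⟨Metric.ball 0 r, Metric.isOpen_ball⟩ with hV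
  have hsym (R : Fin 3 → ℂ) (hR : R ∈ V) : (U R - U₀).IsSymm := (hred.symm R (hb R hR).2).sub hU
  have hwsym (R : Fin 3 → ℂ) (hR : R ∈ V) : (mobius C (U R - U₀)).IsSymm :=
    mobius_isSymm hC (hsym R hR) (hb R hR).1
  have hwan (R : Fin 3 → ℂ) (hR : R ∈ V) : AnalyticAt ℂ (fun R => mobius C (U R - U₀)) R :=
    analyticAt_mobius (han R (hb R hR).2) (hb R hR).1
  have hw (p q : Fin 3) : AnalyticOnNhd ℂ (fun R => mobius C (U R - U₀) p q) V :=
    fun R hR => analyticAt_entry (hwan R hR) p q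
  have ha (i : Fin 3) : AnalyticOnNhd ℂ (pd i fun R => U R 0 0) V := fun R hR =>
    analyticOnNhd_pd (hred.analytic_U 0 0) i R (hb R hR).2
  have hη (i p : Fin 3) : AnalyticOnNhd ℂ
      (fun R => ((1 - mobius C (U R - U₀) * C) *ᵥ speedVec (mu i R) (lam i R)) p) V := by
    intro R hR
    simp only [Matrix.mulVec, dotProduct]
    refine Finset.analyticAt_fun_sum _ fun j _ => AnalyticAt.mul ?_ ?_
    · exact analyticAt_entry (f := fun R => 1 - mobius C (U R - U₀) * C)
        (analyticAt_const.sub ((hwan R hR).mul analyticAt_const)) p j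
    · fin_cases j
      · exact analyticAt_const
      · exact hred.analytic_mu i R (hb R hR).2
      · exact hred.analytic_lam i R (hb R hR).2
  have hpdw (R : Fin 3 → ℂ) (hR : R ∈ V) (i p q : Fin 3) :
      pd i (fun R => mobius C (U R - U₀) p q) R = pd i (fun R => U R 0 0) R *
        (((1 - mobius C (U R - U₀) * C) *ᵥ speedVec (mu i R) (lam i R)) p *
          ((1 - mobius C (U R - U₀) * C) *ᵥ speedVec (mu i R) (lam i R)) q) := by
    have h1 : fderiv ℂ (fun R => U R - U₀) R (Pi.single i 1) = pd i (fun R => U R 0 0) R •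
        vecMulVec (speedVec (mu i R) (lam i R)) (speedVec (mu i R) (lam i R)) := by
      ext p q
      have h2 := hasFDerivAt_entry (han R (hb R hR).2).differentiableAt.hasFDerivAt p q
      have h3 : HasFDerivAt (fun R => U R p q - U₀ p q) _ R :=
        (hred.analytic_U p q R (hb R hR).2).differentiableAt.hasFDerivAt.sub_const (U₀ p q)
      rw [Matrix.smul_apply, smul_eq_mul, vecMulVec_apply, ← hred.pd_eq (hb R hR).2 i p q]
      exact congrArg (fun L => L (Pi.single i 1)) (h2.unique h3)
    have h2 := hasFDerivAt_entry (hwan R hR).differentiableAt.hasFDerivAt p q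
    have h3 : fderiv ℂ (fun R => mobius C (U R - U₀)) R (Pi.single i 1) = _ :=
      fderiv_mobius (han R (hb R hR).2) (hb R hR).1 (Pi.single i 1)
    rw [h1, mul_vecMulVec_mul] at h3
    · rw [pd, h2.fderiv]
      refine (congrArg (fun M => M p q) h3).trans ?_
      simp [vecMulVec_apply]
    · simp [Matrix.transpose_mul, hC.eq, (hwsym R hR).eq]
  -- The standard form divided by `det (1 + C V)`, with `det V = det W det (1 + C V)`.
  have hGR (R : Fin 3 → ℂ) (hR : R ∈ V) :
      (symS (E.translate U₀) * mobius C (U R - U₀)).trace + ε * (mobius C (U R - U₀)).det = 0 := by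
    have h1 := hform _ (hsym R hR)
    have hd := (hb R hR).1
    have h2 := congrArg Matrix.det (mobius_mul hd)
    rw [Matrix.det_mul] at h2
    rw [add_sub_cancel, hred.equation R (hb R hR).2, trace_mul_mobius _ hd, ← h2] at h1
    have h3 : (1 + C * (U R - U₀)).det * ((symS (E.translate U₀) * mobius C (U R - U₀)).trace +
        ε * (mobius C (U R - U₀)).det) = 0 := by linear_combination -h1
    exact (mul_eq_zero.1 h3).resolve_left hd
  have h0V : (0 : Fin 3 → ℂ) ∈ V := Metric.mem_ball_self hr
  have hη0 (i : Fin 3) : (1 - mobius C (U 0 - U₀) * C) *ᵥ speedVec (mu i 0) (lam i 0) =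
      speedVec (μ i) (ν i) := by
    rw [hU0, sub_self, mobius_zero, hspeed0]
    simp
  have hε0 : ε = 0 := by
    refine eq_zero_of_commuting_derivations (analyticEval ⟨0, h0V⟩) (fun i => analyticDerivation i)
      analyticDerivation_comm (w := Matrix.of fun p q => restrict _ (hw p q))
      (a := fun i => restrict _ (ha i)) (η := fun i p => restrict _ (hη i p)) ?_ ?_ ?_ ?_
      (symS_isSymm (E.translate U₀)) ?_ ?_
    · intro i p q
      rw [Matrix.of_apply, analyticDerivation_restrict]
      exact Subtype.ext (funext fun R => hpdw R R.2 i p q)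
    · intro p q
      rw [Matrix.of_apply, analyticEval_restrict]
      simp [hU0, mobius_zero]
    · intro i
      rw [analyticEval_restrict, hamp0]
      exact one_ne_zero
    · simpa only [analyticEval_restrict, hη0] using hind
    · intro i j hij
      simpa only [analyticEval_restrict, hη0] using hconj i j hij
    · refine Subtype.ext (funext fun R => ?_)
      have h1 := hGR R R.2
      simp [Matrix.trace, Matrix.mul_apply, Fin.sum_univ_three, Matrix.det_fin_three] at h1
      simp [Fin.sum_univ_three, Matrix.det_fin_three, restrict]
      linear_combination h1
  exact hQ (by simpa [hε0] using hε)

theorem MongeAmpere.integrable_iff {E : MongeAmpere ℂ} : E.Integrable ↔ E.quartic = 0 :=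
  ⟨fun h => by_contra fun hQ => not_integrable hQ h, integrable_of_quartic_eq_zero⟩

end Obstruction

theorem MongeAmpere.quartic_complexify (E : MongeAmpere ℝ) :
    E.complexify.quartic = (E.quartic : ℂ) := by
  simp [quartic, complexify]

theorem quartic_hessOne : hessOne.quartic ≠ 0 := by
  norm_num [MongeAmpere.quartic, hessOne]

theorem quartic_hessLaplace : hessLaplace.quartic ≠ 0 := by
  norm_num [MongeAmpere.quartic, hessLaplace]

end SymplecticMA

end

theorem mainTheorem6 :
    -- equations with complex coefficients
    (∀ E : SymplecticMA.MongeAmpere ℂ, E ≠ 0 →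
      (E.Integrable ↔ E.Linearizable) ∧ (E.Linearizable ↔ E.quartic = 0)) ∧
    -- equations with real coefficients, linearized over the real numbers
    (∀ E : SymplecticMA.MongeAmpere ℝ, E ≠ 0 →
      (E.complexify.Integrable ↔ E.Linearizable) ∧ (E.Linearizable ↔ E.quartic = 0)) ∧
    -- the two examples
    ¬ SymplecticMA.hessOne.Integrable ∧
    ¬ SymplecticMA.hessLaplace.Integrable ∧
    -- the quartic is the equation of the dual variety of the Lagrangian Grassmannian
    (∀ E : SymplecticMA.MongeAmpere ℂ, E ≠ 0 → (E.quartic = 0 ↔ E.IsTangentHyperplane)) ∧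
    (∀ p : MvPolynomial SymplecticMA.Idx ℂ,
      (∀ E : SymplecticMA.MongeAmpere ℂ, E.IsTangentHyperplane → MvPolynomial.eval E p = 0) ↔
        SymplecticMA.quarticPoly ∣ p) := by
  refine ⟨fun E hE => ?_, fun E hE => ?_, ?_, ?_, fun E hE => ?_, ?_⟩
  · exact ⟨SymplecticMA.MongeAmpere.integrable_iff.trans
      (SymplecticMA.MongeAmpere.linearizable_iff hE).symm,
      SymplecticMA.MongeAmpere.linearizable_iff hE⟩
  · refine ⟨SymplecticMA.MongeAmpere.integrable_iff.trans ?_,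
      SymplecticMA.MongeAmpere.linearizable_iff hE⟩
    rw [SymplecticMA.MongeAmpere.quartic_complexify, Complex.ofReal_eq_zero]
    exact (SymplecticMA.MongeAmpere.linearizable_iff hE).symm
  · exact SymplecticMA.MongeAmpere.not_integrable SymplecticMA.quartic_hessOne
  · exact SymplecticMA.MongeAmpere.not_integrable SymplecticMA.quartic_hessLaplace
  · exact SymplecticMA.MongeAmpere.quartic_eq_zero_iff_isTangentHyperplane hE
  · exact SymplecticMA.vanishing_iff_quarticPoly_dvd
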